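/- **Theorem (Influence function).** Let $s_{\max}\ge 1$, let $\mathcal Y\subset\mathbb R$ be bounded, let $\delta_1,\dots,\delta_{s_{\max}}\in(0,\infty)$, and let $f(s,\cdot):\mathbb R^{d}\to\mathbb R^{e}$, $s\ge 1$, be fixed measurable maps. An observation is $D=(Y,S,(W_s,R_s)_{s=1}^{S})$ with outcome $Y\in\mathcal Y$, number of segments $S\in\{1,\dots,s_{\max}\}$, binary treatments $W_s\in\{0,1\}$ and representations $R_s\in\mathbb R^{d}$. Put $\overline W_{s-1}=(W_1,\dots,W_{s-1})$ and $\overline H_s=\{S,\overline W_{s-1},(f(s',R_{s'}))_{s'=1}^{s}\}$. For a law $P$ of $D$ let $$p_s(\overline w_{s-1})=P(W_s=1\mid \overline W_{s-1}=\overline w_{s-1},\,S\ge s),\qquad \pi_s(\overline H_s)=P(W_s=1\mid\overline H_s),$$ $$dQ_s(w;\overline w_{s-1})=\frac{w\,\delta_s p_s(\overline w_{s-1})+(1-w)\{1-p_s(\overline w_{s-1})\}}{\delta_s p_s(\overline w_{s-1})+1-p_s(\overline w_{s-1})}.$$ The model $\mathcal M$ consists of all laws $P$ of $D$ for which there is a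 constant $c>0$ (which may depend on $P$) such that, $P$-almost surely, $\pi_s(\overline H_s)\ge c\,p_s(\overline W_{s-1})$ and $1-\pi_s(\overline H_s)\ge c\{1-p_s(\overline W_{s-1})\}$ for all $s\le S$. The target parameter, as a functional of $P\in\mathcal M$, is the mean outcome under the stochastic intervention given by the g-formula (with $L_s=f(s,R_s)$) $$\Psi(\boldsymbol\delta)=\mathbb E\Big[\int\sum_{\overline w_S\in\{0,1\}^S}\mathbb E[Y\mid \overline W_S=\overline w_S,\overline L_S=\overline l_S,S]\prod_{s=1}^{S}dQ_s(w_s;\overline w_{s-1})\,dF(l_s\mid \overline W_{s-1}=\overline w_{s-1},\overline L_{s-1}=\overline l_{s-1},S)\Big].$$ Define $m_S(\overline H_S,W_S)=\mathbb E[Y\mid\overline H_S,W_S]$, for $1\le s<S$ recursively $$m_s(\overline H_s,W_s)=\mathbb E\Big[\tfrac{\delta_{s+1}p_{s+1}(\overline W_s)\,m_{s+1}(\overline H_{s+1},1)+\{1-p_{s+1}(\overline W_s)\}\,m_{s+1}(\overline H_{s+1},0)}{\delta_{s+1}p_{s+1}(\overline W_s)+1-p_{s+1}(\overline W_s)}\,\Big|\,\overline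 H_s,W_s\Big],$$ and $$\omega_s(\overline H_s,W_s)=\frac{\delta_sW_s\frac{p_s(\overline W_{s-1})}{\pi_s(\overline H_s)}+(1-W_s)\frac{1-p_s(\overline W_{s-1})}{1-\pi_s(\overline H_s)}}{\delta_sp_s(\overline W_{s-1})+1-p_s(\overline W_{s-1})},$$ $$\tilde m_s(\overline W_{s-1},w)=\mathbb E\Big[\prod_{s'=1}^{s-1}\omega_{s'}(\overline H_{s'},W_{s'})\;m_s(\overline H_s,w)\,\Big|\,\overline W_{s-1},\,S\ge s\Big].$$ Then for every $P\in\mathcal M$ the influence function of $\Psi(\boldsymbol\delta)$ at $P$ is $$\begin{aligned}\psi(D)=&\sum_{s=1}^{S}\Big\{\prod_{s'=1}^{s-1}\omega_{s'}\Big\}\frac{\delta_sp_s\,m_s(\overline H_s,1)\big\{1-\frac{W_s}{\pi_s}\big\}+(1-p_s)\,m_s(\overline H_s,0)\big\{1-\frac{1-W_s}{1-\pi_s}\big\}}{\delta_sp_s+1-p_s}\\&+\sum_{s=1}^{S}\frac{\delta_s(W_s-p_s)\{\tilde m_s(\overline W_{s-1},1)-\tilde m_s(\overline W_{s-1},0)\}}{(\delta_sp_s+1-p_s)^2}+\Big\{\prod_{s=1}^{S}\omega_s\Big\}Y-\Psi(\boldsymbol\delta),\end{aligned}$$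 where $p_s=p_s(\overline W_{s-1})$, $\pi_s=\pi_s(\overline H_s)$, $\omega_s=\omega_s(\overline H_s,W_s)$, and $0/0=0$. That is: $\psi\in L^2(P)$, $\mathbb E_P[\psi]=0$, and for every one-dimensional submodel $(P_t)_{t>0}\subset\mathcal M$ that is differentiable in quadratic mean at $P$ as $t\downarrow0$ with score $g$, $$\lim_{t\downarrow0}\frac{\Psi(\boldsymbol\delta)(P_t)-\Psi(\boldsymbol\delta)(P)}{t}=\mathbb E_P[\psi g];$$ and $\psi$ is, up to $P$-null sets, the only function with these properties. -/

import Mathlib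

open MeasureTheory ProbabilityTheory Filter Topology

noncomputable section

/-! ### Influence functions of functionals on a set of probability laws -/

/-- The path `t ↦ Q t` of probability laws is differentiable in quadratic mean at `P` (as `t ↓ 0`)
with score `g ∈ L²(P)`:
`∫ ((√dQ_t - √dP) / t - g √dP / 2)² → 0`, densities being taken with respect to `P + Q_t`. -/
def HasScore {Ω : Type*} [MeasurableSpace Ω] (P : ProbabilityMeasure Ω)
    (Q : ℝ → ProbabilityMeasure Ω) (g : Ω → ℝ) : Prop :=
  MemLp g 2 (P : Measure Ω) ∧
  Tendsto
    (fun t : ℝ =>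
      ∫⁻ x, ENNReal.ofReal
        (((√((Q t : Measure Ω).rnDeriv ((P : Measure Ω) + (Q t : Measure Ω)) x).toReal
            - √((P : Measure Ω).rnDeriv ((P : Measure Ω) + (Q t : Measure Ω)) x).toReal) / t
          - (1 / 2) * g x
            * √((P : Measure Ω).rnDeriv ((P : Measure Ω) + (Q t : Measure Ω)) x).toReal) ^ 2)
        ∂((P : Measure Ω) + (Q t : Measure Ω)))
    (𝓝[>] 0) (𝓝 0)

/-- `ψ` is an influence function at `P` of the functional `Ψ` on the model `M`: it is square
integrable with mean zero, and along every one-dimensional submodel of `M` that passes through `P`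
at `t = 0` and is differentiable in quadratic mean there, with score `g`, the derivative of `Ψ`
at `t = 0` exists and equals `E_P[ψ g]`. -/
def IsInfluenceFunction {Ω : Type*} [MeasurableSpace Ω] (M : Set (ProbabilityMeasure Ω))
    (Ψ : ProbabilityMeasure Ω → ℝ) (P : ProbabilityMeasure Ω) (ψ : Ω → ℝ) : Prop :=
  MemLp ψ 2 (P : Measure Ω) ∧
  ∫ x, ψ x ∂(P : Measure Ω) = 0 ∧
  ∀ (Q : ℝ → ProbabilityMeasure Ω) (g : Ω → ℝ),
    (∀ᶠ t in 𝓝[>] (0 : ℝ), Q t ∈ M) → HasScore P Q g →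
    Tendsto (fun t : ℝ => (Ψ (Q t) - Ψ P) / t) (𝓝[>] 0)
      (𝓝 (∫ x, ψ x * g x ∂(P : Measure Ω)))

namespace GPI

/-! ### The observed data

Segments are numbered from `0`: the segments of a record of length `S` are `0, …, S - 1`. -/

/-- One observation `(Y, S, (W_s, R_s)_{s < S})`: outcome, number of segments, and for every segment
the binary treatment feature and the internal representation in `ℝ ^ d`. -/
abbrev Obs (d : ℕ) : Type := ℝ × (Σ n : ℕ, (Fin n → Bool × (Fin d → ℝ)))

/-- The outcome `Y`. -/
def outcome {d : ℕ} (D : Obs d) : ℝ := D.1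

/-- The number `S` of segments. -/
def len {d : ℕ} (D : Obs d) : ℕ := D.2.1

/-- The treatment feature `W_s` of segment `s < S`. -/
def treat {d : ℕ} (s : ℕ) (D : Obs d) : Bool :=
  if h : s < D.2.1 then (D.2.2 ⟨s, h⟩).1 else false

/-- The learned feature `f(s, R_s)` of segment `s < S`. -/
def feat {d e : ℕ} (f : ℕ → (Fin d → ℝ) → (Fin e → ℝ)) (s : ℕ) (D : Obs d) : Fin e → ℝ :=
  if h : s < D.2.1 then f s (D.2.2 ⟨s, h⟩).2 else 0

/-- The treatment history `(W_0, …, W_{s-1})` before segment `s`. -/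
def treatHist {d : ℕ} (s : ℕ) (D : Obs d) : Fin s → Bool := fun j => treat j D

/-- Values of the history at segment `s`: length, earlier treatments, features up to `s`. -/
abbrev Hist (e s : ℕ) : Type := ℕ × (Fin s → Bool) × (Fin (s + 1) → Fin e → ℝ)

/-- The history `H_s = (S, (W_j)_{j < s}, (f(j, R_j))_{j ≤ s})`. -/
def hist {d e : ℕ} (f : ℕ → (Fin d → ℝ) → (Fin e → ℝ)) (s : ℕ) (D : Obs d) : Hist e s :=
  (len D, treatHist s D, fun j => feat f j D)

/-- The history together with the current treatment, `(H_s, W_s)`. -/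
def histTreat {d e : ℕ} (f : ℕ → (Fin d → ℝ) → (Fin e → ℝ)) (s : ℕ) (D : Obs d) :
    Hist e s × Bool :=
  (hist f s D, treat s D)

/-- The event that segment `s` exists and is preceded by the treatments `w`. -/
def cell {d : ℕ} (s : ℕ) (w : Fin s → Bool) : Set (Obs d) :=
  {D | s < len D ∧ treatHist s D = w}

/-- The numerical value of a binary treatment. -/
def num (w : Bool) : ℝ := if w then 1 else 0

/-! ### Treatment probabilities and the stochastic intervention -/

/-- `p_s(w) = P(W_s = 1 ∣ W_0, …, W_{s-1} = w, segment s exists)`. -/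
def trtProb {d : ℕ} (P : ProbabilityMeasure (Obs d)) (s : ℕ) (w : Fin s → Bool) : ℝ :=
  (cond (P : Measure (Obs d)) (cell s w)).real {D | treat s D = true}

/-- The propensity score `π_s(h) = P(W_s = 1 ∣ H_s = h)`. -/
def propensity {d e : ℕ} (P : ProbabilityMeasure (Obs d)) (f : ℕ → (Fin d → ℝ) → (Fin e → ℝ))
    (s : ℕ) (h : Hist e s) : ℝ :=
  (condDistrib (treat s) (hist f s) (P : Measure (Obs d)) h).real {true}

/-- The intervention probability `dQ_s(w)` as a function of `δ_s` and `p_s`. -/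
def dQ (δ p : ℝ) (w : Bool) : ℝ :=
  (num w * δ * p + (1 - num w) * (1 - p)) / (δ * p + 1 - p)

/-! ### The target parameter -/

/-- The outcome regression `E[Y ∣ H_s = h, W_s = w]`. -/
def outcomeReg {d e : ℕ} (P : ProbabilityMeasure (Obs d)) (f : ℕ → (Fin d → ℝ) → (Fin e → ℝ))
    (s : ℕ) (h : Hist e s) (w : Bool) : ℝ :=
  ∫ y, y ∂(condDistrib outcome (histTreat f s) (P : Measure (Obs d)) (h, w))

/-- The law of the history `H_s` on records of length `n` when, at each segment `j < s`, the
treatment is drawn from `dQ_j` and the next history from its observed conditional law given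
`(H_j, W_j)`. Its total mass is `P(S = n)`. -/
def interventionLaw {d e : ℕ} (P : ProbabilityMeasure (Obs d))
    (f : ℕ → (Fin d → ℝ) → (Fin e → ℝ)) (δ : ℕ → ℝ) (n : ℕ) : (s : ℕ) → Measure (Hist e s)
  | 0 => ((P : Measure (Obs d)).map (hist f 0)).restrict {h | h.1 = n}
  | s + 1 => (interventionLaw P f δ n s).bind fun h =>
      ∑ w : Bool, ENNReal.ofReal (dQ (δ s) (trtProb P s h.2.1) w) •
        condDistrib (hist f (s + 1)) (histTreat f s) (P : Measure (Obs d)) (h, w)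

/-- The g-formula for the mean outcome under the stochastic intervention, averaged over the number
of segments `S = n + 1 ∈ {1, …, smax}`. -/
def target {d e : ℕ} (smax : ℕ) (f : ℕ → (Fin d → ℝ) → (Fin e → ℝ)) (δ : ℕ → ℝ)
    (P : ProbabilityMeasure (Obs d)) : ℝ :=
  ∑ n ∈ Finset.range smax,
    ∫ h, ∑ w : Bool, dQ (δ n) (trtProb P n h.2.1) w * outcomeReg P f n h w
      ∂(interventionLaw P f δ (n + 1) n)

/-! ### The model -/

/-- The model: between `1` and `smax` segments, outcomes in `𝒴`, and bounded relative overlap,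
i.e. `π_s ≥ c p_s` and `1 - π_s ≥ c (1 - p_s)` on the existing segments for some `c > 0`. -/
def model {d e : ℕ} (smax : ℕ) (𝒴 : Set ℝ) (f : ℕ → (Fin d → ℝ) → (Fin e → ℝ)) :
    Set (ProbabilityMeasure (Obs d)) :=
  {P | (∀ᵐ D ∂(P : Measure (Obs d)), 1 ≤ len D ∧ len D ≤ smax) ∧
    (∀ᵐ D ∂(P : Measure (Obs d)), outcome D ∈ 𝒴) ∧
    ∃ c : ℝ, 0 < c ∧ ∀ᵐ D ∂(P : Measure (Obs d)), ∀ s < len D,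
      c * trtProb P s (treatHist s D) ≤ propensity P f s (hist f s D) ∧
      c * (1 - trtProb P s (treatHist s D)) ≤ 1 - propensity P f s (hist f s D)}

/-! ### The ingredients of the influence function -/

/-- The weight `ω_s(h, w)`. -/
def weight {d e : ℕ} (P : ProbabilityMeasure (Obs d)) (f : ℕ → (Fin d → ℝ) → (Fin e → ℝ))
    (δ : ℕ → ℝ) (s : ℕ) (h : Hist e s) (w : Bool) : ℝ :=
  (δ s * num w * (trtProb P s h.2.1 / propensity P f s h)
      + (1 - num w) * ((1 - trtProb P s h.2.1) / (1 - propensity P f s h)))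
    / (δ s * trtProb P s h.2.1 + 1 - trtProb P s h.2.1)

/-- The cumulative weight `∏_{j < s} ω_j(H_j, W_j)`. -/
def cumWeight {d e : ℕ} (P : ProbabilityMeasure (Obs d)) (f : ℕ → (Fin d → ℝ) → (Fin e → ℝ))
    (δ : ℕ → ℝ) (s : ℕ) (D : Obs d) : ℝ :=
  ∏ j ∈ Finset.range s, weight P f δ j (hist f j D) (treat j D)

/-- The outcome model at segment `s` when `k` more segments follow: the outcome regression if
`k = 0`, and otherwise the conditional mean given `(H_s, W_s) = (h, w)` of the outcome model at
segment `s + 1`, averaged over the intervention at that segment. -/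
def outcomeModelAux {d e : ℕ} (P : ProbabilityMeasure (Obs d))
    (f : ℕ → (Fin d → ℝ) → (Fin e → ℝ)) (δ : ℕ → ℝ) :
    (k : ℕ) → (s : ℕ) → Hist e s → Bool → ℝ
  | 0, s, h, w => outcomeReg P f s h w
  | k + 1, s, h, w =>
      ∫ h', (δ (s + 1) * trtProb P (s + 1) h'.2.1 * outcomeModelAux P f δ k (s + 1) h' true
            + (1 - trtProb P (s + 1) h'.2.1) * outcomeModelAux P f δ k (s + 1) h' false)
          / (δ (s + 1) * trtProb P (s + 1) h'.2.1 + 1 - trtProb P (s + 1) h'.2.1)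
        ∂(condDistrib (hist f (s + 1)) (histTreat f s) (P : Measure (Obs d)) (h, w))

/-- The outcome model `m_s(h, w)`; the number `S` of segments is the first entry of `h`. -/
def outcomeModel {d e : ℕ} (P : ProbabilityMeasure (Obs d))
    (f : ℕ → (Fin d → ℝ) → (Fin e → ℝ)) (δ : ℕ → ℝ) (s : ℕ) (h : Hist e s) (w : Bool) : ℝ :=
  outcomeModelAux P f δ (h.1 - (s + 1)) s h w

/-- `m̃_s(v, w) = E[∏_{j < s} ω_j(H_j, W_j) m_s(H_s, w) ∣ W_0, …, W_{s-1} = v, segment s exists]`. -/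
def outcomeModelTilde {d e : ℕ} (P : ProbabilityMeasure (Obs d))
    (f : ℕ → (Fin d → ℝ) → (Fin e → ℝ)) (δ : ℕ → ℝ) (s : ℕ) (v : Fin s → Bool) (w : Bool) : ℝ :=
  ∫ D, cumWeight P f δ s D * outcomeModel P f δ s (hist f s D) w
    ∂(cond (P : Measure (Obs d)) (cell s v))

/-- The influence function. -/
def influence {d e : ℕ} (smax : ℕ) (f : ℕ → (Fin d → ℝ) → (Fin e → ℝ)) (δ : ℕ → ℝ)
    (P : ProbabilityMeasure (Obs d)) (D : Obs d) : ℝ :=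
  (∑ s ∈ Finset.range (len D),
    cumWeight P f δ s D *
      ((δ s * trtProb P s (treatHist s D) * outcomeModel P f δ s (hist f s D) true
            * (1 - num (treat s D) / propensity P f s (hist f s D))
          + (1 - trtProb P s (treatHist s D)) * outcomeModel P f δ s (hist f s D) false
            * (1 - (1 - num (treat s D)) / (1 - propensity P f s (hist f s D))))
        / (δ s * trtProb P s (treatHist s D) + 1 - trtProb P s (treatHist s D))))
  + (∑ s ∈ Finset.range (len D),
      δ s * (num (treat s D) - trtProb P s (treatHist s D))
        * (outcomeModelTilde P f δ s (treatHist s D) true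
          - outcomeModelTilde P f δ s (treatHist s D) false)
        / (δ s * trtProb P s (treatHist s D) + 1 - trtProb P s (treatHist s D)) ^ 2)
  + cumWeight P f δ (len D) D * outcome D
  - target smax f δ P

end GPI

end

/-! The target is a weighted mean, `E[∏ ω_s Y]`. Fix `P` and take another law `Q` of the model.
Telescoping the weighted outcome along the segments, with the outcome models of `P` and the weights
of `Q`, gives an exact expansion (`IsWeightBound.target_expansion`). It says that `Ψ(Q)` is the
`Q`-mean of the value function of `P` at the first segment, plus, for each segment, two corrections:
the weighted `Q`-mean of the regression residual of `P`, and a term carrying the difference of the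
intervention probabilities of `Q` and `P`.

Let `Q = Q_t` run along a path differentiable in quadratic mean. In the residual terms, replacing
the weights of `Q_t` by those of `P` costs a product of two errors, one of weights and one of
regressions, hence `O(t²)` (`IsRegularPath.stepTerm_isBigO`). The intervention terms depend on the
treatment probabilities of finitely many cells and are linear in them up to `o(t)`
(`IsRegularPath.treat_isLittleO`); this produces the sum in `m̃_s`. What is left is the `Q_t`-mean
of one fixed bounded function, `linearization`, and means of bounded functions are differentiable
along the path (`HasScore.tendsto_integral`). The function `ψ` is almost surely this function minus
its mean (`influence_eq_linearization`).

The difficulty is that the overlap constant may depend on the law, so the weights of `Q_t` need not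
be bounded uniformly in `t`. Two devices avoid any uniform bound. Regression errors are controlled
in `L²(Q_t)` by the Hellinger distance alone (`integral_sq_le_hellingerSq`,
`regression_diff_isBigO`). The newest weight of `Q_t` is integrated over the treatment first, where
propensity times weight is an intervention probability, hence at most one; then only the overlap of
`P` matters (`IsRegularPath.weightDiff_isBigO`).

Regressions are arbitrary at treatments of probability zero. Weights and outcome models are
therefore replaced by truncations that are bounded everywhere and agree with the originals wherever
the intervention puts mass.

For uniqueness, the laws with density `1 + t g`, `|g| ≤ 1`, `∫ g dP = 0`, stay in the model
(`perturbedLaw_mem_model`), so every centred indicator is a score and the derivatives determine `ψ`.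
-/

noncomputable section

/-! ### Hellinger distance and squared errors of regressions. -/

section Hellinger

variable {Ω : Type*} [MeasurableSpace Ω]

theorem integrable_of_abs_le {μ : Measure Ω} [IsFiniteMeasure μ] {φ : Ω → ℝ} {C : ℝ}
    (hm : Measurable φ) (hb : ∀ x, |φ x| ≤ C) : Integrable φ μ :=
  Integrable.of_bound hm.aestronglyMeasurable C (.of_forall hb)

/-- The square root of the density of `P` with respect to `μ`. -/
def sqrtDensity (P μ : Measure Ω) (x : Ω) : ℝ := √(P.rnDeriv μ x).toReal

theorem measurable_sqrtDensity (P μ : Measure Ω) : Measurable (sqrtDensity P μ) :=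
  (Measure.measurable_rnDeriv P μ).ennreal_toReal.sqrt

theorem sqrtDensity_sq (P μ : Measure Ω) (x : Ω) :
    sqrtDensity P μ x ^ 2 = (P.rnDeriv μ x).toReal := Real.sq_sqrt ENNReal.toReal_nonneg

theorem integral_mul_sqrtDensity_sq {P μ : Measure Ω} [IsFiniteMeasure P] [IsFiniteMeasure μ]
    (h : P ≪ μ) (φ : Ω → ℝ) : ∫ x, φ x * sqrtDensity P μ x ^ 2 ∂μ = ∫ x, φ x ∂P := by
  rw [← integral_rnDeriv_smul h]
  exact integral_congr_ae (.of_forall fun x => by simp [sqrtDensity_sq, mul_comm])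

theorem integrable_mul_sqrtDensity_sq {P μ : Measure Ω} [IsFiniteMeasure P] [IsFiniteMeasure μ]
    (h : P ≪ μ) {φ : Ω → ℝ} (hφ : Integrable φ P) :
    Integrable (fun x => φ x * sqrtDensity P μ x ^ 2) μ := by
  refine ((integrable_rnDeriv_smul_iff h).2 hφ).congr (.of_forall fun x => ?_)
  simp [sqrtDensity_sq, mul_comm]

/-- The squared Hellinger distance. -/
def hellingerSq (P Q : Measure Ω) : ℝ :=
  ∫ x, (sqrtDensity Q (P + Q) x - sqrtDensity P (P + Q) x) ^ 2 ∂(P + Q)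

theorem absolutelyContinuous_add_left {P Q : Measure Ω} : P ≪ P + Q :=
  Measure.AbsolutelyContinuous.rfl.add_right Q

theorem absolutelyContinuous_add_right {P Q : Measure Ω} : Q ≪ P + Q := by
  rw [add_comm]; exact Measure.AbsolutelyContinuous.rfl.add_right P

theorem memLp_sqrtDensity {P μ : Measure Ω} [IsFiniteMeasure P] [IsFiniteMeasure μ] (h : P ≪ μ) :
    MemLp (sqrtDensity P μ) 2 μ := by
  rw [memLp_two_iff_integrable_sq (measurable_sqrtDensity _ _).aestronglyMeasurable]
  simpa using integrable_mul_sqrtDensity_sq h (integrable_const (μ := P) (1 : ℝ))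

theorem hellingerSq_nonneg {P Q : Measure Ω} : 0 ≤ hellingerSq P Q :=
  integral_nonneg fun _ => sq_nonneg _

variable {P Q : Measure Ω} [IsFiniteMeasure P] [IsFiniteMeasure Q]

/-- Meant for `D` the difference of the regressions under `Q` and `P`, and `Z` the residual of the
regression under `P`: the two integral hypotheses are then the normal equations. With `a`, `b` the
root densities, `∫ D² dQ = ∫ D Z (a² - b²)`, and a multiple of `∫ D² a²` is absorbed on the left. No
lower bound on any density or propensity is used. -/
theorem integral_sq_le_hellingerSq {D Z : Ω → ℝ} {C : ℝ} (hD : Measurable D) (hZ : Measurable Z)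
    (hDC : ∀ x, |D x| ≤ C) (hZC : ∀ x, |Z x| ≤ C) (h0 : ∫ x, D x * Z x ∂P = 0)
    (h1 : ∫ x, D x * Z x ∂Q = ∫ x, D x ^ 2 ∂Q) :
    ∫ x, D x ^ 2 ∂Q ≤ 6 * C ^ 2 * hellingerSq P Q := by
  set a := sqrtDensity Q (P + Q)
  set b := sqrtDensity P (P + Q)
  have hQ : Q ≪ P + Q := absolutelyContinuous_add_right
  have hP : P ≪ P + Q := absolutelyContinuous_add_left
  have hDZ : ∀ x, |D x * Z x| ≤ C * C := fun x => by
    rw [abs_mul]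
    exact mul_le_mul (hDC x) (hZC x) (abs_nonneg _) ((abs_nonneg _).trans (hDC x))
  have hDD : ∀ x, |D x ^ 2| ≤ C * C := fun x => by
    rw [sq, abs_mul]
    exact mul_le_mul (hDC x) (hDC x) (abs_nonneg _) ((abs_nonneg _).trans (hDC x))
  have i1 : Integrable (fun x => D x * Z x * a x ^ 2) (P + Q) :=
    integrable_mul_sqrtDensity_sq hQ (integrable_of_abs_le (hD.mul hZ) hDZ)
  have i2 : Integrable (fun x => D x * Z x * b x ^ 2) (P + Q) :=
    integrable_mul_sqrtDensity_sq hP (integrable_of_abs_le (hD.mul hZ) hDZ)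
  have i3 := integrable_mul_sqrtDensity_sq hQ (integrable_of_abs_le (μ := Q) (hD.pow_const 2) hDD)
  have i4 : Integrable (fun x => (a x - b x) ^ 2) (P + Q) :=
    ((memLp_sqrtDensity hQ).sub (memLp_sqrtDensity hP)).integrable_sq
  have e1 := integral_mul_sqrtDensity_sq hQ (fun x => D x * Z x)
  have e2 := integral_mul_sqrtDensity_sq hP (fun x => D x * Z x)
  have e3 := integral_mul_sqrtDensity_sq hQ (fun x => D x ^ 2)
  have key : ∫ x, (D x * Z x * a x ^ 2 - D x * Z x * b x ^ 2) ∂(P + Q)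
      ≤ ∫ x, (1 / 2 * (D x ^ 2 * a x ^ 2) + 3 * C ^ 2 * (a x - b x) ^ 2) ∂(P + Q) := by
    refine integral_mono (i1.sub i2) ((i3.const_mul _).add (i4.const_mul _)) fun x => ?_
    have hk : (Z x * (a x - b x)) ^ 2 ≤ C ^ 2 * (a x - b x) ^ 2 := by
      rw [mul_pow]
      exact mul_le_mul_of_nonneg_right (sq_le_sq' (neg_le_of_abs_le (hZC x))
        (le_of_abs_le (hZC x))) (sq_nonneg _)
    have hk2 : -(D x * Z x) * (a x - b x) ^ 2 ≤ C ^ 2 * (a x - b x) ^ 2 := by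
      refine mul_le_mul_of_nonneg_right ?_ (sq_nonneg _)
      rw [sq]
      exact (neg_le_abs _).trans (hDZ x)
    have : D x * Z x * a x ^ 2 - D x * Z x * b x ^ 2
      = 2 * (D x * a x) * (Z x * (a x - b x)) + -(D x * Z x) * (a x - b x) ^ 2 := by ring
    simp only [this]
    -- Young's inequality `2XY ≤ X²/2 + 2Y²` with `X = D a`, `Y = Z (a - b)`; together with the
    -- quadratic term this makes `3 C²`, and `6 C²` after absorption.
    nlinarith [sq_nonneg (D x * a x - 2 * (Z x * (a x - b x)))]
  rw [integral_sub i1 i2, integral_add (i3.const_mul _) (i4.const_mul _), integral_const_mul,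
    integral_const_mul, e1, e2, e3, h0, h1] at key
  change _ ≤ _ * ∫ x, (a x - b x) ^ 2 ∂(P + Q)
  linarith

/-- The case `D = Z = 1_A` of the preceding bound. Along a differentiable path it makes the mass
escaping to `P`-null sets of second order. -/
theorem measureReal_le_hellingerSq {A : Set Ω} (hA : MeasurableSet A) (h0 : P A = 0) :
    Q.real A ≤ 6 * hellingerSq P Q := by
  have hb : ∀ x, |A.indicator (fun _ => (1 : ℝ)) x| ≤ 1 := fun x => by
    by_cases hx : x ∈ A <;> simp [hx]
  have hm : Measurable (A.indicator fun _ => (1 : ℝ)) := measurable_const.indicator hA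
  have e : ∀ x, A.indicator (fun _ => (1 : ℝ)) x * A.indicator (fun _ => (1 : ℝ)) x
      = A.indicator (fun _ => (1 : ℝ)) x := fun x => by by_cases hx : x ∈ A <;> simp [hx]
  have := integral_sq_le_hellingerSq (P := P) (Q := Q) hm hm hb hb
    (by simp only [e]; rw [integral_indicator_const _ hA]; simp [Measure.real, h0])
    (by simp only [sq])
  simp only [sq, e] at this
  rw [integral_indicator_const _ hA] at this
  simpa using this

end Hellinger

/-! ### Consequences of differentiability in quadratic mean. -/

section Score

variable {Ω : Type*} [MeasurableSpace Ω] {P : ProbabilityMeasure Ω}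
  {Q : ℝ → ProbabilityMeasure Ω} {g : Ω → ℝ}

/-- A `P`-null set may carry mass of `P + Q t`, but the density of `P` vanishes at almost every
point of it, and there the score is multiplied by zero. -/
theorem HasScore.congr_score {g' : Ω → ℝ} (h : HasScore P Q g)
    (hg : g =ᵐ[(P : Measure Ω)] g') : HasScore P Q g' := by
  refine ⟨h.1.ae_eq hg, h.2.congr fun t => lintegral_congr_ae ?_⟩
  have hP : (P : Measure Ω) ≪ (P : Measure Ω) + (Q t : Measure Ω) := absolutelyContinuous_add_left
  have h1 : ∀ᵐ x ∂((P : Measure Ω) + (Q t : Measure Ω)),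
      (P : Measure Ω).rnDeriv ((P : Measure Ω) + (Q t : Measure Ω)) x ≠ 0 → g x = g' x := by
    have := hg
    rw [← Measure.withDensity_rnDeriv_eq _ _ hP] at this
    exact (ae_withDensity_iff (Measure.measurable_rnDeriv _ _)).1 this
  filter_upwards [h1] with x hx
  by_cases h0 : (P : Measure Ω).rnDeriv ((P : Measure Ω) + (Q t : Measure Ω)) x = 0
  · simp [h0]
  · rw [hx h0]

/-- The remainder of the quadratic mean expansion. -/
def qmdRemainder (P : ProbabilityMeasure Ω) (Q : ℝ → ProbabilityMeasure Ω) (g : Ω → ℝ) (t : ℝ)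
    (x : Ω) : ℝ :=
  (sqrtDensity (Q t : Measure Ω) (P + Q t) x - sqrtDensity (P : Measure Ω) (P + Q t) x) / t
    - (1 / 2) * g x * sqrtDensity (P : Measure Ω) (P + Q t) x

theorem memLp_score_mul (hg : MemLp g 2 (P : Measure Ω)) (hgm : Measurable g) (t : ℝ) :
    MemLp (fun x => (1 / 2) * g x * sqrtDensity (P : Measure Ω) (P + Q t) x) 2
      ((P : Measure Ω) + (Q t : Measure Ω)) := by
  have hP : (P : Measure Ω) ≪ (P : Measure Ω) + (Q t : Measure Ω) := absolutelyContinuous_add_left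
  have hm : Measurable fun x => (1 / 2) * g x * sqrtDensity (P : Measure Ω) (P + Q t) x :=
    (hgm.const_mul _).mul (measurable_sqrtDensity _ _)
  rw [memLp_two_iff_integrable_sq hm.aestronglyMeasurable]
  refine ((integrable_mul_sqrtDensity_sq hP hg.integrable_sq).const_mul (1 / 4)).congr
    (.of_forall fun x => ?_)
  simp only; ring

theorem memLp_qmdRemainder (hg : MemLp g 2 (P : Measure Ω)) (hgm : Measurable g) (t : ℝ) :
    MemLp (qmdRemainder P Q g t) 2 ((P : Measure Ω) + (Q t : Measure Ω)) := by
  refine MemLp.sub ?_ (memLp_score_mul hg hgm t)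
  simp only [div_eq_inv_mul]
  exact ((memLp_sqrtDensity absolutelyContinuous_add_right).sub
    (memLp_sqrtDensity absolutelyContinuous_add_left)).const_mul _

theorem HasScore.tendsto_remainder (h : HasScore P Q g) (hgm : Measurable g) :
    Tendsto (fun t => ∫ x, qmdRemainder P Q g t x ^ 2 ∂((P : Measure Ω) + (Q t : Measure Ω)))
      (𝓝[>] 0) (𝓝 0) := by
  have := (ENNReal.tendsto_toReal ENNReal.zero_ne_top).comp h.2
  refine this.congr fun t => ?_
  rw [integral_eq_lintegral_of_nonneg_ae (.of_forall fun x => sq_nonneg _)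
    (memLp_qmdRemainder h.1 hgm t).integrable_sq.1]
  rfl

theorem HasScore.hellingerSq_isBigO (h : HasScore P Q g) (hgm : Measurable g) :
    (fun t => hellingerSq (P : Measure Ω) (Q t : Measure Ω)) =O[𝓝[>] 0] fun t : ℝ => t ^ 2 := by
  have h1 : ∀ᶠ t in 𝓝[>] (0 : ℝ),
      ∫ x, qmdRemainder P Q g t x ^ 2 ∂((P : Measure Ω) + (Q t : Measure Ω)) < 1 :=
    (h.tendsto_remainder hgm).eventually (gt_mem_nhds zero_lt_one)
  -- From `(x + y)² ≤ 2x² + 2y²` with `x = g √p / 2` and `y` the remainder, whose squared integral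
  -- is eventually below one.
  refine Asymptotics.IsBigO.of_bound (1 / 2 * ∫ x, g x ^ 2 ∂(P : Measure Ω) + 2) ?_
  filter_upwards [h1, self_mem_nhdsWithin] with t ht ht0
  have ht0 : 0 < t := ht0
  have hP : (P : Measure Ω) ≪ (P : Measure Ω) + (Q t : Measure Ω) := absolutelyContinuous_add_left
  have i1 := (memLp_qmdRemainder (Q := Q) h.1 hgm t).integrable_sq
  have i2 := integrable_mul_sqrtDensity_sq hP h.1.integrable_sq
  rw [Real.norm_of_nonneg hellingerSq_nonneg, Real.norm_of_nonneg (sq_nonneg _)]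
  have : hellingerSq (P : Measure Ω) (Q t : Measure Ω) ≤
      ∫ x, t ^ 2 * (1 / 2 * (g x ^ 2 * sqrtDensity (P : Measure Ω) (P + Q t) x ^ 2)
        + 2 * qmdRemainder P Q g t x ^ 2) ∂((P : Measure Ω) + (Q t : Measure Ω)) := by
    refine integral_mono ((memLp_sqrtDensity absolutelyContinuous_add_right).sub
      (memLp_sqrtDensity absolutelyContinuous_add_left)).integrable_sq
      (((i2.const_mul _).add (i1.const_mul _)).const_mul _) fun x => ?_
    set a := sqrtDensity (Q t : Measure Ω) (P + Q t) x
    set b := sqrtDensity (P : Measure Ω) (P + Q t) x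
    set r := qmdRemainder P Q g t x with hr
    have : a - b = t * (1 / 2 * g x * b + r) := by
      rw [hr, qmdRemainder]; field_simp; ring
    change (a - b) ^ 2 ≤ t ^ 2 * (1 / 2 * (g x ^ 2 * b ^ 2) + 2 * r ^ 2)
    rw [this, mul_pow]
    refine mul_le_mul_of_nonneg_left ?_ (sq_nonneg _)
    nlinarith [sq_nonneg (1 / 2 * g x * b - r)]
  refine this.trans ?_
  rw [integral_const_mul, integral_add (i2.const_mul _) (i1.const_mul _), integral_const_mul,
    integral_const_mul, integral_mul_sqrtDensity_sq hP (fun x => g x ^ 2), mul_comm]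
  gcongr
  linarith

/-- Writing the root density of `Q t` as `a = b + t (g b / 2 + r)`, the error of the difference
quotient is `φ (2 r b + t (g b / 2 + r)²)`, and `r → 0` in `L²`. -/
theorem HasScore.tendsto_integral_of_measurable (h : HasScore P Q g) (hgm : Measurable g)
    {φ : Ω → ℝ} {B : ℝ} (hφ : Measurable φ) (hB : ∀ x, |φ x| ≤ B) :
    Tendsto (fun t => (∫ x, φ x ∂(Q t : Measure Ω) - ∫ x, φ x ∂(P : Measure Ω)) / t) (𝓝[>] 0)
      (𝓝 (∫ x, φ x * g x ∂(P : Measure Ω))) := by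
  set R : ℝ → ℝ := fun t =>
    ∫ x, qmdRemainder P Q g t x ^ 2 ∂((P : Measure Ω) + (Q t : Measure Ω)) with hRdef
  have hR : Tendsto R (𝓝[>] 0) (𝓝 0) := h.tendsto_remainder hgm
  have hR0 : ∀ t, 0 ≤ R t := fun t => integral_nonneg fun _ => sq_nonneg _
  have hB0 : 0 ≤ B := by
    obtain ⟨x⟩ : Nonempty Ω := nonempty_of_isProbabilityMeasure (P : Measure Ω)
    exact (abs_nonneg _).trans (hB x)
  have hid : Tendsto (fun t : ℝ => t) (𝓝[>] 0) (𝓝 0) := tendsto_id.mono_left nhdsWithin_le_nhds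
  set G := ∫ x, g x ^ 2 ∂(P : Measure Ω)
  have hlim : Tendsto (fun t => B * (2 * (√(R t) + t) + t * (1 / 2 * G + 2 * R t))) (𝓝[>] 0)
      (𝓝 0) := by
    have hs : Tendsto (fun t => √(R t)) (𝓝[>] 0) (𝓝 0) := by simpa using hR.sqrt
    have := (((hs.add hid).const_mul 2).add
      (hid.mul ((hR.const_mul 2).const_add (1 / 2 * G)))).const_mul B
    simpa using this
  rw [tendsto_iff_dist_tendsto_zero]
  refine squeeze_zero' (.of_forall fun _ => dist_nonneg) ?_ hlim
  filter_upwards [self_mem_nhdsWithin] with t ht0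
  have ht0 : 0 < t := ht0
  have hP : (P : Measure Ω) ≪ (P : Measure Ω) + (Q t : Measure Ω) := absolutelyContinuous_add_left
  have hQ : (Q t : Measure Ω) ≪ (P : Measure Ω) + (Q t : Measure Ω) :=
    absolutelyContinuous_add_right
  set a := sqrtDensity (Q t : Measure Ω) (P + Q t)
  set b := sqrtDensity (P : Measure Ω) (P + Q t)
  set r := qmdRemainder P Q g t with hr
  have hgi : Integrable g (P : Measure Ω) := h.1.integrable (by norm_num)
  have hφg : Integrable (fun x => φ x * g x) (P : Measure Ω) :=
    hgi.bdd_mul hφ.aestronglyMeasurable (.of_forall hB)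
  have i1 := integrable_mul_sqrtDensity_sq hQ (integrable_of_abs_le hφ hB)
  have i2 := integrable_mul_sqrtDensity_sq hP (integrable_of_abs_le hφ hB)
  have i3 := integrable_mul_sqrtDensity_sq hP hφg
  have i4 : Integrable (fun x => b x ^ 2) ((P : Measure Ω) + (Q t : Measure Ω)) :=
    (memLp_sqrtDensity hP).integrable_sq
  have i5 : Integrable (fun x => r x ^ 2) ((P : Measure Ω) + (Q t : Measure Ω)) :=
    (memLp_qmdRemainder h.1 hgm t).integrable_sq
  have i6 := integrable_mul_sqrtDensity_sq hP h.1.integrable_sq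
  have e4 : ∫ x, b x ^ 2 ∂((P : Measure Ω) + (Q t : Measure Ω)) = 1 := by
    simpa using integral_mul_sqrtDensity_sq hP (fun _ => 1)
  rw [Real.dist_eq, ← integral_mul_sqrtDensity_sq hQ, ← integral_mul_sqrtDensity_sq hP φ,
    ← integral_mul_sqrtDensity_sq hP (fun x => φ x * g x), ← integral_sub i1 i2, ← integral_div,
    ← integral_sub (by exact (i1.sub i2).div_const t) i3]
  -- The weight in `2 |r b| ≤ r² / l + l b²`. The choice `√R` balances the two terms; adding `t`
  -- keeps `l` positive when the remainder vanishes.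
  set l := √(R t) + t with hl
  have hl0 : 0 < l := by positivity
  have hRl : R t ≤ l ^ 2 := by
    rw [← Real.sq_sqrt (hR0 t)]
    exact pow_le_pow_left₀ (Real.sqrt_nonneg _) (by rw [hl]; linarith) 2
  calc |∫ x, ((φ x * a x ^ 2 - φ x * b x ^ 2) / t - φ x * g x * b x ^ 2)
        ∂((P : Measure Ω) + (Q t : Measure Ω))|
      ≤ ∫ x, B * ((1 / l * r x ^ 2 + l * b x ^ 2)
          + t * (1 / 2 * (g x ^ 2 * b x ^ 2) + 2 * r x ^ 2))
          ∂((P : Measure Ω) + (Q t : Measure Ω)) := by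
        rw [← Real.norm_eq_abs]
        refine norm_integral_le_of_norm_le ((((i5.const_mul _).add (i4.const_mul _)).add
          (((i6.const_mul _).add (i5.const_mul _)).const_mul _)).const_mul _) (.of_forall fun x => ?_)
        have hab : a x = b x + t * (1 / 2 * g x * b x + r x) := by
          simp only [hr, qmdRemainder]; field_simp; ring
        have e : (φ x * a x ^ 2 - φ x * b x ^ 2) / t - φ x * g x * b x ^ 2
            = φ x * (2 * (r x * b x) + t * (1 / 2 * g x * b x + r x) ^ 2) := by
          rw [hab]; field_simp; ring
        rw [e, Real.norm_eq_abs, abs_mul]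
        refine mul_le_mul (hB x) ((abs_add_le _ _).trans (add_le_add ?_ ?_)) (abs_nonneg _) hB0
        · have h1 : 1 / l * r x ^ 2 + l * b x ^ 2 - 2 * (r x * b x)
              = 1 / l * (r x - l * b x) ^ 2 := by field_simp; ring
          have h2 : 1 / l * r x ^ 2 + l * b x ^ 2 + 2 * (r x * b x)
              = 1 / l * (r x + l * b x) ^ 2 := by field_simp; ring
          have h3 : 0 ≤ 1 / l * (r x - l * b x) ^ 2 := by positivity
          have h4 : 0 ≤ 1 / l * (r x + l * b x) ^ 2 := by positivity
          rw [abs_le]; constructor <;> linarith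
        · rw [abs_of_nonneg (by positivity)]
          refine mul_le_mul_of_nonneg_left ?_ ht0.le
          nlinarith [sq_nonneg (1 / 2 * g x * b x - r x)]
    _ = B * ((1 / l * R t + l * 1) + t * (1 / 2 * G + 2 * R t)) := by
        rw [integral_const_mul, integral_add (by exact (i5.const_mul _).add (i4.const_mul _))
          (by exact ((i6.const_mul _).add (i5.const_mul _)).const_mul _),
          integral_add (i5.const_mul _) (i4.const_mul _), integral_const_mul, integral_const_mul,
          integral_const_mul, integral_add (i6.const_mul _) (i5.const_mul _), integral_const_mul,
          integral_const_mul, e4, integral_mul_sqrtDensity_sq hP (fun x => g x ^ 2)]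
    _ ≤ B * (2 * l + t * (1 / 2 * G + 2 * R t)) := by
        have : 1 / l * R t ≤ l := by
          rw [one_div, inv_mul_le_iff₀ hl0]; linarith
        gcongr
        linarith

theorem HasScore.exists_measurable (h : HasScore P Q g) :
    ∃ g', Measurable g' ∧ g =ᵐ[(P : Measure Ω)] g' ∧ HasScore P Q g' := by
  refine ⟨h.1.1.mk g, h.1.1.stronglyMeasurable_mk.measurable, h.1.1.ae_eq_mk, ?_⟩
  exact h.congr_score h.1.1.ae_eq_mk

theorem HasScore.tendsto_integral (h : HasScore P Q g)
    {φ : Ω → ℝ} {B : ℝ} (hφ : Measurable φ) (hB : ∀ x, |φ x| ≤ B) :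
    Tendsto (fun t => (∫ x, φ x ∂(Q t : Measure Ω) - ∫ x, φ x ∂(P : Measure Ω)) / t) (𝓝[>] 0)
      (𝓝 (∫ x, φ x * g x ∂(P : Measure Ω))) := by
  obtain ⟨g', hm, he, h'⟩ := h.exists_measurable
  rw [integral_congr_ae (he.mono fun x hx => by simp only [hx] :
    (fun x => φ x * g x) =ᵐ[(P : Measure Ω)] fun x => φ x * g' x)]
  exact h'.tendsto_integral_of_measurable hm hφ hB

theorem HasScore.hellingerSq_le (h : HasScore P Q g) :
    (fun t => hellingerSq (P : Measure Ω) (Q t : Measure Ω)) =O[𝓝[>] 0] fun t : ℝ => t ^ 2 := by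
  obtain ⟨g', hm, -, h'⟩ := h.exists_measurable
  exact h'.hellingerSq_isBigO hm

theorem HasScore.congr_path {Q' : ℝ → ProbabilityMeasure Ω} (h : HasScore P Q g)
    (hQ : Q =ᶠ[𝓝[>] 0] Q') : HasScore P Q' g := by
  refine ⟨h.1, h.2.congr' ?_⟩
  filter_upwards [hQ] with t ht
  rw [ht]

/-- The total mass is constant along the path. -/
theorem HasScore.integral_score (h : HasScore P Q g) : ∫ x, g x ∂(P : Measure Ω) = 0 := by
  have := h.tendsto_integral (φ := fun _ => 1) (B := 1) measurable_const (by simp)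
  simp only [one_mul, integral_const, probReal_univ, smul_eq_mul, mul_one, sub_self,
    zero_div] at this
  exact (tendsto_nhds_unique this tendsto_const_nhds)

end Score

/-- The truncation of `x` to `[-B, B]`. -/
def clamp (B x : ℝ) : ℝ := max (-B) (min x B)

theorem measurable_clamp (B : ℝ) : Measurable (clamp B) := by unfold clamp; fun_prop

theorem abs_clamp_le {B : ℝ} (hB : 0 ≤ B) (x : ℝ) : |clamp B x| ≤ B :=
  abs_le.2 ⟨le_max_left _ _, max_le (by linarith) (min_le_right _ _)⟩

theorem clamp_eq_self {B x : ℝ} (h : |x| ≤ B) : clamp B x = x := by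
  rw [clamp, min_eq_left (abs_le.1 h).2, max_eq_right (abs_le.1 h).1]

/-! ### Conditional laws and bounded versions of regressions. -/

section Disintegration

variable {Ω β γ : Type*} [MeasurableSpace Ω] [MeasurableSpace β] [MeasurableSpace γ]
  [StandardBorelSpace γ] [Nonempty γ] {μ : Measure Ω} [IsProbabilityMeasure μ]
  {X : Ω → β} {Y : Ω → γ}

theorem integral_eq_integral_condDistrib (hX : Measurable X) (hY : Measurable Y) {F : β × γ → ℝ}
    (hF : Measurable F) {C : ℝ} (hC : ∀ x, |F x| ≤ C) :
    ∫ x, F (X x, Y x) ∂μ = ∫ x, ∫ y, F (X x, y) ∂(condDistrib Y X μ (X x)) ∂μ := by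
  have := Measure.isProbabilityMeasure_map (μ := μ) hX.aemeasurable
  rw [← integral_map (hX.prodMk hY).aemeasurable (f := F) hF.aestronglyMeasurable,
    ← compProd_map_condDistrib hY.aemeasurable,
    Measure.integral_compProd (integrable_of_abs_le hF hC),
    integral_map hX.aemeasurable]
  exact (hF.stronglyMeasurable.integral_condDistrib).aestronglyMeasurable

theorem lintegral_eq_lintegral_condDistrib (hX : Measurable X) (hY : Measurable Y)
    {F : β × γ → ENNReal} (hF : Measurable F) :
    ∫⁻ x, F (X x, Y x) ∂μ = ∫⁻ x, ∫⁻ y, F (X x, y) ∂(condDistrib Y X μ (X x)) ∂μ := by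
  have := Measure.isProbabilityMeasure_map (μ := μ) hX.aemeasurable
  rw [← lintegral_map hF (hX.prodMk hY), ← compProd_map_condDistrib hY.aemeasurable,
    Measure.lintegral_compProd hF, lintegral_map hF.lintegral_kernel_prod_right' hX]

theorem measurable_integral_condDistrib {F : γ → ℝ} (hF : Measurable F) :
    Measurable fun b => ∫ y, F y ∂(condDistrib Y X μ b) :=
  ((hF.comp (measurable_snd (α := β) (β := γ))).stronglyMeasurable.integral_condDistrib).measurable

theorem ae_condDistrib_of_ae (hX : Measurable X) (hY : Measurable Y) {p : β × γ → Prop}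
    (hpm : MeasurableSet {z | p z}) (hp : ∀ᵐ x ∂μ, p (X x, Y x)) :
    ∀ᵐ x ∂μ, ∀ᵐ y ∂(condDistrib Y X μ (X x)), p (X x, y) := by
  have := Measure.isProbabilityMeasure_map (μ := μ) hX.aemeasurable
  have h1 : ∀ᵐ z ∂(μ.map fun x => (X x, Y x)), p z :=
    (ae_map_iff (hX.prodMk hY).aemeasurable hpm).2 hp
  rw [← compProd_map_condDistrib hY.aemeasurable] at h1
  exact ae_of_ae_map hX.aemeasurable (Measure.ae_ae_of_ae_compProd h1)

/-- If `F (Y)` agrees on `{X ∈ A}` with a bounded variable `G`, then the regression of `F (Y)` on `X`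
is bounded there and is a version of the regression of `G`. -/
theorem regression_of_ae_eq (hX : Measurable X) (hY : Measurable Y) {F : γ → ℝ} (hF : Measurable F)
    {G : Ω → ℝ} {B : ℝ} (hB : 0 ≤ B) (hGB : ∀ x, |G x| ≤ B) {A : Set β}
    (hA : MeasurableSet A) (hFG : ∀ᵐ x ∂μ, X x ∈ A → F (Y x) = G x) :
    (∀ᵐ x ∂μ, X x ∈ A → |∫ y, F y ∂(condDistrib Y X μ (X x))| ≤ B) ∧
    ∀ φ : β → ℝ, Measurable φ → ∀ C, (∀ b, |φ b| ≤ C) → (∀ b, b ∉ A → φ b = 0) →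
      ∫ x, φ (X x) * G x ∂μ
        = ∫ x, φ (X x) * clamp B (∫ y, F y ∂(condDistrib Y X μ (X x))) ∂μ := by
  have hF' : Measurable fun y => clamp B (F y) := (measurable_clamp B).comp hF
  -- `F` may be unbounded away from `A`. Given `X` in `A`, truncating it changes nothing for almost
  -- every value of `Y`, so its regression there is that of a bounded function.
  have hae : ∀ᵐ x ∂μ, ∀ᵐ y ∂(condDistrib Y X μ (X x)), X x ∈ A → F y = clamp B (F y) := by
    refine ae_condDistrib_of_ae hX hY (p := fun z => z.1 ∈ A → F z.2 = clamp B (F z.2)) ?_ ?_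
    · have h1 : MeasurableSet {z : β × γ | z.1 ∈ A} := measurable_fst hA
      have h2 : MeasurableSet {z : β × γ | F z.2 = clamp B (F z.2)} :=
        measurableSet_eq_fun (hF.comp measurable_snd) (hF'.comp measurable_snd)
      exact h1.imp h2
    · filter_upwards [hFG] with x hx hxA
      rw [clamp_eq_self (by rw [hx hxA]; exact hGB x)]
  have hint : ∀ᵐ x ∂μ, X x ∈ A →
      ∫ y, F y ∂(condDistrib Y X μ (X x)) = ∫ y, clamp B (F y) ∂(condDistrib Y X μ (X x)) := by
    filter_upwards [hae] with x hx hxA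
    exact integral_congr_ae (hx.mono fun y hy => hy hxA)
  have hbd : ∀ b, |∫ y, clamp B (F y) ∂(condDistrib Y X μ b)| ≤ B := fun b => by
    have := norm_integral_le_of_norm_le_const (μ := condDistrib Y X μ b)
      (f := fun y => clamp B (F y)) (C := B) (.of_forall fun y => abs_clamp_le hB _)
    simpa using this
  refine ⟨?_, fun φ hφ C hC hφA => ?_⟩
  · filter_upwards [hint] with x hx hxA
    rw [hx hxA]; exact hbd _
  · have e1 : ∫ x, φ (X x) * G x ∂μ = ∫ x, φ (X x) * clamp B (F (Y x)) ∂μ := by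
      refine integral_congr_ae ?_
      filter_upwards [hFG] with x hx
      by_cases hxA : X x ∈ A
      · simp only [hx hxA, clamp_eq_self (hGB x)]
      · simp [hφA _ hxA]
    rw [e1, integral_eq_integral_condDistrib hX hY (F := fun z => φ z.1 * clamp B (F z.2))
      ((hφ.comp measurable_fst).mul (hF'.comp measurable_snd)) (C := C * B) (fun z => by
        rw [abs_mul]
        exact mul_le_mul (hC _) (abs_clamp_le hB _) (abs_nonneg _) ((abs_nonneg _).trans (hC z.1)))]
    refine integral_congr_ae ?_
    filter_upwards [hint] with x hx
    by_cases hxA : X x ∈ A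
    · simp only [integral_const_mul]
      rw [← hx hxA, clamp_eq_self (by rw [hx hxA]; exact hbd _)]
    · simp [hφA _ hxA]

/-- Truncation gives a version of the conditional mean that is bounded at every point, not only
almost surely. -/
theorem exists_regression (hX : Measurable X) {Z : Ω → ℝ} (hZ : Measurable Z) {B : ℝ} (hB : 0 ≤ B)
    (hZB : ∀ x, |Z x| ≤ B) :
    ∃ n : β → ℝ, Measurable n ∧ (∀ b, |n b| ≤ B) ∧ ∀ φ : β → ℝ, Measurable φ →
      ∀ C, (∀ b, |φ b| ≤ C) → ∫ x, φ (X x) * Z x ∂μ = ∫ x, φ (X x) * n (X x) ∂μ := by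
  refine ⟨fun b => clamp B (∫ y, y ∂(condDistrib Z X μ b)), ?_, fun b => abs_clamp_le hB _,
    fun φ hφ C hC => ?_⟩
  · exact (measurable_clamp B).comp (measurable_integral_condDistrib measurable_id)
  · exact (regression_of_ae_eq hX hZ measurable_id hB hZB MeasurableSet.univ
      (.of_forall fun _ _ => rfl)).2 φ hφ C hC (fun b hb => (hb trivial).elim)

end Disintegration

/-! ### Measurability of the observed data, and averaging over the current treatment. -/

namespace GPI

variable {d e : ℕ}

theorem measurable_of_sigma {γ : Type*} [MeasurableSpace γ] {β : ℕ → Type*}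
    [∀ n, MeasurableSpace (β n)] {φ : (Σ n, β n) → γ} (h : ∀ n, Measurable fun x => φ ⟨n, x⟩) :
    Measurable φ :=
  fun _ hs => MeasurableSpace.measurableSet_iInf.2 fun n => h n hs

theorem measurable_outcome : Measurable (outcome : Obs d → ℝ) := measurable_fst

theorem measurable_len : Measurable (len : Obs d → ℕ) := by
  refine (measurable_of_sigma (φ := fun x : Σ n : ℕ, (Fin n → Bool × (Fin d → ℝ)) => x.1)
    fun n => measurable_const).comp measurable_snd

theorem measurable_treat (s : ℕ) : Measurable (treat s : Obs d → Bool) := by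
  refine (measurable_of_sigma (φ := fun x : Σ n : ℕ, (Fin n → Bool × (Fin d → ℝ)) =>
    if h : s < x.1 then (x.2 ⟨s, h⟩).1 else false) fun n => ?_).comp measurable_snd
  by_cases h : s < n
  · simp only [h, dite_true]
    change Measurable fun x : Fin n → Bool × (Fin d → ℝ) => (x ⟨s, h⟩).1
    fun_prop
  · simp only [h, dite_false]
    exact measurable_const

theorem measurable_feat {f : ℕ → (Fin d → ℝ) → (Fin e → ℝ)} (hf : ∀ s, Measurable (f s)) (s : ℕ) :
    Measurable (feat f s : Obs d → Fin e → ℝ) := by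
  refine (measurable_of_sigma (φ := fun x : Σ n : ℕ, (Fin n → Bool × (Fin d → ℝ)) =>
    if h : s < x.1 then f s (x.2 ⟨s, h⟩).2 else 0) fun n => ?_).comp measurable_snd
  by_cases h : s < n
  · simp only [h, dite_true]
    have := hf s
    change Measurable fun x : Fin n → Bool × (Fin d → ℝ) => f s (x ⟨s, h⟩).2
    fun_prop
  · simp only [h, dite_false]
    exact measurable_const

theorem measurable_treatHist (s : ℕ) : Measurable (treatHist s : Obs d → Fin s → Bool) :=
  measurable_pi_lambda _ fun _ => measurable_treat _

theorem measurable_hist {f : ℕ → (Fin d → ℝ) → (Fin e → ℝ)} (hf : ∀ s, Measurable (f s)) (s : ℕ) :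
    Measurable (hist f s) :=
  measurable_len.prodMk ((measurable_treatHist s).prodMk
    (measurable_pi_lambda _ fun _ => measurable_feat hf _))

theorem measurable_histTreat {f : ℕ → (Fin d → ℝ) → (Fin e → ℝ)} (hf : ∀ s, Measurable (f s))
    (s : ℕ) : Measurable (histTreat f s) :=
  (measurable_hist hf s).prodMk (measurable_treat s)

theorem measurableSet_cell (s : ℕ) (v : Fin s → Bool) : MeasurableSet (cell s v : Set (Obs d)) :=
  (measurableSet_lt measurable_const measurable_len).inter
    (measurable_treatHist s (measurableSet_singleton v))

theorem measurable_uncurry_bool {β γ : Type*} [MeasurableSpace β] [MeasurableSpace γ]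
    {φ : β → Bool → γ} (h : ∀ w, Measurable fun b => φ b w) :
    Measurable fun z : β × Bool => φ z.1 z.2 :=
  measurable_from_prod_countable_left h

/-- The Bernoulli probability mass function with success probability `x`. -/
def bern (x : ℝ) (w : Bool) : ℝ := if w then x else 1 - x

theorem bern_nonneg {x : ℝ} (h0 : 0 ≤ x) (h1 : x ≤ 1) (w : Bool) : 0 ≤ bern x w := by
  cases w <;> simp [bern, h0, h1]

theorem bern_le_one {x : ℝ} (h0 : 0 ≤ x) (h1 : x ≤ 1) (w : Bool) : bern x w ≤ 1 := by
  cases w <;> simp [bern, h0, h1]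

theorem abs_bern_sub (x y : ℝ) (w : Bool) : |bern x w - bern y w| = |x - y| := by
  cases w
  · simp [bern, abs_sub_comm]
  · simp [bern]

variable {f : ℕ → (Fin d → ℝ) → (Fin e → ℝ)} {δ : ℕ → ℝ} {Q : ProbabilityMeasure (Obs d)}

theorem trtProb_nonneg (s : ℕ) (v : Fin s → Bool) : 0 ≤ trtProb Q s v := measureReal_nonneg

theorem trtProb_le_one (s : ℕ) (v : Fin s → Bool) : trtProb Q s v ≤ 1 := by
  unfold trtProb
  by_cases h : (Q : Measure (Obs d)) (cell s v) = 0
  · simp [ProbabilityTheory.cond_eq_zero_of_meas_eq_zero h]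
  · have := cond_isProbabilityMeasure h
    exact measureReal_le_one

theorem propensity_nonneg (s : ℕ) (h : Hist e s) : 0 ≤ propensity Q f s h := measureReal_nonneg

theorem propensity_le_one (s : ℕ) (h : Hist e s) : propensity Q f s h ≤ 1 := measureReal_le_one

theorem bern_propensity (s : ℕ) (h : Hist e s) (w : Bool) :
    bern (propensity Q f s h) w
      = (condDistrib (treat s) (hist f s) (Q : Measure (Obs d)) h).real {w} := by
  cases w
  · have := probReal_compl_eq_one_sub
      (μ := condDistrib (treat s) (hist f s) (Q : Measure (Obs d)) h)
      (measurableSet_singleton true)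
    have h2 : ({true} : Set Bool)ᶜ = {false} := by ext b; cases b <;> simp
    rw [h2] at this
    simp [bern, propensity, this]
  · simp [bern, propensity]

theorem measurable_propensity (s : ℕ) : Measurable (propensity Q f s : Hist e s → ℝ) :=
  (Kernel.measurable_coe _ (measurableSet_singleton true)).ennreal_toReal

theorem measurable_bern {β : Type*} [MeasurableSpace β] {x : β → ℝ} (hx : Measurable x) (w : Bool) :
    Measurable fun b => bern (x b) w := by
  cases w <;> simp only [bern] <;> simp <;> fun_prop

/-- Given the history, the treatment is Bernoulli with the propensity score as parameter. -/
theorem integral_histTreat (hf : ∀ s, Measurable (f s)) (s : ℕ) {φ : Hist e s → Bool → ℝ}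
    (hφ : ∀ w, Measurable fun h => φ h w) {C : ℝ} (hC : ∀ h w, |φ h w| ≤ C) :
    ∫ D, φ (hist f s D) (treat s D) ∂(Q : Measure (Obs d))
      = ∫ D, ∑ w : Bool, bern (propensity Q f s (hist f s D)) w * φ (hist f s D) w
        ∂(Q : Measure (Obs d)) := by
  rw [integral_eq_integral_condDistrib (measurable_hist hf s) (measurable_treat s)
    (F := fun z => φ z.1 z.2) (measurable_uncurry_bool hφ) (fun z => hC z.1 z.2)]
  refine integral_congr_ae (.of_forall fun D => ?_)
  simp only
  rw [integral_fintype .of_finite]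
  simp only [bern_propensity, smul_eq_mul]

theorem lintegral_histTreat (hf : ∀ s, Measurable (f s)) (s : ℕ) {φ : Hist e s → Bool → ENNReal}
    (hφ : ∀ w, Measurable fun h => φ h w) :
    ∫⁻ D, φ (hist f s D) (treat s D) ∂(Q : Measure (Obs d))
      = ∫⁻ D, ∑ w : Bool, ENNReal.ofReal (bern (propensity Q f s (hist f s D)) w)
          * φ (hist f s D) w ∂(Q : Measure (Obs d)) := by
  rw [lintegral_eq_lintegral_condDistrib (measurable_hist hf s) (measurable_treat s)
    (F := fun z => φ z.1 z.2) (measurable_uncurry_bool hφ)]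
  refine lintegral_congr fun D => ?_
  rw [lintegral_fintype]
  refine Finset.sum_congr rfl fun w _ => ?_
  rw [bern_propensity, measureReal_def, ENNReal.ofReal_toReal (measure_ne_top _ _), mul_comm]

/-- Passes from the observed treatment to every treatment of positive propensity: the conditional
law of the treatment charges each such value, so an almost sure property cannot fail at it. -/
theorem ae_forall_treat (hf : ∀ s, Measurable (f s)) (s : ℕ) {p : Hist e s → Bool → Prop}
    (hp : ∀ w, MeasurableSet {h | p h w})
    (h : ∀ᵐ D ∂(Q : Measure (Obs d)), p (hist f s D) (treat s D)) :
    ∀ᵐ D ∂(Q : Measure (Obs d)), ∀ w,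
      bern (propensity Q f s (hist f s D)) w ≠ 0 → p (hist f s D) w := by
  classical
  have hpm : MeasurableSet {z : Hist e s × Bool | p z.1 z.2} := by
    have : Measurable fun z : Hist e s × Bool => p z.1 z.2 :=
      measurable_uncurry_bool (γ := Prop) fun w => measurableSet_setOfPred.1 (hp w)
    exact measurableSet_setOfPred.2 this
  filter_upwards [ae_condDistrib_of_ae (measurable_hist hf s) (measurable_treat s)
    (p := fun z => p z.1 z.2) hpm h] with D hD w hw
  rw [bern_propensity] at hw
  by_contra hn
  refine hw ?_
  rw [measureReal_def, measure_mono_null _ (ae_iff.1 hD), ENNReal.toReal_zero]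
  intro b hb
  rw [Set.mem_singleton_iff.1 hb]
  exact hn

theorem ae_outcome_bounded {smax : ℕ} {𝒴 : Set ℝ} {B : ℝ} (hB : ∀ y ∈ 𝒴, |y| ≤ B)
    (hQ : Q ∈ model smax 𝒴 f) : ∀ᵐ D ∂(Q : Measure (Obs d)), |outcome D| ≤ B :=
  hQ.2.1.mono fun _ h => hB _ h

end GPI

/-! ### The weights, and the intervention as a change of measure. -/

namespace GPI

variable {d e : ℕ} {f : ℕ → (Fin d → ℝ) → (Fin e → ℝ)} {δ : ℕ → ℝ}

/-! ### The intervention probabilities -/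

theorem dQ_denom_pos {δ p : ℝ} (hδ : 0 < δ) (h0 : 0 ≤ p) (h1 : p ≤ 1) : 0 < δ * p + 1 - p := by
  rcases h0.eq_or_lt with h | h
  · simp [← h]
  · nlinarith [mul_pos hδ h]

/-- The denominator is a convex combination of `δ` and `1`. -/
theorem dQ_denom_ge {δ p : ℝ} (h0 : 0 ≤ p) (h1 : p ≤ 1) :
    min δ 1 ≤ δ * p + 1 - p := by
  have h2 : min δ 1 * p ≤ δ * p := mul_le_mul_of_nonneg_right (min_le_left _ _) h0
  have h3 : min δ 1 * (1 - p) ≤ 1 * (1 - p) :=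
    mul_le_mul_of_nonneg_right (min_le_right _ _) (by linarith)
  linarith

theorem dQ_true (δ p : ℝ) : dQ δ p true = δ * p / (δ * p + 1 - p) := by simp [dQ, num]

theorem dQ_false (δ p : ℝ) : dQ δ p false = (1 - p) / (δ * p + 1 - p) := by simp [dQ, num]

theorem dQ_nonneg {δ p : ℝ} (hδ : 0 < δ) (h0 : 0 ≤ p) (h1 : p ≤ 1) (w : Bool) : 0 ≤ dQ δ p w := by
  have := dQ_denom_pos hδ h0 h1
  have h2 : 0 ≤ 1 - p := by linarith
  cases w
  · rw [dQ_false]; positivity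
  · rw [dQ_true]; positivity

theorem sum_dQ {δ p : ℝ} (hδ : 0 < δ) (h0 : 0 ≤ p) (h1 : p ≤ 1) : ∑ w, dQ δ p w = 1 := by
  have := (dQ_denom_pos hδ h0 h1).ne'
  rw [Fintype.sum_bool, dQ_true, dQ_false]
  field_simp
  ring

theorem dQ_le_one {δ p : ℝ} (hδ : 0 < δ) (h0 : 0 ≤ p) (h1 : p ≤ 1) (w : Bool) : dQ δ p w ≤ 1 := by
  rw [← sum_dQ hδ h0 h1]
  exact Finset.single_le_sum (fun w _ => dQ_nonneg hδ h0 h1 w) (Finset.mem_univ w)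

/-- This is why overlap relative to `p` suffices: the intervention never puts mass on a treatment of
probability zero. -/
theorem dQ_le_bern {δ p : ℝ} (hδ : 0 < δ) (h0 : 0 ≤ p) (h1 : p ≤ 1) (w : Bool) :
    dQ δ p w ≤ max δ 1 / min δ 1 * bern p w := by
  have hm : 0 < min δ 1 := lt_min hδ one_pos
  have hd := dQ_denom_ge (δ := δ) h0 h1
  have hb := bern_nonneg h0 h1 w
  have hM : 0 ≤ max δ 1 := hδ.le.trans (le_max_left _ _)
  have h2 : 0 ≤ 1 - p := by linarith
  rw [div_mul_eq_mul_div]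
  cases w
  · rw [dQ_false]
    simp only [bern, Bool.false_eq_true, if_false] at hb ⊢
    gcongr
    nlinarith [le_max_right δ 1]
  · rw [dQ_true]
    simp only [bern, if_true] at hb ⊢
    gcongr
    exact le_max_left _ _

/-- An exact difference quotient. As `p' → p` it becomes the factor with the squared denominator in
the influence function. -/
theorem dQ_true_sub {δ p p' : ℝ} (hδ : 0 < δ) (h0 : 0 ≤ p) (h1 : p ≤ 1) (h0' : 0 ≤ p')
    (h1' : p' ≤ 1) : dQ δ p' true - dQ δ p true
      = (p' - p) * (δ / ((δ * p' + 1 - p') * (δ * p + 1 - p))) := by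
  have := (dQ_denom_pos hδ h0 h1).ne'
  have := (dQ_denom_pos hδ h0' h1').ne'
  rw [dQ_true, dQ_true]
  field_simp
  ring

theorem abs_dQ_sub_le {δ p p' : ℝ} (hδ : 0 < δ) (h0 : 0 ≤ p) (h1 : p ≤ 1) (h0' : 0 ≤ p')
    (h1' : p' ≤ 1) (w : Bool) :
    |dQ δ p' w - dQ δ p w| ≤ δ / (min δ 1 * min δ 1) * |p' - p| := by
  have hm : 0 < min δ 1 := lt_min hδ one_pos
  have ht : |dQ δ p' true - dQ δ p true| ≤ δ / (min δ 1 * min δ 1) * |p' - p| := by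
    have d1 := dQ_denom_pos hδ h0 h1
    have d2 := dQ_denom_pos hδ h0' h1'
    rw [dQ_true_sub hδ h0 h1 h0' h1', abs_mul, mul_comm, abs_of_pos (by positivity)]
    have := dQ_denom_ge (δ := δ) h0 h1
    have := dQ_denom_ge (δ := δ) h0' h1'
    gcongr
  cases w
  · have e1 := sum_dQ hδ h0 h1
    have e2 := sum_dQ hδ h0' h1'
    rw [Fintype.sum_bool] at e1 e2
    have : dQ δ p' false - dQ δ p false = -(dQ δ p' true - dQ δ p true) := by linarith
    rw [this, abs_neg]
    exact ht
  · exact ht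

/-- The weight is the likelihood ratio of the intervention to the observed treatment mechanism. -/
theorem weight_eq (P : ProbabilityMeasure (Obs d)) (s : ℕ) (h : Hist e s) (w : Bool) :
    weight P f δ s h w = dQ (δ s) (trtProb P s h.2.1) w / bern (propensity P f s h) w := by
  cases w
  · simp only [weight, dQ, bern, num]; simp; ring
  · simp only [weight, dQ, bern, num]; simp; ring

/-! ### Bounded weights -/

/-- `1` if segment `s` exists. -/
def act {e : ℕ} (s : ℕ) (h : Hist e s) : ℝ := if s < h.1 then 1 else 0

theorem act_nonneg (s : ℕ) (h : Hist e s) : 0 ≤ act s h := by unfold act; split_ifs <;> simp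

theorem act_le_one (s : ℕ) (h : Hist e s) : act s h ≤ 1 := by unfold act; split_ifs <;> simp

theorem abs_act_le (s : ℕ) (h : Hist e s) : |act s h| ≤ 1 := by
  rw [abs_of_nonneg (act_nonneg s h)]; exact act_le_one s h

theorem measurable_act (s : ℕ) : Measurable (act s : Hist e s → ℝ) :=
  (Measurable.of_discrete (f := fun n : ℕ => if s < n then (1 : ℝ) else 0)).comp measurable_fst

theorem act_hist (s : ℕ) (D : Obs d) : act s (hist f s D) = if s < len D then 1 else 0 := rfl

theorem measurable_treatHist_comp {s : ℕ} {γ : Type*} [MeasurableSpace γ]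
    (φ : (Fin s → Bool) → γ) : Measurable fun h : Hist e s => φ h.2.1 :=
  (Measurable.of_discrete (f := φ)).comp (measurable_fst.comp measurable_snd)

/-- `K` bounds the weights almost surely. -/
def IsWeightBound (Q : ProbabilityMeasure (Obs d)) (f : ℕ → (Fin d → ℝ) → (Fin e → ℝ)) (δ : ℕ → ℝ)
    (K : ℝ) : Prop :=
  0 ≤ K ∧ ∀ᵐ D ∂(Q : Measure (Obs d)), ∀ s < len D, ∀ w,
    0 ≤ weight Q f δ s (hist f s D) w ∧ weight Q f δ s (hist f s D) w ≤ K ∧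
    bern (propensity Q f s (hist f s D)) w * weight Q f δ s (hist f s D) w
      = dQ (δ s) (trtProb Q s (treatHist s D)) w

theorem bern_overlap {c p π : ℝ} (h1 : c * p ≤ π) (h2 : c * (1 - p) ≤ 1 - π) (w : Bool) :
    c * bern p w ≤ bern π w := by
  cases w
  · simpa [bern] using h2
  · simpa [bern] using h1

variable {smax : ℕ} {𝒴 : Set ℝ} {Q : ProbabilityMeasure (Obs d)}

/-- Intervention probabilities are at most a constant times the treatment probabilities, which by
overlap are at most `1 / c` times the propensities. Only finitely many segments occur, so one
constant serves all. -/
theorem exists_isWeightBound (hδ : ∀ s < smax, 0 < δ s) (hQ : Q ∈ model smax 𝒴 f) :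
    ∃ K, IsWeightBound Q f δ K := by
  obtain ⟨hlen, -, c, hc, hov⟩ := hQ
  obtain ⟨M, hM⟩ := ((Finset.range smax).image fun s => max (δ s) 1 / min (δ s) 1).exists_le
  refine ⟨max M 0 / c, by positivity, ?_⟩
  filter_upwards [hlen, hov] with D hD hovD s hs w
  have hsm : s < smax := hs.trans_le hD.2
  have hp0 := trtProb_nonneg (Q := Q) s (treatHist s D)
  have hp1 := trtProb_le_one (Q := Q) s (treatHist s D)
  have ho := bern_overlap (hovD s hs).1 (hovD s hs).2 w
  have hb := bern_nonneg (propensity_nonneg (Q := Q) (f := f) s (hist f s D))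
    (propensity_le_one _ _) w
  have hbp := bern_nonneg hp0 hp1 w
  have hq0 := dQ_nonneg (hδ s hsm) hp0 hp1 w
  have hq : dQ (δ s) (trtProb Q s (treatHist s D)) w
      ≤ max M 0 * bern (trtProb Q s (treatHist s D)) w := by
    refine (dQ_le_bern (hδ s hsm) hp0 hp1 w).trans (mul_le_mul_of_nonneg_right ?_ hbp)
    exact (hM _ (Finset.mem_image_of_mem _ (Finset.mem_range.2 hsm))).trans (le_max_left _ _)
  have hcb : bern (trtProb Q s (treatHist s D)) w ≤ bern (propensity Q f s (hist f s D)) w / c := by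
    rw [le_div_iff₀ hc]; linarith
  have hM0 : 0 ≤ max M 0 := le_max_right _ _
  have hqK : dQ (δ s) (trtProb Q s (treatHist s D)) w
      ≤ max M 0 / c * bern (propensity Q f s (hist f s D)) w := by
    refine hq.trans ((mul_le_mul_of_nonneg_left hcb hM0).trans_eq (by ring))
  rw [weight_eq]
  change 0 ≤ dQ (δ s) (trtProb Q s (treatHist s D)) w / _ ∧
    dQ (δ s) (trtProb Q s (treatHist s D)) w / _ ≤ _ ∧
    _ * (dQ (δ s) (trtProb Q s (treatHist s D)) w / _) = _
  refine ⟨div_nonneg hq0 hb, ?_, ?_⟩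
  · exact div_le_of_le_mul₀ hb (by positivity) hqK
  -- At zero propensity the intervention probability is zero too, so the convention `0/0 = 0`
  -- preserves the identity.
  · rcases hb.eq_or_lt with h0 | h0
    · rw [← h0] at hqK ⊢
      simp only [mul_zero] at hqK
      rw [zero_mul]; exact le_antisymm hq0 hqK
    · field_simp

/-- The weight, truncated to `[0, K]`. -/
def boundedWeight (Q : ProbabilityMeasure (Obs d)) (f : ℕ → (Fin d → ℝ) → (Fin e → ℝ))
    (δ : ℕ → ℝ) (K : ℝ) (s : ℕ) (h : Hist e s) (w : Bool) : ℝ :=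
  max 0 (min (weight Q f δ s h w) K)

theorem boundedWeight_nonneg (K : ℝ) (s : ℕ) (h : Hist e s) (w : Bool) :
    0 ≤ boundedWeight Q f δ K s h w := le_max_left _ _

theorem boundedWeight_le {K : ℝ} (hK : 0 ≤ K) (s : ℕ) (h : Hist e s) (w : Bool) :
    boundedWeight Q f δ K s h w ≤ K := max_le hK (min_le_right _ _)

theorem measurable_dQ_trtProb (s : ℕ) (w : Bool) :
    Measurable fun h : Hist e s => dQ (δ s) (trtProb Q s h.2.1) w :=
  measurable_treatHist_comp fun v => dQ (δ s) (trtProb Q s v) w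

theorem measurable_boundedWeight (K : ℝ) (s : ℕ) (w : Bool) :
    Measurable fun h => boundedWeight Q f δ K s h w := by
  have : Measurable fun h => weight Q f δ s h w := by
    simp only [weight_eq]
    exact (measurable_dQ_trtProb s w).div (measurable_bern (measurable_propensity s) w)
  exact measurable_const.max (this.min measurable_const)

theorem IsWeightBound.boundedWeight_eq {K : ℝ} (hK : IsWeightBound Q f δ K) :
    ∀ᵐ D ∂(Q : Measure (Obs d)), ∀ s < len D, ∀ w,
      boundedWeight Q f δ K s (hist f s D) w = weight Q f δ s (hist f s D) w := by
  filter_upwards [hK.2] with D hD s hs w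
  rw [boundedWeight, min_eq_left (hD s hs w).2.1, max_eq_right (hD s hs w).1]

theorem IsWeightBound.bern_mul {K : ℝ} (hK : IsWeightBound Q f δ K) :
    ∀ᵐ D ∂(Q : Measure (Obs d)), ∀ s < len D, ∀ w,
      bern (propensity Q f s (hist f s D)) w * boundedWeight Q f δ K s (hist f s D) w
        = dQ (δ s) (trtProb Q s (treatHist s D)) w := by
  filter_upwards [hK.2, hK.boundedWeight_eq] with D hD hD' s hs w
  rw [hD' s hs w, (hD s hs w).2.2]

/-- Multiplying by the weight turns the observed treatment into one drawn from the intervention,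
since propensity times weight is the intervention probability. -/
theorem IsWeightBound.integral_balance {K : ℝ} (hK : IsWeightBound Q f δ K)
    (hf : ∀ s, Measurable (f s)) (s : ℕ) {φ : Hist e s → Bool → ℝ}
    (hφ : ∀ w, Measurable fun h => φ h w) {C : ℝ} (hC : ∀ h w, |φ h w| ≤ C) :
    ∫ D, act s (hist f s D) * (boundedWeight Q f δ K s (hist f s D) (treat s D)
        * φ (hist f s D) (treat s D)) ∂(Q : Measure (Obs d))
      = ∫ D, act s (hist f s D) * ∑ w, dQ (δ s) (trtProb Q s (treatHist s D)) w
        * φ (hist f s D) w ∂(Q : Measure (Obs d)) := by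
  rw [integral_histTreat hf s
    (φ := fun h w => act s h * (boundedWeight Q f δ K s h w * φ h w)) (C := 1 * (K * C))
    (fun w => (measurable_act s).mul ((measurable_boundedWeight K s w).mul (hφ w)))
    (fun h w => by
      rw [abs_mul, abs_mul, abs_of_nonneg (boundedWeight_nonneg K s h w)]
      have hC0 := (abs_nonneg _).trans (hC h w)
      exact mul_le_mul (abs_act_le s h) (mul_le_mul (boundedWeight_le hK.1 s h w) (hC h w)
        (abs_nonneg _) hK.1) (mul_nonneg (boundedWeight_nonneg K s h w) (abs_nonneg _))
          zero_le_one)]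
  refine integral_congr_ae ?_
  filter_upwards [hK.bern_mul] with D hD
  by_cases hs : s < len D
  · simp only [act_hist, hs, if_true, one_mul]
    exact Finset.sum_congr rfl fun w _ => by rw [← hD s hs w, mul_assoc]
  · simp [act_hist, hs]

theorem measurableSet_len_eq (n : ℕ) : MeasurableSet {D : Obs d | len D = n} :=
  measurable_len (measurableSet_singleton n)

theorem setLIntegral_len_eq (f : ℕ → (Fin d → ℝ) → (Fin e → ℝ)) (s n : ℕ) (G : Obs d → ENNReal) :
    ∫⁻ D in {D | len D = n}, G D ∂(Q : Measure (Obs d))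
      = ∫⁻ D, (if (hist f s D).1 = n then 1 else 0) * G D ∂(Q : Measure (Obs d)) := by
  rw [← lintegral_indicator (measurableSet_len_eq n)]
  refine lintegral_congr fun D => ?_
  by_cases h : len D = n
  · have h' : (hist f s D).1 = n := h
    simp [Set.indicator, h, h']
  · have h' : ¬ (hist f s D).1 = n := h
    simp [Set.indicator, h, h']

theorem measurable_ite_len (s n : ℕ) :
    Measurable fun h : Hist e s => if h.1 = n then (1 : ENNReal) else 0 :=
  (Measurable.of_discrete (f := fun k : ℕ => if k = n then (1 : ENNReal) else 0)).comp measurable_fst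

theorem IsWeightBound.lintegral_balance {K : ℝ} (hK : IsWeightBound Q f δ K)
    (hf : ∀ s, Measurable (f s)) {s n : ℕ} (hs : s < n) {φ : Hist e s → Bool → ENNReal}
    (hφ : ∀ w, Measurable fun h => φ h w) :
    ∫⁻ D in {D | len D = n}, ENNReal.ofReal (boundedWeight Q f δ K s (hist f s D) (treat s D))
        * φ (hist f s D) (treat s D) ∂(Q : Measure (Obs d))
      = ∫⁻ D in {D | len D = n}, ∑ w, ENNReal.ofReal (dQ (δ s) (trtProb Q s (treatHist s D)) w)
        * φ (hist f s D) w ∂(Q : Measure (Obs d)) := by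
  rw [setLIntegral_len_eq f s, setLIntegral_len_eq f s, lintegral_histTreat hf s
    (φ := fun h w => (if h.1 = n then 1 else 0)
      * (ENNReal.ofReal (boundedWeight Q f δ K s h w) * φ h w))
    (fun w => (measurable_ite_len s n).mul
      ((measurable_boundedWeight K s w).ennreal_ofReal.mul (hφ w)))]
  refine lintegral_congr_ae ?_
  filter_upwards [hK.bern_mul] with D hD
  by_cases hn : (hist f s D).1 = n
  · have hs' : s < len D := by change s < (hist f s D).1; omega
    simp only [hn, if_true, one_mul]
    refine Finset.sum_congr rfl fun w _ => ?_
    rw [← hD s hs' w, ENNReal.ofReal_mul (bern_nonneg (propensity_nonneg _ _)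
      (propensity_le_one _ _) w), mul_assoc]
  · simp [hn]

/-! ### Cumulative weights as functions of the history -/

/-- The history at the previous segment. -/
def prevHist {s : ℕ} (h : Hist e (s + 1)) : Hist e s :=
  (h.1, fun j => h.2.1 j.castSucc, fun j => h.2.2 j.castSucc)

/-- The most recent treatment of a history. -/
def lastTreat {s : ℕ} (h : Hist e (s + 1)) : Bool := h.2.1 (Fin.last s)

theorem measurable_prevHist (s : ℕ) : Measurable (prevHist : Hist e (s + 1) → Hist e s) := by
  unfold prevHist; fun_prop

theorem measurable_lastTreat (s : ℕ) : Measurable (lastTreat : Hist e (s + 1) → Bool) :=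
  measurable_treatHist_comp fun v => v (Fin.last s)

/-- The product of the weights `u` along the history before segment `s`. -/
def prodWeight (u : (s : ℕ) → Hist e s → Bool → ℝ) : (s : ℕ) → Hist e s → ℝ
  | 0, _ => 1
  | s + 1, h => prodWeight u s (prevHist h) * u s (prevHist h) (lastTreat h)

variable {u : (s : ℕ) → Hist e s → Bool → ℝ}

/-- Cumulating along a history rather than along an observation makes the weight a function of the
history, so that it can be taken out of conditional means given that history. -/
theorem prodWeight_succ_hist (s : ℕ) (D : Obs d) :
    prodWeight u (s + 1) (hist f (s + 1) D)
      = prodWeight u s (hist f s D) * u s (hist f s D) (treat s D) := rfl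

theorem prodWeight_hist (s : ℕ) (D : Obs d) :
    prodWeight u s (hist f s D) = ∏ j ∈ Finset.range s, u j (hist f j D) (treat j D) := by
  induction s with
  | zero => rfl
  | succ s ih => rw [prodWeight_succ_hist, ih, Finset.prod_range_succ]

theorem measurable_prodWeight (hu : ∀ s w, Measurable fun h => u s h w) (s : ℕ) :
    Measurable (prodWeight u s) := by
  induction s with
  | zero => exact measurable_const
  | succ s ih =>
    exact (ih.comp (measurable_prevHist s)).mul ((measurable_uncurry_bool (hu s)).comp
      ((measurable_prevHist s).prodMk (measurable_lastTreat s)))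

theorem prodWeight_nonneg (hu : ∀ s h w, 0 ≤ u s h w) (s : ℕ) (h : Hist e s) :
    0 ≤ prodWeight u s h := by
  induction s with
  | zero => exact zero_le_one
  | succ s ih => exact mul_nonneg (ih _) (hu _ _ _)

theorem prodWeight_le (hu : ∀ s h w, 0 ≤ u s h w) {K : ℝ} (hK : 0 ≤ K) (huK : ∀ s h w, u s h w ≤ K)
    (s : ℕ) (h : Hist e s) : prodWeight u s h ≤ K ^ s := by
  induction s with
  | zero => simp [prodWeight]
  | succ s ih =>
    rw [pow_succ]
    exact mul_le_mul (ih _) (huK _ _ _) (hu _ _ _) (by positivity)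

theorem abs_prodWeight_boundedWeight_le {K : ℝ} (hK : 0 ≤ K) (s : ℕ) (h : Hist e s) :
    |prodWeight (boundedWeight Q f δ K) s h| ≤ K ^ s := by
  rw [abs_of_nonneg (prodWeight_nonneg (boundedWeight_nonneg K) s h)]
  exact prodWeight_le (boundedWeight_nonneg K) hK (boundedWeight_le hK) s h

theorem measurable_prodWeight_boundedWeight (K : ℝ) (s : ℕ) :
    Measurable (prodWeight (boundedWeight Q f δ K) s) :=
  measurable_prodWeight (measurable_boundedWeight K) s

/-! ### The law of the history under the intervention -/

theorem measurable_interventionKernel (s : ℕ) :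
    Measurable fun h : Hist e s =>
      ∑ w : Bool, ENNReal.ofReal (dQ (δ s) (trtProb Q s h.2.1) w) •
        condDistrib (hist f (s + 1)) (histTreat f s) (Q : Measure (Obs d)) (h, w) := by
  refine Measure.measurable_of_measurable_coe _ fun A hA => ?_
  simp only [Measure.coe_finsetSum, Finset.sum_apply, Measure.smul_apply, smul_eq_mul]
  refine Finset.measurable_sum _ fun w _ => (measurable_dQ_trtProb s w).ennreal_ofReal.mul ?_
  exact (Kernel.measurable_coe _ hA).comp (measurable_id.prodMk measurable_const)

theorem lintegral_mul_indicator {β : Type*} [MeasurableSpace β] (ν : Measure β) {A : Set β}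
    (hA : MeasurableSet A) (a b c : ENNReal) :
    ∫⁻ y, a * (b * (c * A.indicator (fun _ => 1) y)) ∂ν = a * (b * (c * ν A)) := by
  have hi : Measurable (A.indicator fun _ => (1 : ENNReal)) := measurable_const.indicator hA
  rw [lintegral_const_mul _ ((hi.const_mul _).const_mul _), lintegral_const_mul _ (hi.const_mul _),
    lintegral_const_mul _ hi, lintegral_indicator_const hA, one_mul]

/-- Change of measure, by induction on the segment: the balance identity exchanges the treatment
drawn from the intervention for the observed, weighted one, and disintegration then supplies the
next history. The condition `s ≤ n` ensures that all segments before `s` exist. -/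
theorem IsWeightBound.interventionLaw_eq {K : ℝ} (hK : IsWeightBound Q f δ K)
    (hf : ∀ s, Measurable (f s)) (n s : ℕ) (hs : s ≤ n) :
    interventionLaw Q f δ n s
      = (((Q : Measure (Obs d)).restrict {D | len D = n}).withDensity fun D =>
          ENNReal.ofReal (prodWeight (boundedWeight Q f δ K) s (hist f s D))).map (hist f s) := by
  induction s with
  | zero =>
    simp only [interventionLaw, prodWeight, ENNReal.ofReal_one]
    rw [show (fun _ : Obs d => (1 : ENNReal)) = 1 from rfl, withDensity_one]
    have hA : MeasurableSet {h : Hist e 0 | h.1 = n} := measurable_fst (measurableSet_singleton n)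
    exact Measure.restrict_map (measurable_hist hf 0) hA
  | succ s ih =>
    have hm : ∀ s, Measurable fun D : Obs d =>
        ENNReal.ofReal (prodWeight (boundedWeight Q f δ K) s (hist f s D)) := fun s =>
      ((measurable_prodWeight_boundedWeight K s).comp (measurable_hist hf s)).ennreal_ofReal
    ext A hA
    have hcd : ∀ w, Measurable fun h : Hist e s =>
        condDistrib (hist f (s + 1)) (histTreat f s) (Q : Measure (Obs d)) (h, w) A := fun w =>
      (Kernel.measurable_coe _ hA).comp (measurable_id.prodMk measurable_const)
    have hsum : Measurable fun h : Hist e s => (∑ w : Bool,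
        ENNReal.ofReal (dQ (δ s) (trtProb Q s h.2.1) w) •
        condDistrib (hist f (s + 1)) (histTreat f s) (Q : Measure (Obs d)) (h, w)) A :=
      (Measure.measurable_coe hA).comp (measurable_interventionKernel s)
    rw [interventionLaw, Measure.bind_apply hA (measurable_interventionKernel s).aemeasurable,
      ih (by omega), lintegral_map hsum (measurable_hist hf s),
      lintegral_withDensity_eq_lintegral_mul _ (hm s) (by exact hsum.comp (measurable_hist hf s)),
      Measure.map_apply (measurable_hist hf _) hA,
      withDensity_apply _ (measurable_hist hf _ hA),
      ← lintegral_indicator (measurable_hist hf _ hA)]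
    simp only [Pi.mul_apply, Measure.coe_finsetSum, Finset.sum_apply, Measure.smul_apply,
      smul_eq_mul, Finset.mul_sum]
    have h1 := hK.lintegral_balance hf (s := s) (n := n) hs (φ := fun h w =>
      ENNReal.ofReal (prodWeight (boundedWeight Q f δ K) s h) *
        condDistrib (hist f (s + 1)) (histTreat f s) (Q : Measure (Obs d)) (h, w) A)
      (fun w => (measurable_prodWeight_boundedWeight K s).ennreal_ofReal.mul (hcd w))
    refine (Eq.trans ?_ h1.symm).trans ?_
    · refine lintegral_congr fun D => Finset.sum_congr rfl fun w _ => ?_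
      change _ * (ENNReal.ofReal (dQ (δ s) (trtProb Q s (treatHist s D)) w) * _) = _
      ring
    · rw [setLIntegral_len_eq f s, setLIntegral_len_eq f s]
      have hF : Measurable fun z : (Hist e s × Bool) × Hist e (s + 1) =>
          (if z.1.1.1 = n then (1 : ENNReal) else 0) *
          (ENNReal.ofReal (boundedWeight Q f δ K s z.1.1 z.1.2) *
            (ENNReal.ofReal (prodWeight (boundedWeight Q f δ K) s z.1.1) *
              A.indicator (fun _ => 1) z.2)) := by
        refine ((measurable_ite_len s n).comp (measurable_fst.comp measurable_fst)).mul
          (((measurable_uncurry_bool (measurable_boundedWeight K s)).comp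
            measurable_fst).ennreal_ofReal.mul
          (((measurable_prodWeight_boundedWeight K s).comp
            (measurable_fst.comp measurable_fst)).ennreal_ofReal.mul
            ((measurable_const.indicator hA).comp measurable_snd)))
      have h2 := lintegral_eq_lintegral_condDistrib (μ := (Q : Measure (Obs d)))
        (measurable_histTreat hf s) (measurable_hist hf (s + 1)) hF
      refine (Eq.trans ?_ h2.symm).trans ?_
      · refine lintegral_congr fun D => ?_
        exact (lintegral_mul_indicator _ hA _ _ _).symm
      · refine lintegral_congr fun D => ?_
        change (if (hist f s D).1 = n then (1 : ENNReal) else 0) *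
          (ENNReal.ofReal (boundedWeight Q f δ K s (hist f s D) (treat s D)) *
            (ENNReal.ofReal (prodWeight (boundedWeight Q f δ K) s (hist f s D)) *
              A.indicator (fun _ => 1) (hist f (s + 1) D))) = _
        congr 1
        by_cases hD : hist f (s + 1) D ∈ A
        · have hD' : D ∈ hist f (s + 1) ⁻¹' A := hD
          rw [Set.indicator_of_mem hD, Set.indicator_of_mem hD', prodWeight_succ_hist,
            ENNReal.ofReal_mul (prodWeight_nonneg (boundedWeight_nonneg K) _ _), mul_one, mul_comm]
        · have hD' : D ∉ hist f (s + 1) ⁻¹' A := hD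
          rw [Set.indicator_of_notMem hD, Set.indicator_of_notMem hD', mul_zero, mul_zero]

end GPI

/-! ### The outcome models as iterated regressions. -/

namespace GPI

variable {d e : ℕ} {f : ℕ → (Fin d → ℝ) → (Fin e → ℝ)} {δ : ℕ → ℝ}
  {smax : ℕ} {𝒴 : Set ℝ} {Q : ProbabilityMeasure (Obs d)}

theorem outcomeModelAux_succ (k s : ℕ) (h : Hist e s) (w : Bool) :
    outcomeModelAux Q f δ (k + 1) s h w
      = ∫ h', ∑ v, dQ (δ (s + 1)) (trtProb Q (s + 1) h'.2.1) v * outcomeModelAux Q f δ k (s + 1) h' v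
        ∂(condDistrib (hist f (s + 1)) (histTreat f s) (Q : Measure (Obs d)) (h, w)) := by
  rw [outcomeModelAux]
  refine integral_congr_ae (.of_forall fun h' => ?_)
  simp only [Fintype.sum_bool, dQ_true, dQ_false]
  ring

theorem measurable_outcomeModelAux (k s : ℕ) (w : Bool) :
    Measurable fun h => outcomeModelAux Q f δ k s h w := by
  induction k generalizing s w with
  | zero =>
    exact (measurable_integral_condDistrib (Y := outcome) (X := histTreat f s)
      (μ := (Q : Measure (Obs d))) measurable_id).comp (measurable_id.prodMk measurable_const)
  | succ k ih =>
    simp only [outcomeModelAux_succ]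
    have hF : Measurable fun h' : Hist e (s + 1) =>
        ∑ v, dQ (δ (s + 1)) (trtProb Q (s + 1) h'.2.1) v * outcomeModelAux Q f δ k (s + 1) h' v :=
      Finset.measurable_sum _ fun v _ => (measurable_dQ_trtProb (s + 1) v).mul (ih (s + 1) v)
    exact (measurable_integral_condDistrib (Y := hist f (s + 1)) (X := histTreat f s)
      (μ := (Q : Measure (Obs d))) hF).comp (measurable_id.prodMk measurable_const)

theorem measurable_outcomeModel (s : ℕ) (w : Bool) :
    Measurable fun h => outcomeModel Q f δ s h w := by
  have h1 : Measurable fun z : ℕ × Hist e s => outcomeModelAux Q f δ z.1 s z.2 w :=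
    measurable_from_prod_countable_right fun k => measurable_outcomeModelAux k s w
  exact h1.comp (((Measurable.of_discrete (f := fun n : ℕ => n - (s + 1))).comp
    measurable_fst).prodMk measurable_id)

/-- The outcome model, truncated to `[-B, B]`. -/
def truncModel (Q : ProbabilityMeasure (Obs d)) (f : ℕ → (Fin d → ℝ) → (Fin e → ℝ)) (δ : ℕ → ℝ)
    (B : ℝ) (s : ℕ) (h : Hist e s) (w : Bool) : ℝ :=
  clamp B (outcomeModel Q f δ s h w)

theorem measurable_truncModel (B : ℝ) (s : ℕ) (w : Bool) :
    Measurable fun h => truncModel Q f δ B s h w :=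
  (measurable_clamp B).comp (measurable_outcomeModel s w)

theorem abs_truncModel_le {B : ℝ} (hB : 0 ≤ B) (s : ℕ) (h : Hist e s) (w : Bool) :
    |truncModel Q f δ B s h w| ≤ B := abs_clamp_le hB _

/-- The mean under the intervention given the history at segment `s`, equal to the outcome if there
is no such segment. -/
def value (Q : ProbabilityMeasure (Obs d)) (f : ℕ → (Fin d → ℝ) → (Fin e → ℝ)) (δ : ℕ → ℝ)
    (B : ℝ) (s : ℕ) (D : Obs d) : ℝ :=
  if s < len D then
    ∑ w, dQ (δ s) (trtProb Q s (treatHist s D)) w * truncModel Q f δ B s (hist f s D) w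
  else clamp B (outcome D)

theorem measurable_sum_dQ_mul {s : ℕ} {P : ProbabilityMeasure (Obs d)} {φ : Hist e s → Bool → ℝ}
    (hφ : ∀ w, Measurable fun h => φ h w) :
    Measurable fun h : Hist e s => ∑ w, dQ (δ s) (trtProb P s h.2.1) w * φ h w :=
  Finset.measurable_sum _ fun w _ => (measurable_dQ_trtProb s w).mul (hφ w)

theorem abs_sum_dQ_mul_le {δ p C : ℝ} (hδ : 0 < δ) (h0 : 0 ≤ p) (h1 : p ≤ 1) {φ : Bool → ℝ}
    (hφ : ∀ w, |φ w| ≤ C) : |∑ w, dQ δ p w * φ w| ≤ C := by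
  refine (Finset.abs_sum_le_sum_abs _ _).trans ?_
  rw [← one_mul C, ← sum_dQ hδ h0 h1, Finset.sum_mul]
  refine Finset.sum_le_sum fun w _ => ?_
  rw [abs_mul, abs_of_nonneg (dQ_nonneg hδ h0 h1 w)]
  exact mul_le_mul_of_nonneg_left (hφ w) (dQ_nonneg hδ h0 h1 w)

theorem measurable_value (hf : ∀ s, Measurable (f s)) (B : ℝ) (s : ℕ) :
    Measurable (value Q f δ B s) := by
  have h1 : Measurable fun D : Obs d =>
      ∑ w, dQ (δ s) (trtProb Q s (treatHist s D)) w * truncModel Q f δ B s (hist f s D) w := by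
    have h := (measurable_sum_dQ_mul (P := Q) (δ := δ) (φ := truncModel Q f δ B s)
      (measurable_truncModel B s)).comp (measurable_hist hf s)
    exact h
  have h2 : Measurable fun D : Obs d => clamp B (outcome D) :=
    (measurable_clamp B).comp measurable_outcome
  exact Measurable.ite (measurableSet_lt measurable_const measurable_len) h1 h2

theorem abs_value_le (hδ : ∀ s, 0 < δ s) {B : ℝ} (hB : 0 ≤ B) (s : ℕ) (D : Obs d) :
    |value Q f δ B s D| ≤ B := by
  unfold value
  split_ifs
  · exact abs_sum_dQ_mul_le (hδ s) (trtProb_nonneg _ _) (trtProb_le_one _ _)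
      fun w => abs_truncModel_le hB _ _ _
  · exact abs_clamp_le hB _

theorem truncModel_of_len {B : ℝ} {k s : ℕ} {h : Hist e s} (hh : h.1 = s + k + 1) (w : Bool) :
    truncModel Q f δ B s h w = clamp B (outcomeModelAux Q f δ k s h w) := by
  rw [truncModel, outcomeModel, show h.1 - (s + 1) = k by omega]

theorem bern_ne_zero_of_overlap (hQ : Q ∈ model smax 𝒴 f) :
    ∀ᵐ D ∂(Q : Measure (Obs d)), ∀ s < len D, ∀ w, bern (trtProb Q s (treatHist s D)) w ≠ 0 →
      bern (propensity Q f s (hist f s D)) w ≠ 0 := by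
  obtain ⟨-, -, c, hc, hov⟩ := hQ
  filter_upwards [hov] with D hD s hs w hw
  have h1 := bern_overlap (hD s hs).1 (hD s hs).2 w
  have h2 := (bern_nonneg (trtProb_nonneg (Q := Q) s (treatHist s D))
    (trtProb_le_one _ _) w).lt_of_ne' hw
  exact (lt_of_lt_of_le (mul_pos hc h2) h1).ne'

/-- Common to both cases of the recursion for the outcome model: `Y` is the outcome at the last
segment and the next history at earlier ones. Fixing the length fixes how many segments follow. -/
theorem regression_of_outcomeModelAux_eq (hf : ∀ s, Measurable (f s)) (hδ : ∀ s, 0 < δ s)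
    (hQ : Q ∈ model smax 𝒴 f) {B : ℝ} (hB0 : 0 ≤ B) (k s : ℕ)
    {γ : Type*} [MeasurableSpace γ] [StandardBorelSpace γ] [Nonempty γ] {Y : Obs d → γ}
    (hY : Measurable Y) {F : γ → ℝ} (hF : Measurable F)
    (hm : ∀ h w, outcomeModelAux Q f δ k s h w
      = ∫ y, F y ∂(condDistrib Y (histTreat f s) (Q : Measure (Obs d)) (h, w)))
    (hFV : ∀ᵐ D ∂(Q : Measure (Obs d)), len D = s + k + 1 → F (Y D) = value Q f δ B (s + 1) D) :
    (∀ᵐ D ∂(Q : Measure (Obs d)), len D = s + k + 1 → ∀ w,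
      bern (trtProb Q s (treatHist s D)) w ≠ 0 → |outcomeModelAux Q f δ k s (hist f s D) w| ≤ B) ∧
    ∀ φ : Hist e s × Bool → ℝ, Measurable φ → ∀ C, (∀ z, |φ z| ≤ C) →
      (∀ z, z.1.1 ≠ s + k + 1 → φ z = 0) →
      ∫ D, φ (histTreat f s D) * value Q f δ B (s + 1) D ∂(Q : Measure (Obs d))
        = ∫ D, φ (histTreat f s D) * truncModel Q f δ B s (hist f s D) (treat s D)
          ∂(Q : Measure (Obs d)) := by
  have hA : MeasurableSet {z : Hist e s × Bool | z.1.1 = s + k + 1} :=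
    (measurable_fst.comp measurable_fst) (measurableSet_singleton (s + k + 1))
  obtain ⟨h1, h2⟩ := regression_of_ae_eq (μ := (Q : Measure (Obs d))) (measurable_histTreat hf s)
    hY hF hB0 (abs_value_le hδ hB0 (s + 1)) hA hFV
  refine ⟨?_, fun φ hφ C hC hφ0 => ?_⟩
  -- The bound is known at the observed treatment only; positive propensity, implied by overlap when
  -- the treatment probability is positive, carries it to the other one.
  · have h3 := ae_forall_treat (Q := Q) hf s
      (p := fun h w => h.1 = s + k + 1 → |outcomeModelAux Q f δ k s h w| ≤ B) (fun w => by
        have m1 : MeasurableSet {h : Hist e s | h.1 = s + k + 1} :=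
          measurable_fst (measurableSet_singleton (s + k + 1))
        have m2 : MeasurableSet {h : Hist e s | |outcomeModelAux Q f δ k s h w| ≤ B} :=
          measurableSet_le (measurable_outcomeModelAux k s w).abs measurable_const
        exact m1.imp m2) (by
        filter_upwards [h1] with D hD hl
        rw [hm]
        exact hD hl)
    filter_upwards [h3, bern_ne_zero_of_overlap hQ] with D hD hD' hl w hw
    exact hD w (hD' s (by omega) w hw) hl
  · rw [h2 φ hφ C hC hφ0]
    refine integral_congr_ae (.of_forall fun D => ?_)
    simp only
    by_cases hl : (hist f s D).1 = s + k + 1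
    · rw [truncModel_of_len (k := k) hl, hm]
      rfl
    · rw [hφ0 _ hl, zero_mul, zero_mul]

/-- Backward induction in the number of remaining segments. The bound and the regression identity
are proved together because the bound at segment `s + 1` is what identifies the integrand at segment
`s` with the truncated value. -/
theorem outcomeModelAux_regression (hf : ∀ s, Measurable (f s)) (hδ : ∀ s, 0 < δ s)
    (hQ : Q ∈ model smax 𝒴 f) {B : ℝ} (hB0 : 0 ≤ B) (hB : ∀ y ∈ 𝒴, |y| ≤ B) (k s : ℕ) :
    (∀ᵐ D ∂(Q : Measure (Obs d)), len D = s + k + 1 → ∀ w,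
      bern (trtProb Q s (treatHist s D)) w ≠ 0 → |outcomeModelAux Q f δ k s (hist f s D) w| ≤ B) ∧
    ∀ φ : Hist e s × Bool → ℝ, Measurable φ → ∀ C, (∀ z, |φ z| ≤ C) →
      (∀ z, z.1.1 ≠ s + k + 1 → φ z = 0) →
      ∫ D, φ (histTreat f s D) * value Q f δ B (s + 1) D ∂(Q : Measure (Obs d))
        = ∫ D, φ (histTreat f s D) * truncModel Q f δ B s (hist f s D) (treat s D)
          ∂(Q : Measure (Obs d)) := by
  induction k generalizing s with
  | zero =>
    refine regression_of_outcomeModelAux_eq hf hδ hQ hB0 0 s measurable_outcome measurable_id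
      (fun _ _ => rfl) ?_
    filter_upwards [ae_outcome_bounded hB hQ] with D hD hl
    rw [value, if_neg (by omega), clamp_eq_self hD, id]
  | succ k ih =>
    refine regression_of_outcomeModelAux_eq hf hδ hQ hB0 (k + 1) s (measurable_hist hf (s + 1)) (F := fun h' => ∑ v, dQ (δ (s + 1))
      (trtProb Q (s + 1) h'.2.1) v * outcomeModelAux Q f δ k (s + 1) h' v)
      (measurable_sum_dQ_mul (measurable_outcomeModelAux k (s + 1)))
      (fun h w => outcomeModelAux_succ k s h w) ?_
    filter_upwards [(ih (s + 1)).1] with D hD hl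
    rw [value, if_pos (by omega)]
    refine Finset.sum_congr rfl fun w _ => ?_
    rw [truncModel_of_len (k := k) (by change len D = _; omega)]
    -- The outcome model is uncontrolled at such a treatment, but its intervention probability
    -- vanishes.
    by_cases hw : bern (trtProb Q (s + 1) (treatHist (s + 1) D)) w = 0
    · have h0 := dQ_le_bern (hδ (s + 1)) (trtProb_nonneg (Q := Q) (s + 1) (treatHist (s + 1) D))
        (trtProb_le_one _ _) w
      rw [hw, mul_zero] at h0
      have h1 := le_antisymm h0 (dQ_nonneg (hδ (s + 1)) (trtProb_nonneg _ _) (trtProb_le_one _ _) w)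
      change dQ (δ (s + 1)) (trtProb Q (s + 1) (treatHist (s + 1) D)) w * _ = _
      rw [h1, zero_mul, zero_mul]
    · rw [clamp_eq_self (hD (by omega) w hw)]
      rfl

end GPI

/-- `φ` is measurable and bounded. -/
structure BoundedMeasurable {Ω : Type*} [MeasurableSpace Ω] (φ : Ω → ℝ) : Prop where
  measurable : Measurable φ
  bounded : ∃ C, ∀ x, |φ x| ≤ C

namespace BoundedMeasurable

variable {Ω Ω' : Type*} [MeasurableSpace Ω] [MeasurableSpace Ω'] {φ ψ : Ω → ℝ}

theorem integrable (h : BoundedMeasurable φ) {μ : Measure Ω} [IsFiniteMeasure μ] :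
    Integrable φ μ := by
  obtain ⟨C, hC⟩ := h.bounded
  exact integrable_of_abs_le h.measurable hC

theorem const (c : ℝ) : BoundedMeasurable fun _ : Ω => c := ⟨measurable_const, |c|, fun _ => le_rfl⟩

theorem add (h : BoundedMeasurable φ) (h' : BoundedMeasurable ψ) :
    BoundedMeasurable fun x => φ x + ψ x := by
  obtain ⟨C, hC⟩ := h.bounded
  obtain ⟨C', hC'⟩ := h'.bounded
  exact ⟨h.measurable.add h'.measurable, C + C',
    fun x => (abs_add_le _ _).trans (add_le_add (hC x) (hC' x))⟩

theorem mul (h : BoundedMeasurable φ) (h' : BoundedMeasurable ψ) :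
    BoundedMeasurable fun x => φ x * ψ x := by
  obtain ⟨C, hC⟩ := h.bounded
  obtain ⟨C', hC'⟩ := h'.bounded
  exact ⟨h.measurable.mul h'.measurable, C * C', fun x => by
    rw [abs_mul]
    exact mul_le_mul (hC x) (hC' x) (abs_nonneg _) ((abs_nonneg _).trans (hC x))⟩

theorem neg (h : BoundedMeasurable φ) : BoundedMeasurable fun x => -φ x := by
  simpa using (const (Ω := Ω) (-1)).mul h

theorem sub (h : BoundedMeasurable φ) (h' : BoundedMeasurable ψ) :
    BoundedMeasurable fun x => φ x - ψ x := by
  simpa [sub_eq_add_neg] using h.add h'.neg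

theorem abs (h : BoundedMeasurable φ) : BoundedMeasurable fun x => |φ x| := by
  obtain ⟨C, hC⟩ := h.bounded
  exact ⟨h.measurable.abs, C, fun x => by rw [abs_abs]; exact hC x⟩

theorem pow_two (h : BoundedMeasurable φ) : BoundedMeasurable fun x => φ x ^ 2 := by
  simpa only [sq] using h.mul h

theorem sum {ι : Type*} (t : Finset ι) {φ : ι → Ω → ℝ} (h : ∀ i ∈ t, BoundedMeasurable (φ i)) :
    BoundedMeasurable fun x => ∑ i ∈ t, φ i x := by
  classical
  induction t using Finset.induction_on with
  | empty => simpa using const 0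
  | insert a t ha ih =>
    simp only [Finset.sum_insert ha]
    exact (h a (Finset.mem_insert_self _ _)).add
      (ih fun i hi => h i (Finset.mem_insert_of_mem hi))

theorem comp (h : BoundedMeasurable φ) {X : Ω' → Ω} (hX : Measurable X) :
    BoundedMeasurable fun x => φ (X x) := by
  obtain ⟨C, hC⟩ := h.bounded
  exact ⟨h.measurable.comp hX, C, fun x => hC _⟩

theorem uncurry_bool {φ : Ω → Bool → ℝ} (h : ∀ w, BoundedMeasurable fun x => φ x w) :
    BoundedMeasurable fun z : Ω × Bool => φ z.1 z.2 := by
  obtain ⟨C, hC⟩ := (h true).bounded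
  obtain ⟨C', hC'⟩ := (h false).bounded
  refine ⟨GPI.measurable_uncurry_bool fun w => (h w).measurable, max C C', ?_⟩
  rintro ⟨x, w⟩
  cases w
  · exact (hC' x).trans (le_max_right _ _)
  · exact (hC x).trans (le_max_left _ _)

theorem indicator {A : Set Ω} (hA : MeasurableSet A) :
    BoundedMeasurable (A.indicator fun _ => (1 : ℝ)) :=
  ⟨measurable_const.indicator hA, 1, fun x => by by_cases hx : x ∈ A <;> simp [hx]⟩

theorem ite {p : Ω → Prop} [DecidablePred p] (hp : MeasurableSet {x | p x}) :
    BoundedMeasurable fun x => if p x then (1 : ℝ) else 0 :=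
  ⟨Measurable.ite hp measurable_const measurable_const, 1, fun x => by
    by_cases hx : p x <;> simp [hx]⟩

end BoundedMeasurable

/-! ### The exact expansion of the target. -/

namespace GPI

variable {d e : ℕ} {f : ℕ → (Fin d → ℝ) → (Fin e → ℝ)} {δ : ℕ → ℝ}
  {smax : ℕ} {𝒴 : Set ℝ} {P Q : ProbabilityMeasure (Obs d)}

theorem boundedMeasurable_act (s : ℕ) : BoundedMeasurable (act s : Hist e s → ℝ) :=
  ⟨measurable_act s, 1, abs_act_le s⟩

theorem boundedMeasurable_of_treatHist {s : ℕ} (φ : (Fin s → Bool) → ℝ) :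
    BoundedMeasurable fun h : Hist e s => φ h.2.1 := by
  refine ⟨measurable_treatHist_comp φ, ∑ v, |φ v|, fun h => ?_⟩
  exact Finset.single_le_sum (f := fun v => |φ v|) (fun _ _ => abs_nonneg _) (Finset.mem_univ h.2.1)

theorem boundedMeasurable_truncModel {B : ℝ} (hB : 0 ≤ B) (s : ℕ) (w : Bool) :
    BoundedMeasurable fun h => truncModel Q f δ B s h w :=
  ⟨measurable_truncModel B s w, B, fun h => abs_truncModel_le hB s h w⟩

theorem boundedMeasurable_boundedWeight {K : ℝ} (hK : 0 ≤ K) (s : ℕ) (w : Bool) :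
    BoundedMeasurable fun h => boundedWeight Q f δ K s h w :=
  ⟨measurable_boundedWeight K s w, K, fun h => by
    rw [abs_of_nonneg (boundedWeight_nonneg K s h w)]; exact boundedWeight_le hK s h w⟩

theorem boundedMeasurable_prodWeight {K : ℝ} (hK : 0 ≤ K) (s : ℕ) :
    BoundedMeasurable (prodWeight (boundedWeight Q f δ K) s) :=
  ⟨measurable_prodWeight_boundedWeight K s, K ^ s, abs_prodWeight_boundedWeight_le hK s⟩

theorem boundedMeasurable_value (hf : ∀ s, Measurable (f s)) (hδ : ∀ s, 0 < δ s) {B : ℝ}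
    (hB : 0 ≤ B) (s : ℕ) : BoundedMeasurable (value Q f δ B s) :=
  ⟨measurable_value hf B s, B, abs_value_le hδ hB s⟩

theorem boundedMeasurable_sum_dQ_mul {s : ℕ} {φ : Hist e s → Bool → ℝ}
    (hφ : ∀ w, BoundedMeasurable fun h => φ h w) :
    BoundedMeasurable fun h : Hist e s => ∑ w, dQ (δ s) (trtProb P s h.2.1) w * φ h w :=
  .sum _ fun w _ => (boundedMeasurable_of_treatHist fun v => dQ (δ s) (trtProb P s v) w).mul (hφ w)

/-- The normal equations at all record lengths at once, obtained by summing over the number of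
segments that follow `s`, which is bounded in the model. -/
theorem integral_act_value (hf : ∀ s, Measurable (f s)) (hδ : ∀ s, 0 < δ s)
    (hQ : Q ∈ model smax 𝒴 f) {B : ℝ} (hB0 : 0 ≤ B) (hB : ∀ y ∈ 𝒴, |y| ≤ B) (s : ℕ)
    {φ : Hist e s × Bool → ℝ} (hφ : BoundedMeasurable φ) :
    ∫ D, act s (hist f s D) * (φ (histTreat f s D) * value Q f δ B (s + 1) D)
        ∂(Q : Measure (Obs d))
      = ∫ D, act s (hist f s D) * (φ (histTreat f s D)
          * truncModel Q f δ B s (hist f s D) (treat s D)) ∂(Q : Measure (Obs d)) := by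
  have hset : ∀ k, MeasurableSet {z : Hist e s × Bool | z.1.1 = s + k + 1} := fun k =>
    (measurable_fst.comp measurable_fst) (measurableSet_singleton (s + k + 1))
  set ι : ℕ → Hist e s × Bool → ℝ := fun k z => if z.1.1 = s + k + 1 then 1 else 0
  have hι : ∀ k, BoundedMeasurable (ι k) := fun k => .ite (hset k)
  have hsum : ∀ G : Obs d → ℝ, (fun D => act s (hist f s D) * (φ (histTreat f s D) * G D))
      =ᵐ[(Q : Measure (Obs d))]
      fun D => ∑ k ∈ Finset.range smax, ι k (histTreat f s D) * φ (histTreat f s D) * G D := by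
    intro G
    filter_upwards [hQ.1] with D hD
    rw [← Finset.sum_mul, ← Finset.sum_mul, mul_assoc]
    congr 1
    have hl : ∀ k, ι k (histTreat f s D) = if len D = s + k + 1 then 1 else 0 := fun k => rfl
    simp only [hl, act_hist]
    by_cases hs : s < len D
    -- The number of segments after segment `s`, segments being counted from zero.
    · rw [if_pos hs, Finset.sum_eq_single (len D - s - 1)]
      · rw [if_pos (by omega)]
      · intro k _ hk
        rw [if_neg (by omega)]
      · intro hk
        exact absurd (Finset.mem_range.2 (by omega)) hk
    · rw [if_neg hs]
      exact (Finset.sum_eq_zero fun k _ => if_neg (by omega)).symm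
  have hX := measurable_histTreat hf s
  rw [integral_congr_ae (hsum _), integral_congr_ae (hsum _), integral_finsetSum _ fun k _ =>
    ((((hι k).mul hφ).comp hX).mul (boundedMeasurable_value hf hδ hB0 (s + 1))).integrable,
    integral_finsetSum _ fun k _ => by
      exact ((((hι k).mul hφ).mul
        (.uncurry_bool (boundedMeasurable_truncModel hB0 s))).comp hX).integrable]
  refine Finset.sum_congr rfl fun k _ => ?_
  obtain ⟨C, hC⟩ := ((hι k).mul hφ).bounded
  exact (outcomeModelAux_regression hf hδ hQ hB0 hB k s).2 (fun z => ι k z * φ z)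
    ((hι k).mul hφ).measurable C hC (fun z hz => by
      have : ι k z = 0 := if_neg hz
      rw [this, zero_mul])

theorem outcomeModel_eq_truncModel (hf : ∀ s, Measurable (f s)) (hδ : ∀ s, 0 < δ s)
    (hQ : Q ∈ model smax 𝒴 f) {B : ℝ} (hB0 : 0 ≤ B) (hB : ∀ y ∈ 𝒴, |y| ≤ B) :
    ∀ᵐ D ∂(Q : Measure (Obs d)), ∀ s < len D, ∀ w, bern (trtProb Q s (treatHist s D)) w ≠ 0 →
      outcomeModel Q f δ s (hist f s D) w = truncModel Q f δ B s (hist f s D) w := by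
  have h1 : ∀ᵐ D ∂(Q : Measure (Obs d)), ∀ s k, len D = s + k + 1 → ∀ w,
      bern (trtProb Q s (treatHist s D)) w ≠ 0 → |outcomeModelAux Q f δ k s (hist f s D) w| ≤ B :=
    ae_all_iff.2 fun s => ae_all_iff.2 fun k =>
      (outcomeModelAux_regression hf hδ hQ hB0 hB k s).1
  filter_upwards [h1] with D hD s hs w hw
  rw [truncModel, clamp_eq_self]
  have := hD s (len D - (s + 1)) (by omega) w hw
  exact this

theorem dQ_eq_zero {δ p : ℝ} (hδ : 0 < δ) (h0 : 0 ≤ p) (h1 : p ≤ 1) {w : Bool}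
    (hw : bern p w = 0) : dQ δ p w = 0 := by
  have h := dQ_le_bern hδ h0 h1 w
  rw [hw, mul_zero] at h
  exact le_antisymm h (dQ_nonneg hδ h0 h1 w)

theorem measurable_hist_len (n : ℕ) : MeasurableSet {h : Hist e n | h.1 = n + 1} :=
  measurable_fst (measurableSet_singleton (n + 1))

/-- After the change of measure the last intervention average becomes one more weight, and the
outcome regression gives way to the outcome. The last segment of a record of length `n + 1` has
index `n`. -/
theorem IsWeightBound.integral_interventionLaw {K : ℝ} (hK : IsWeightBound Q f δ K)
    (hf : ∀ s, Measurable (f s)) (hδ : ∀ s, 0 < δ s)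
    (hQ : Q ∈ model smax 𝒴 f) {B : ℝ} (hB0 : 0 ≤ B) (hB : ∀ y ∈ 𝒴, |y| ≤ B) (n : ℕ) :
    ∫ h, ∑ w : Bool, dQ (δ n) (trtProb Q n h.2.1) w * outcomeReg Q f n h w
      ∂(interventionLaw Q f δ (n + 1) n)
    = ∫ D, (if len D = n + 1 then 1 else 0) *
        (prodWeight (boundedWeight Q f δ K) (len D) (hist f (len D) D) * clamp B (outcome D))
        ∂(Q : Measure (Obs d)) := by
  have hF : Measurable fun h : Hist e n =>
      ∑ w : Bool, dQ (δ n) (trtProb Q n h.2.1) w * outcomeReg Q f n h w :=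
    measurable_sum_dQ_mul (φ := outcomeReg Q f n) (measurable_outcomeModelAux (δ := δ) 0 n)
  have hH := measurable_hist hf n
  have hw : Measurable fun D : Obs d =>
      ENNReal.ofReal (prodWeight (boundedWeight Q f δ K) n (hist f n D)) :=
    ((measurable_prodWeight_boundedWeight K n).comp hH).ennreal_ofReal
  rw [hK.interventionLaw_eq hf (n + 1) n (by omega), integral_map hH.aemeasurable
    hF.aestronglyMeasurable, integral_withDensity_eq_integral_toReal_smul hw
    (.of_forall fun _ => ENNReal.ofReal_lt_top), ← integral_indicator (measurableSet_len_eq (n + 1))]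
  set ι : Hist e n → ℝ := fun h => if h.1 = n + 1 then 1 else 0 with hιd
  have hι : BoundedMeasurable ι := .ite (measurable_hist_len n)
  have hιl : ∀ D : Obs d, ι (hist f n D) = if len D = n + 1 then 1 else 0 := fun D => rfl
  have hιa : ∀ D : Obs d, act n (hist f n D) * ι (hist f n D) = ι (hist f n D) := fun D => by
    rw [hιl, act_hist]; split_ifs <;> first | omega | simp
  have hm := boundedMeasurable_truncModel (Q := Q) (f := f) (δ := δ) hB0 n
  have hΩ := boundedMeasurable_prodWeight (Q := Q) (f := f) (δ := δ) hK.1 n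
  obtain ⟨C, hC⟩ := (BoundedMeasurable.uncurry_bool
    fun w => hι.mul (hΩ.mul (hm w))).bounded
  have e1 := hK.integral_balance hf n (φ := fun h w => ι h *
    (prodWeight (boundedWeight Q f δ K) n h * truncModel Q f δ B n h w))
    (fun w => (hι.mul (hΩ.mul (hm w))).measurable) (fun h w => hC (h, w))
  have e2 := integral_act_value hf hδ hQ hB0 hB n (φ := fun z => ι z.1 *
    (prodWeight (boundedWeight Q f δ K) n z.1 * boundedWeight Q f δ K n z.1 z.2))
    (.uncurry_bool fun w => hι.mul (hΩ.mul (boundedMeasurable_boundedWeight hK.1 n w)))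
  refine (Eq.trans ?_ (e1.symm.trans (Eq.trans ?_ e2.symm))).trans ?_
  · refine integral_congr_ae ?_
    filter_upwards [outcomeModel_eq_truncModel hf hδ hQ hB0 hB] with D hD
    by_cases hl : len D = n + 1
    · have hl' : D ∈ {D : Obs d | len D = n + 1} := hl
      rw [Set.indicator_of_mem hl', ENNReal.toReal_ofReal
        (prodWeight_nonneg (boundedWeight_nonneg K) _ _), smul_eq_mul, Finset.mul_sum,
        Finset.mul_sum, act_hist, if_pos (by omega)]
      refine Finset.sum_congr rfl fun w _ => ?_
      rw [hιl, if_pos hl]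
      change _ * (dQ (δ n) (trtProb Q n (treatHist n D)) w * _) = _
      by_cases hw : bern (trtProb Q n (treatHist n D)) w = 0
      · rw [dQ_eq_zero (hδ n) (trtProb_nonneg _ _) (trtProb_le_one _ _) hw]; ring
      · rw [← hD n (by omega) w hw, outcomeModel,
          show (hist f n D).1 - (n + 1) = 0 by change len D - (n + 1) = 0; omega, outcomeModelAux]
        ring
    · have hl' : D ∉ {D : Obs d | len D = n + 1} := hl
      rw [Set.indicator_of_notMem hl', hιl, if_neg hl]
      simp
  · refine integral_congr_ae (.of_forall fun D => ?_)
    simp only [histTreat]; ring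
  · refine integral_congr_ae (.of_forall fun D => ?_)
    simp only [histTreat]
    rw [← mul_assoc, ← mul_assoc, hιa, hιl]
    by_cases hl : len D = n + 1
    · rw [if_pos hl, hl, prodWeight_succ_hist, value, if_neg (by omega)]
      ring
    · rw [if_neg hl]; ring

/-- The inverse probability weighted form of the g-formula. -/
theorem IsWeightBound.target_eq {K : ℝ} (hK : IsWeightBound Q f δ K)
    (hf : ∀ s, Measurable (f s)) (hδ : ∀ s, 0 < δ s)
    (hQ : Q ∈ model smax 𝒴 f) {B : ℝ} (hB0 : 0 ≤ B) (hB : ∀ y ∈ 𝒴, |y| ≤ B) :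
    target smax f δ Q = ∫ D, prodWeight (boundedWeight Q f δ K) (len D) (hist f (len D) D)
      * clamp B (outcome D) ∂(Q : Measure (Obs d)) := by
  rw [target, Finset.sum_congr rfl fun n _ => hK.integral_interventionLaw hf hδ hQ hB0 hB n,
    ← integral_finsetSum]
  · refine integral_congr_ae ?_
    filter_upwards [hQ.1] with D hD
    -- The summand `n` concerns records of length `n + 1`; records have at least one segment.
    rw [← Finset.sum_mul, Finset.sum_eq_single (len D - 1), if_pos (by omega), one_mul]
    · intro k _ hk
      rw [if_neg (by omega)]
    · intro hk
      exact absurd (Finset.mem_range.2 (by omega)) hk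
  · intro n _
    have h1 : BoundedMeasurable fun D : Obs d => (if len D = n + 1 then (1 : ℝ) else 0) :=
      .ite (measurableSet_len_eq (n + 1))
    have h2 : BoundedMeasurable fun D : Obs d => clamp B (outcome D) :=
      ⟨(measurable_clamp B).comp measurable_outcome, B, fun D => abs_clamp_le hB0 _⟩
    refine ((h1.mul (((boundedMeasurable_prodWeight (Q := Q) (f := f) (δ := δ) hK.1 (n + 1)).comp
      (measurable_hist hf (n + 1))).mul h2)).integrable (μ := (Q : Measure (Obs d)))).congr
      (.of_forall fun D => ?_)
    by_cases hl : len D = n + 1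
    · simp only [if_pos hl]
      rw [hl]
    · simp only [if_neg hl, zero_mul]

/-- The correction at segment `s` in the expansion of the target. -/
def stepTerm (P : ProbabilityMeasure (Obs d)) (f : ℕ → (Fin d → ℝ) → (Fin e → ℝ)) (δ : ℕ → ℝ)
    (B : ℝ) (u : (s : ℕ) → Hist e s → Bool → ℝ) (s : ℕ) (D : Obs d) : ℝ :=
  act s (hist f s D) * (prodWeight u (s + 1) (hist f (s + 1) D)
    * (value P f δ B (s + 1) D - truncModel P f δ B s (hist f s D) (treat s D)))

/-- Holds for each observation and for arbitrary weights `u`, so the outcome models may come from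
one law and the weights from another. The bracketed difference in each summand has mean zero when
`u` balances the intervention probabilities. -/
theorem telescope (u : (s : ℕ) → Hist e s → Bool → ℝ) (B : ℝ) {D : Obs d} (hD : len D ≤ smax) :
    prodWeight u (len D) (hist f (len D) D) * clamp B (outcome D)
      = value P f δ B 0 D + ∑ s ∈ Finset.range smax, (stepTerm P f δ B u s D
        + (act s (hist f s D) * (u s (hist f s D) (treat s D)
            * (prodWeight u s (hist f s D) * truncModel P f δ B s (hist f s D) (treat s D)))
          - act s (hist f s D) * ∑ w, dQ (δ s) (trtProb P s (treatHist s D)) w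
            * (prodWeight u s (hist f s D) * truncModel P f δ B s (hist f s D) w))) := by
  -- The weight is frozen once the record has ended, where the value is already the outcome; the
  -- later increments are then zero.
  set S : ℕ → ℝ := fun s => prodWeight u (min s (len D)) (hist f (min s (len D)) D)
    * value P f δ B s D with hS
  have h0 : S 0 = value P f δ B 0 D := by simp [hS, prodWeight_hist]
  have hN : S smax = prodWeight u (len D) (hist f (len D) D) * clamp B (outcome D) := by
    simp only [hS]
    rw [min_eq_right hD, value, if_neg (by omega)]
  rw [← h0, ← hN, ← sub_eq_iff_eq_add', ← Finset.sum_range_sub]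
  refine Finset.sum_congr rfl fun s _ => ?_
  simp only [hS, stepTerm, act_hist]
  by_cases hs : s < len D
  · rw [if_pos hs, min_eq_left (by omega), min_eq_left (by omega), prodWeight_succ_hist]
    have hv : value P f δ B s D
        = ∑ w, dQ (δ s) (trtProb P s (treatHist s D)) w * truncModel P f δ B s (hist f s D) w := by
      rw [value, if_pos hs]
    rw [hv]
    simp only [Fintype.sum_bool]
    ring
  · rw [if_neg hs, min_eq_right (by omega), min_eq_right (by omega), value, value,
      if_neg (by omega), if_neg hs]
    ring

theorem boundedMeasurable_stepTerm (hf : ∀ s, Measurable (f s)) (hδ : ∀ s, 0 < δ s) {B : ℝ}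
    (hB0 : 0 ≤ B) {K : ℝ} (hK : 0 ≤ K) (s : ℕ) :
    BoundedMeasurable (stepTerm P f δ B (boundedWeight Q f δ K) s) :=
  ((boundedMeasurable_act s).comp (measurable_hist hf s)).mul
    (((boundedMeasurable_prodWeight hK (s + 1)).comp (measurable_hist hf (s + 1))).mul
    ((boundedMeasurable_value hf hδ hB0 (s + 1)).sub
      ((BoundedMeasurable.uncurry_bool (boundedMeasurable_truncModel hB0 s)).comp
        (measurable_histTreat hf s))))

/-- Telescoping with the weights of `Q` and the outcome models of `P`, integrated under `Q`. Balance
holds under `Q` with the intervention probabilities of `Q`, whereas telescoping used those of `P`: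
their difference is the last term. There is no remainder. -/
theorem IsWeightBound.target_expansion {K : ℝ} (hK : IsWeightBound Q f δ K)
    (hf : ∀ s, Measurable (f s)) (hδ : ∀ s, 0 < δ s)
    (hQ : Q ∈ model smax 𝒴 f) {B : ℝ} (hB0 : 0 ≤ B) (hB : ∀ y ∈ 𝒴, |y| ≤ B)
    (P : ProbabilityMeasure (Obs d)) :
    target smax f δ Q = ∫ D, value P f δ B 0 D ∂(Q : Measure (Obs d))
      + ∑ s ∈ Finset.range smax, (∫ D, stepTerm P f δ B (boundedWeight Q f δ K) s D
          ∂(Q : Measure (Obs d))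
        + ∫ D, act s (hist f s D) * ∑ w, (dQ (δ s) (trtProb Q s (treatHist s D)) w
            - dQ (δ s) (trtProb P s (treatHist s D)) w)
            * (prodWeight (boundedWeight Q f δ K) s (hist f s D)
              * truncModel P f δ B s (hist f s D) w) ∂(Q : Measure (Obs d))) := by
  rw [hK.target_eq hf hδ hQ hB0 hB]
  have hH := fun s => measurable_hist hf s
  have b1 : ∀ s w, BoundedMeasurable fun h =>
      prodWeight (boundedWeight Q f δ K) s h * truncModel P f δ B s h w := fun s w =>
    (boundedMeasurable_prodWeight hK.1 s).mul (boundedMeasurable_truncModel hB0 s w)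
  have b2 : ∀ s, BoundedMeasurable fun D : Obs d =>
      act s (hist f s D) * (boundedWeight Q f δ K s (hist f s D) (treat s D)
        * (prodWeight (boundedWeight Q f δ K) s (hist f s D)
          * truncModel P f δ B s (hist f s D) (treat s D))) := fun s =>
    ((boundedMeasurable_act s).comp (hH s)).mul
      ((BoundedMeasurable.uncurry_bool fun w => (boundedMeasurable_boundedWeight hK.1 s w).mul
        (b1 s w)).comp (measurable_histTreat hf s))
  have b3 : ∀ (P' : ProbabilityMeasure (Obs d)) s, BoundedMeasurable fun D : Obs d =>
      act s (hist f s D) * ∑ w, dQ (δ s) (trtProb P' s (treatHist s D)) w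
        * (prodWeight (boundedWeight Q f δ K) s (hist f s D)
          * truncModel P f δ B s (hist f s D) w) := fun P' s =>
    ((boundedMeasurable_act s).mul (boundedMeasurable_sum_dQ_mul (P := P') (b1 s))).comp (hH s)
  have b4 := fun s => boundedMeasurable_stepTerm (P := P) (Q := Q) hf hδ hB0 hK.1 s
  rw [integral_congr_ae (hQ.1.mono fun D hD => telescope (P := P) _ B hD.2), integral_add
    (boundedMeasurable_value hf hδ hB0 0).integrable
    (BoundedMeasurable.sum _ fun s _ => (b4 s).add ((b2 s).sub (b3 P s))).integrable,
    integral_finsetSum _ fun s _ => ((b4 s).add ((b2 s).sub (b3 P s))).integrable]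
  congr 1
  refine Finset.sum_congr rfl fun s _ => ?_
  obtain ⟨C, hC⟩ := (BoundedMeasurable.uncurry_bool (b1 s)).bounded
  rw [integral_add (b4 s).integrable ((b2 s).sub (b3 P s)).integrable,
    integral_sub (b2 s).integrable (b3 P s).integrable, hK.integral_balance hf s
      (fun w => (b1 s w).measurable) (fun h w => hC (h, w)), ← integral_sub (b3 Q s).integrable
      (b3 P s).integrable]
  congr 1
  refine integral_congr_ae (.of_forall fun D => ?_)
  simp only [Fintype.sum_bool]
  ring

end GPI

theorem isBigO_of_abs_le {F G k : ℝ → ℝ} {l : Filter ℝ} (h : ∀ t, |F t| ≤ G t) (hG : G =O[l] k) :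
    F =O[l] k :=
  (Asymptotics.IsBigO.of_bound 1 (.of_forall fun t => by
    rw [one_mul, Real.norm_eq_abs]; exact (h t).trans (le_abs_self _))).trans hG

/-- `integral_sq_le_hellingerSq` for `D = n t - m` and the residual `Z - m`: this residual is
orthogonal to functions of `X` under `P`, and under `Q t` its conditional mean is `n t - m`. -/
theorem regression_diff_isBigO {Ω β : Type*} [MeasurableSpace Ω] [MeasurableSpace β]
    {P : ProbabilityMeasure Ω} {Q : ℝ → ProbabilityMeasure Ω} {l : Filter ℝ} {r : ℝ → ℝ}
    (hH : (fun t => hellingerSq (P : Measure Ω) (Q t : Measure Ω)) =O[l] r)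
    {X : Ω → β} (hX : Measurable X) {Z : Ω → ℝ} {m : β → ℝ} {n : ℝ → β → ℝ} {B : ℝ}
    (hZ : Measurable Z) (hm : Measurable m) (hn : ∀ t, Measurable (n t)) (hZB : ∀ x, |Z x| ≤ B)
    (hmB : ∀ x, |m x| ≤ B) (hnB : ∀ t x, |n t x| ≤ B)
    (hP : ∀ φ : β → ℝ, BoundedMeasurable φ →
      ∫ x, φ (X x) * Z x ∂(P : Measure Ω) = ∫ x, φ (X x) * m (X x) ∂(P : Measure Ω))
    (hQ : ∀ t, ∀ φ : β → ℝ, BoundedMeasurable φ →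
      ∫ x, φ (X x) * Z x ∂(Q t : Measure Ω) = ∫ x, φ (X x) * n t (X x) ∂(Q t : Measure Ω)) :
    (fun t => ∫ x, (n t (X x) - m (X x)) ^ 2 ∂(Q t : Measure Ω)) =O[l] r := by
  have bZ : BoundedMeasurable Z := ⟨hZ, B, hZB⟩
  have bm : BoundedMeasurable m := ⟨hm, B, hmB⟩
  have bn : ∀ t, BoundedMeasurable (n t) := fun t => ⟨hn t, B, hnB t⟩
  refine isBigO_of_abs_le (G := fun t => 6 * (B + B) ^ 2 * hellingerSq (P : Measure Ω) (Q t))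
    (fun t => ?_) (hH.const_mul_left _)
  rw [abs_of_nonneg (integral_nonneg fun _ => sq_nonneg _)]
  have bφ := (bn t).sub bm
  refine integral_sq_le_hellingerSq (Z := fun x => Z x - m (X x)) (bφ.comp hX).measurable
    (bZ.sub (bm.comp hX)).measurable (fun x => (abs_sub _ _).trans (add_le_add (hnB t _) (hmB _)))
    (fun x => (abs_sub _ _).trans (add_le_add (hZB _) (hmB _))) ?_ ?_
  · have := hP _ bφ
    simp only [mul_sub]
    rw [integral_sub ((bφ.comp hX).mul bZ).integrable
      ((bφ.comp hX).mul (bm.comp hX)).integrable, this, sub_self]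
  · have := hQ t _ bφ
    simp only [mul_sub]
    rw [integral_sub ((bφ.comp hX).mul bZ).integrable
      ((bφ.comp hX).mul (bm.comp hX)).integrable, this, ← integral_sub
      ((bφ.comp hX).mul ((bn t).comp hX)).integrable ((bφ.comp hX).mul (bm.comp hX)).integrable]
    refine integral_congr_ae (.of_forall fun x => ?_)
    simp only
    ring

/-! ### Rates for propensities and treatment probabilities along a path. -/

namespace GPI

variable {d e : ℕ} {f : ℕ → (Fin d → ℝ) → (Fin e → ℝ)} {δ : ℕ → ℝ}
  {smax : ℕ} {𝒴 : Set ℝ} {P : ProbabilityMeasure (Obs d)} {Q : ℝ → ProbabilityMeasure (Obs d)}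
  {g : Obs d → ℝ} {K0 B : ℝ} {K : ℝ → ℝ}

/-- A path in the model, differentiable in quadratic mean, together with bounds for the weights and
for the outcomes. -/
structure IsRegularPath (smax : ℕ) (𝒴 : Set ℝ) (f : ℕ → (Fin d → ℝ) → (Fin e → ℝ)) (δ : ℕ → ℝ)
    (P : ProbabilityMeasure (Obs d)) (Q : ℝ → ProbabilityMeasure (Obs d)) (g : Obs d → ℝ)
    (K0 : ℝ) (K : ℝ → ℝ) (B : ℝ) : Prop where
  measurable_f : ∀ s, Measurable (f s)
  delta_pos : ∀ s, 0 < δ s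
  mem : P ∈ model smax 𝒴 f
  mem_path : ∀ t, Q t ∈ model smax 𝒴 f
  score : HasScore P Q g
  bound : IsWeightBound P f δ K0
  bound_path : ∀ t, IsWeightBound (Q t) f δ (K t)
  B_nonneg : 0 ≤ B
  outcome_le : ∀ y ∈ 𝒴, |y| ≤ B

theorem null_isBigO (hS : HasScore P Q g) {A : Set (Obs d)} (hA : MeasurableSet A)
    (h0 : (P : Measure (Obs d)) A = 0) :
    (fun t => (Q t : Measure (Obs d)).real A) =O[𝓝[>] 0] fun t : ℝ => t ^ 2 :=
  isBigO_of_abs_le (fun t => by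
    rw [abs_of_nonneg measureReal_nonneg]; exact measureReal_le_hellingerSq hA h0)
    (hS.hellingerSq_le.const_mul_left 6)

theorem integral_mul_num_treat (hf : ∀ s, Measurable (f s)) (R : ProbabilityMeasure (Obs d)) (s : ℕ)
    {φ : Hist e s → ℝ} (hφ : BoundedMeasurable φ) :
    ∫ D, φ (hist f s D) * num (treat s D) ∂(R : Measure (Obs d))
      = ∫ D, φ (hist f s D) * propensity R f s (hist f s D) ∂(R : Measure (Obs d)) := by
  have hb : ∀ w, BoundedMeasurable fun h => φ h * num w := fun w => hφ.mul (.const _)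
  obtain ⟨C, hC⟩ := (BoundedMeasurable.uncurry_bool hb).bounded
  rw [integral_histTreat hf s (φ := fun h w => φ h * num w) (fun w => (hb w).measurable)
    (fun h w => hC (h, w))]
  refine integral_congr_ae (.of_forall fun D => ?_)
  simp [num, bern]
  ring

theorem boundedMeasurable_propensity (R : ProbabilityMeasure (Obs d))
    (f : ℕ → (Fin d → ℝ) → (Fin e → ℝ)) (s : ℕ) :
    BoundedMeasurable (propensity R f s : Hist e s → ℝ) :=
  ⟨measurable_propensity s, 1, fun h => by
    rw [abs_of_nonneg (propensity_nonneg _ _)]; exact propensity_le_one _ _⟩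

theorem boundedMeasurable_num_treat (s : ℕ) :
    BoundedMeasurable fun D : Obs d => num (treat s D) :=
  ⟨(Measurable.of_discrete (f := num)).comp (measurable_treat s), 1, fun D => by
    cases treat s D <;> simp [num]⟩

theorem propensity_diff_isBigO (hf : ∀ s, Measurable (f s)) (hS : HasScore P Q g) (s : ℕ) :
    (fun t => ∫ D, (propensity (Q t) f s (hist f s D) - propensity P f s (hist f s D)) ^ 2
      ∂(Q t : Measure (Obs d))) =O[𝓝[>] 0] fun t : ℝ => t ^ 2 :=
  regression_diff_isBigO (B := 1) hS.hellingerSq_le (measurable_hist hf s)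
    (boundedMeasurable_num_treat s).measurable (measurable_propensity s)
    (fun t => measurable_propensity s) (fun D => by cases treat s D <;> simp [num])
    (fun h => by rw [abs_of_nonneg (propensity_nonneg _ _)]; exact propensity_le_one _ _)
    (fun t h => by rw [abs_of_nonneg (propensity_nonneg _ _)]; exact propensity_le_one _ _)
    (fun _ hφ => integral_mul_num_treat hf P s hφ)
    (fun t _ hφ => integral_mul_num_treat hf (Q t) s hφ)

/-! ### Cells -/

/-- The product form also holds on cells of probability zero, where the treatment probability is
only a default value. -/
theorem measureReal_cell_mul_bern (R : ProbabilityMeasure (Obs d)) (s : ℕ) (v : Fin s → Bool)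
    (w : Bool) : (R : Measure (Obs d)).real (cell s v) * bern (trtProb R s v) w
      = (R : Measure (Obs d)).real (cell s v ∩ {D | treat s D = w}) := by
  have hT : MeasurableSet {D : Obs d | treat s D = true} :=
    measurable_treat s (measurableSet_singleton true)
  have h1 : (R : Measure (Obs d)).real (cell s v) * trtProb R s v
      = (R : Measure (Obs d)).real (cell s v ∩ {D | treat s D = true}) := by
    have hc : trtProb R s v = ((R : Measure (Obs d)).real (cell s v))⁻¹
        * (R : Measure (Obs d)).real (cell s v ∩ {D | treat s D = true}) := by
      simp only [trtProb, Measure.real]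
      rw [cond_apply (measurableSet_cell s v), ENNReal.toReal_mul, ENNReal.toReal_inv]
    rw [hc]
    by_cases h0 : (R : Measure (Obs d)).real (cell s v) = 0
    · have : (R : Measure (Obs d)).real (cell s v ∩ {D | treat s D = true}) = 0 :=
        le_antisymm ((measureReal_mono Set.inter_subset_left).trans h0.le) measureReal_nonneg
      rw [this, h0, zero_mul]
    · field_simp
  cases w
  · have h2 := measureReal_inter_add_sdiff (μ := (R : Measure (Obs d))) (s := cell s v) hT
    have h3 : cell s v \ {D : Obs d | treat s D = true} = cell s v ∩ {D | treat s D = false} := by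
      ext D
      simp
    rw [h3] at h2
    simp only [bern, Bool.false_eq_true, if_false]
    linarith
  · simpa [bern] using h1

/-- The indicator of a cell. -/
def cellInd (s : ℕ) (v : Fin s → Bool) (D : Obs d) : ℝ :=
  if s < len D ∧ treatHist s D = v then 1 else 0

theorem boundedMeasurable_cellInd (s : ℕ) (v : Fin s → Bool) :
    BoundedMeasurable (cellInd s v : Obs d → ℝ) := .ite (measurableSet_cell s v)

theorem integral_cellInd (R : ProbabilityMeasure (Obs d)) (s : ℕ) (v : Fin s → Bool) :
    ∫ D, cellInd s v D ∂(R : Measure (Obs d)) = (R : Measure (Obs d)).real (cell s v) := by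
  rw [← integral_indicator_one (measurableSet_cell s v)]
  refine integral_congr_ae (.of_forall fun D => ?_)
  by_cases h : s < len D ∧ treatHist s D = v
  · have h' : D ∈ cell s v := h
    simp [cellInd, h, h']
  · have h' : D ∉ cell s v := h
    simp [cellInd, h, h']

theorem integral_cellInd_mul_num (R : ProbabilityMeasure (Obs d)) (s : ℕ) (v : Fin s → Bool)
    (c : ℝ) : ∫ D, cellInd s v D * (num (treat s D) - c) ∂(R : Measure (Obs d))
      = (R : Measure (Obs d)).real (cell s v) * (trtProb R s v - c) := by
  have hb := boundedMeasurable_cellInd (d := d) s v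
  simp only [mul_sub]
  rw [integral_sub (hb.mul (boundedMeasurable_num_treat s)).integrable
    (hb.mul (.const c)).integrable, integral_mul_const, integral_cellInd]
  have h1 := measureReal_cell_mul_bern R s v true
  simp only [bern, if_true] at h1
  have hm : MeasurableSet (cell s v ∩ {D : Obs d | treat s D = true}) :=
    (measurableSet_cell s v).inter (measurable_treat s (measurableSet_singleton true))
  rw [h1, ← integral_indicator_one hm]
  congr 1
  refine integral_congr_ae (.of_forall fun D => ?_)
  by_cases h : s < len D ∧ treatHist s D = v
  · have h' : D ∈ cell s v := h
    by_cases hw : treat s D = true <;> simp [cellInd, h, h', num, hw, Set.indicator]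
  · have h' : D ∉ cell s v := h
    simp [cellInd, h, h', Set.indicator]

theorem act_mul_eq_sum_cellInd (s : ℕ) (D : Obs d) (F : (Fin s → Bool) → ℝ) :
    act s (hist f s D) * F (treatHist s D) = ∑ v, cellInd s v D * F v := by
  rw [act_hist]
  by_cases hs : s < len D
  · rw [if_pos hs, Finset.sum_eq_single (treatHist s D)]
    · simp [cellInd, hs]
    · intro v _ hv
      rw [cellInd, if_neg (fun h => hv h.2.symm), zero_mul]
    · intro h; exact absurd (Finset.mem_univ _) h
  · rw [if_neg hs, zero_mul]
    exact (Finset.sum_eq_zero fun v _ => by rw [cellInd, if_neg (fun h => hs h.1), zero_mul]).symm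

theorem isBigO_of_tendsto_div {F : ℝ → ℝ} {c : ℝ}
    (h : Tendsto (fun t => F t / t) (𝓝[>] 0) (𝓝 c)) : F =O[𝓝[>] 0] fun t : ℝ => t := by
  have h1 := (h.isBigO_one ℝ).mul (Asymptotics.isBigO_refl (fun t : ℝ => t) (𝓝[>] 0))
  refine (h1.congr' ?_ ?_)
  · filter_upwards [self_mem_nhdsWithin] with t ht
    exact div_mul_cancel₀ _ (ne_of_gt ht)
  · exact .of_forall fun t => one_mul t

theorem HasScore_sub_isBigO (hS : HasScore P Q g) {φ : Obs d → ℝ} (hφ : BoundedMeasurable φ) :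
    (fun t => ∫ D, φ D ∂(Q t : Measure (Obs d)) - ∫ D, φ D ∂(P : Measure (Obs d)))
      =O[𝓝[>] 0] fun t : ℝ => t := by
  obtain ⟨C, hC⟩ := hφ.bounded
  exact isBigO_of_tendsto_div (hS.tendsto_integral hφ.measurable hC)

theorem tendsto_id_nhdsGT : Tendsto (fun t : ℝ => t) (𝓝[>] 0) (𝓝 0) :=
  tendsto_id.mono_left nhdsWithin_le_nhds

theorem HasScore_tendsto (hS : HasScore P Q g) {φ : Obs d → ℝ} (hφ : BoundedMeasurable φ) :
    Tendsto (fun t => ∫ D, φ D ∂(Q t : Measure (Obs d))) (𝓝[>] 0)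
      (𝓝 (∫ D, φ D ∂(P : Measure (Obs d)))) :=
  tendsto_sub_nhds_zero_iff.1 ((HasScore_sub_isBigO hS hφ).trans_tendsto tendsto_id_nhdsGT)

theorem tendsto_measureReal_cell (hS : HasScore P Q g) (s : ℕ) (v : Fin s → Bool) :
    Tendsto (fun t => (Q t : Measure (Obs d)).real (cell s v)) (𝓝[>] 0)
      (𝓝 ((P : Measure (Obs d)).real (cell s v))) := by
  simpa only [integral_cellInd] using HasScore_tendsto hS (boundedMeasurable_cellInd s v)

/-- The cell probability tends to a positive limit and can be divided out. -/
theorem isBigO_of_cell_mul (hS : HasScore P Q g) {s : ℕ} {v : Fin s → Bool}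
    (hv : (P : Measure (Obs d)).real (cell s v) ≠ 0) {F k : ℝ → ℝ}
    (hF : (fun t => (Q t : Measure (Obs d)).real (cell s v) * F t) =O[𝓝[>] 0] k) :
    F =O[𝓝[>] 0] k := by
  have h := tendsto_measureReal_cell hS s v
  have h1 := ((h.inv₀ hv).isBigO_one ℝ).mul hF
  refine h1.congr' ?_ (.of_forall fun t => one_mul _)
  filter_upwards [h.eventually_ne hv] with t ht
  exact inv_mul_cancel_left₀ ht _

/-- The left side is the `Q t`-mean of the cell indicator times the treatment centred at its
`P`-probability, a bounded function of `P`-mean zero. -/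
theorem cell_mul_trtProb_isBigO (hS : HasScore P Q g) (s : ℕ) (v : Fin s → Bool) :
    (fun t => (Q t : Measure (Obs d)).real (cell s v) * (trtProb (Q t) s v - trtProb P s v))
      =O[𝓝[>] 0] fun t : ℝ => t := by
  have h := HasScore_sub_isBigO hS ((boundedMeasurable_cellInd (d := d) s v).mul
    ((boundedMeasurable_num_treat s).sub (.const (trtProb P s v))))
  simpa only [integral_cellInd_mul_num, sub_self, mul_zero, sub_zero] using h

/-- The squared error of the treatment probabilities of `R` on the cells of positive
`P`-probability, plus the treatment probabilities of `R` that vanish under `P`. -/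
def trtError (P R : ProbabilityMeasure (Obs d)) (s : ℕ) : ℝ :=
  ∑ v : Fin s → Bool, if (P : Measure (Obs d)).real (cell s v) = 0 then 0 else
    ((trtProb R s v - trtProb P s v) ^ 2
      + ∑ w, if bern (trtProb P s v) w = 0 then bern (trtProb R s v) w else 0)

theorem bern_trtProb_nonneg (R : ProbabilityMeasure (Obs d)) (s : ℕ) (v : Fin s → Bool)
    (w : Bool) : 0 ≤ bern (trtProb R s v) w :=
  bern_nonneg (trtProb_nonneg _ _) (trtProb_le_one _ _) w

theorem trtError_term_nonneg (P R : ProbabilityMeasure (Obs d)) (s : ℕ) (v : Fin s → Bool)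
    (w : Bool) : 0 ≤ if bern (trtProb P s v) w = 0 then bern (trtProb R s v) w else 0 := by
  split_ifs
  · exact bern_trtProb_nonneg _ _ _ _
  · exact le_rfl

theorem le_trtError {P R : ProbabilityMeasure (Obs d)} {s : ℕ} {v : Fin s → Bool}
    (hv : (P : Measure (Obs d)).real (cell s v) ≠ 0) :
    (trtProb R s v - trtProb P s v) ^ 2
      + ∑ w, (if bern (trtProb P s v) w = 0 then bern (trtProb R s v) w else 0)
      ≤ trtError P R s := by
  have h := Finset.single_le_sum (s := Finset.univ)
    (f := fun v : Fin s → Bool => if (P : Measure (Obs d)).real (cell s v) = 0 then 0 else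
    ((trtProb R s v - trtProb P s v) ^ 2
      + ∑ w, if bern (trtProb P s v) w = 0 then bern (trtProb R s v) w else 0)) (fun v _ => by
      split_ifs
      · exact le_rfl
      · exact add_nonneg (sq_nonneg _) (Finset.sum_nonneg fun _ _ => trtError_term_nonneg _ _ _ _ _))
    (Finset.mem_univ v)
  simp only [if_neg hv] at h
  exact h

theorem sq_le_trtError {P R : ProbabilityMeasure (Obs d)} {s : ℕ} {v : Fin s → Bool}
    (hv : (P : Measure (Obs d)).real (cell s v) ≠ 0) :
    (trtProb R s v - trtProb P s v) ^ 2 ≤ trtError P R s :=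
  (le_add_of_nonneg_right (Finset.sum_nonneg fun _ _ => trtError_term_nonneg _ _ _ _ _)).trans
    (le_trtError hv)

theorem bern_le_trtError {P R : ProbabilityMeasure (Obs d)} {s : ℕ} {v : Fin s → Bool}
    (hv : (P : Measure (Obs d)).real (cell s v) ≠ 0) {w : Bool} (hw : bern (trtProb P s v) w = 0) :
    bern (trtProb R s v) w ≤ trtError P R s := by
  refine le_trans ?_ ((le_add_of_nonneg_left (sq_nonneg _)).trans (le_trtError hv))
  have := Finset.single_le_sum (s := Finset.univ)
    (f := fun w => if bern (trtProb P s v) w = 0 then bern (trtProb R s v) w else 0)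
    (fun w _ => trtError_term_nonneg P R s v w) (Finset.mem_univ w)
  simpa only [if_pos hw] using this

theorem trtError_nonneg (P R : ProbabilityMeasure (Obs d)) (s : ℕ) : 0 ≤ trtError P R s :=
  Finset.sum_nonneg fun v _ => by
    split_ifs
    · exact le_rfl
    · exact add_nonneg (sq_nonneg _) (Finset.sum_nonneg fun _ _ => trtError_term_nonneg _ _ _ _ _)

/-- On a cell charged by `P` the treatment probability moves by `O(t)`. A treatment that `P` never
gives there defines a `P`-null event, whose mass is already `O(t²)`; so its probability enters
without a square. -/
theorem trtError_isBigO (hS : HasScore P Q g) (s : ℕ) :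
    (fun t => trtError P (Q t) s) =O[𝓝[>] 0] fun t : ℝ => t ^ 2 := by
  refine Asymptotics.IsBigO.fun_sum fun v _ => ?_
  by_cases hv : (P : Measure (Obs d)).real (cell s v) = 0
  · simp only [if_pos hv]
    exact Asymptotics.isBigO_zero _ _
  simp only [if_neg hv]
  refine Asymptotics.IsBigO.add ?_ (Asymptotics.IsBigO.fun_sum fun w _ => ?_)
  · exact (isBigO_of_cell_mul hS hv (cell_mul_trtProb_isBigO hS s v)).pow 2
  · by_cases hw : bern (trtProb P s v) w = 0
    · simp only [if_pos hw]
      refine isBigO_of_cell_mul hS hv ?_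
      simp only [measureReal_cell_mul_bern]
      refine null_isBigO hS ((measurableSet_cell s v).inter
        (measurable_treat s (measurableSet_singleton w))) ?_
      have := measureReal_cell_mul_bern P s v w
      rw [hw, mul_zero] at this
      exact (measureReal_eq_zero_iff).1 this.symm
    · simp only [if_neg hw]
      exact Asymptotics.isBigO_zero _ _

end GPI

/-! ### A pointwise bound that uses the overlap of `P` only. -/

namespace GPI

variable {d e : ℕ} {f : ℕ → (Fin d → ℝ) → (Fin e → ℝ)} {δ : ℕ → ℝ}
  {smax : ℕ} {𝒴 : Set ℝ} {P : ProbabilityMeasure (Obs d)} {Q : ℝ → ProbabilityMeasure (Obs d)}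
  {g : Obs d → ℝ} {K0 B : ℝ} {K : ℝ → ℝ}

/-- The histories on which overlap and the defining property of the weights hold for `P`. -/
def regularHist (P : ProbabilityMeasure (Obs d)) (f : ℕ → (Fin d → ℝ) → (Fin e → ℝ)) (δ : ℕ → ℝ)
    (K0 η : ℝ) (s : ℕ) : Set (Hist e s) :=
  {h | (P : Measure (Obs d)).real (cell s h.2.1) ≠ 0 ∧ ∀ w,
    (bern (trtProb P s h.2.1) w ≠ 0 → η ≤ bern (propensity P f s h) w) ∧
    bern (propensity P f s h) w * boundedWeight P f δ K0 s h w = dQ (δ s) (trtProb P s h.2.1) w}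

theorem measurableSet_regularHist (K0 η : ℝ) (s : ℕ) :
    MeasurableSet (regularHist P f δ K0 η s : Set (Hist e s)) := by
  have hv : ∀ p : (Fin s → Bool) → Prop, MeasurableSet {h : Hist e s | p h.2.1} := fun p =>
    (measurable_fst.comp measurable_snd) (Set.toFinite {v | p v}).measurableSet
  have hb : ∀ w, Measurable fun h : Hist e s => bern (propensity P f s h) w := fun w =>
    measurable_bern (measurable_propensity s) w
  have h1 : ∀ w, MeasurableSet {h : Hist e s |
      (bern (trtProb P s h.2.1) w ≠ 0 → η ≤ bern (propensity P f s h) w)} := fun w =>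
    (hv fun v => bern (trtProb P s v) w ≠ 0).imp (measurableSet_le measurable_const (hb w))
  have h2 : ∀ w, MeasurableSet {h : Hist e s | bern (propensity P f s h) w
      * boundedWeight P f δ K0 s h w = dQ (δ s) (trtProb P s h.2.1) w} := fun w =>
    measurableSet_eq_fun ((hb w).mul (measurable_boundedWeight K0 s w)) (measurable_dQ_trtProb s w)
  have e : (regularHist P f δ K0 η s : Set (Hist e s))
      = {h | (P : Measure (Obs d)).real (cell s h.2.1) ≠ 0} ∩ ⋂ w,
        ({h | (bern (trtProb P s h.2.1) w ≠ 0 → η ≤ bern (propensity P f s h) w)}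
        ∩ {h | bern (propensity P f s h) w * boundedWeight P f δ K0 s h w
          = dQ (δ s) (trtProb P s h.2.1) w}) := by
    ext h
    simp only [regularHist, Set.mem_inter_iff, Set.mem_iInter, Set.mem_ofPred_eq]
  rw [e]
  exact (hv fun v => (P : Measure (Obs d)).real (cell s v) ≠ 0).inter
    (MeasurableSet.iInter fun w => (h1 w).inter (h2 w))

theorem ae_cell_ne_zero (P : ProbabilityMeasure (Obs d)) :
    ∀ᵐ D ∂(P : Measure (Obs d)), ∀ s < len D,
      (P : Measure (Obs d)).real (cell s (treatHist s D)) ≠ 0 := by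
  have : ∀ s, ∀ v : Fin s → Bool, ∀ᵐ D ∂(P : Measure (Obs d)),
      D ∈ cell s v → (P : Measure (Obs d)).real (cell s v) ≠ 0 := by
    intro s v
    by_cases h : (P : Measure (Obs d)).real (cell s v) = 0
    · have h0 := (measureReal_eq_zero_iff).1 h
      filter_upwards [measure_eq_zero_iff_ae_notMem.1 h0] with D hD hm
      exact absurd hm hD
    · exact .of_forall fun _ _ => h
  filter_upwards [ae_all_iff.2 fun s => ae_all_iff.2 (this s)] with D hD s hs
  exact hD s _ ⟨hs, rfl⟩

/-- There are finitely many treatment histories, so overlap relative to the positive treatment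
probabilities becomes an absolute lower bound: `η` is the least positive value of `c` times such a
probability. -/
theorem exists_regularHist (hP : P ∈ model smax 𝒴 f) (hK0 : IsWeightBound P f δ K0) (s : ℕ) :
    ∃ η, 0 < η ∧ ∀ᵐ D ∂(P : Measure (Obs d)), s < len D →
      hist f s D ∈ regularHist P f δ K0 η s := by
  obtain ⟨-, -, c, hc, hov⟩ := hP
  set T : Finset ℝ := (Finset.univ.image fun z : (Fin s → Bool) × Bool =>
    c * bern (trtProb P s z.1) z.2).filter (0 < ·)
  obtain ⟨η, hη, hηT⟩ : ∃ η : ℝ, 0 < η ∧ ∀ x ∈ T, η ≤ x := by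
    by_cases hT : T.Nonempty
    · exact ⟨T.min' hT, (Finset.mem_filter.1 (T.min'_mem hT)).2, fun x hx => T.min'_le x hx⟩
    · exact ⟨1, one_pos, fun x hx => absurd ⟨x, hx⟩ hT⟩
  refine ⟨η, hη, ?_⟩
  filter_upwards [hov, ae_cell_ne_zero P, hK0.bern_mul] with D hD hD1 hD2 hs
  refine ⟨hD1 s hs, fun w => ⟨fun hw => ?_, hD2 s hs w⟩⟩
  have h1 := bern_overlap (hD s hs).1 (hD s hs).2 w
  have h2 : 0 < bern (trtProb P s (treatHist s D)) w :=
    (bern_trtProb_nonneg P s _ w).lt_of_ne' hw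
  refine (hηT _ (Finset.mem_filter.2 ⟨?_, mul_pos hc h2⟩)).trans h1
  exact Finset.mem_image.2 ⟨(treatHist s D, w), Finset.mem_univ _, rfl⟩

/-- The discrepancy between the intervention probabilities of `R` and the ones obtained from the
propensity score of `R` and the weights of `P`. -/
def weightError (P R : ProbabilityMeasure (Obs d)) (f : ℕ → (Fin d → ℝ) → (Fin e → ℝ)) (δ : ℕ → ℝ)
    (K0 : ℝ) (s : ℕ) (h : Hist e s) (w : Bool) : ℝ :=
  dQ (δ s) (trtProb R s h.2.1) w - bern (propensity R f s h) w * boundedWeight P f δ K0 s h w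

/-- From `b' ≥ η - k` and `k x² ≤ C k x`, the latter product being split by Young's inequality. It
replaces a lower bound on the propensity `b'` of the perturbed law by one on the propensity `b` of
`P`, at the price of a squared error. -/
theorem sq_bound_of_overlap {x C b b' k η : ℝ} (hx : 0 ≤ x) (hxC : x ≤ C) (hη : 0 < η)
    (hb : η ≤ b) (hk : |b' - b| = k) :
    η / 2 * x ^ 2 ≤ b' * x ^ 2 + C ^ 2 / (2 * η) * k ^ 2 := by
  have hk0 : 0 ≤ k := hk ▸ abs_nonneg _
  have h1 : b ≤ b' + k := by have := neg_abs_le (b' - b); linarith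
  have h2 : η * x ^ 2 ≤ b' * x ^ 2 + k * x ^ 2 := by nlinarith [sq_nonneg x]
  have h3 : k * x ^ 2 ≤ C * k * x := by nlinarith [mul_nonneg hk0 hx]
  have h4 : C * k * x ≤ η / 2 * x ^ 2 + C ^ 2 / (2 * η) * k ^ 2 := by
    have : η / 2 * x ^ 2 + C ^ 2 / (2 * η) * k ^ 2 - C * k * x
        = (η * x - C * k) ^ 2 / (2 * η) := by field_simp; ring
    have h5 : 0 ≤ (η * x - C * k) ^ 2 / (2 * η) := by positivity
    linarith
  linarith

/-- The essential point is that `C` does not depend on `R`, although the weights of `R` need not be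
bounded uniformly in `R`. Each term on the right will have a mean of order `t²`. -/
theorem exists_pointwise_bound (hδ : ∀ s, 0 < δ s) (hK0 : 0 ≤ K0) {η : ℝ} (hη : 0 < η) {C0 : ℝ}
    (hC0 : 0 ≤ C0) (s : ℕ) :
    ∃ C, 0 ≤ C ∧ ∀ (R : ProbabilityMeasure (Obs d)) (h : Hist e s),
      h ∈ regularHist P f δ K0 η s → ∀ w x, 0 ≤ x → x ≤ C0 →
      |weightError P R f δ K0 s h w| * x + dQ (δ s) (trtProb R s h.2.1) w * x ^ 2
        ≤ C * (bern (propensity R f s h) w * x ^ 2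
          + (propensity R f s h - propensity P f s h) ^ 2 + trtError P R s) := by
  set c1 := δ s / (min (δ s) 1 * min (δ s) 1) with hc1
  set c2 := max (δ s) 1 / min (δ s) 1 with hc2
  have hm : 0 < min (δ s) 1 := lt_min (hδ s) one_pos
  have hc1' : 0 ≤ c1 := by have := hδ s; positivity
  have hc2' : 0 ≤ c2 := by have := (hδ s).le; positivity
  set a := 1 + 2 / η with ha
  have ha' : 0 ≤ a := by positivity
  -- The sum of all coefficients met below: the last two come from treatments that `P` never gives,
  -- the others from treatments with overlap.
  set A := a + a * (C0 ^ 2 / (2 * η)) + 2 / η * c1 ^ 2 + 2 / η * K0 ^ 2 + c2 * C0 + c2 * C0 ^ 2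
    with hA
  have p1 : 0 ≤ a * (C0 ^ 2 / (2 * η)) := by positivity
  have p2 : 0 ≤ 2 / η * c1 ^ 2 := by positivity
  have p3 : 0 ≤ 2 / η * K0 ^ 2 := by positivity
  have p4 : 0 ≤ c2 * C0 := by positivity
  have p5 : 0 ≤ c2 * C0 ^ 2 := by positivity
  refine ⟨A, by positivity, fun R h hh w x hx hxC => ?_⟩
  obtain ⟨hcell, hreg⟩ := hh
  obtain ⟨hreg1, hreg2⟩ := hreg w
  set τ := trtError P R s
  have hτ : 0 ≤ τ := trtError_nonneg P R s
  set b := bern (propensity P f s h) w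
  set b' := bern (propensity R f s h) w
  have hb' : 0 ≤ b' := bern_nonneg (propensity_nonneg _ _) (propensity_le_one _ _) w
  set u := boundedWeight P f δ K0 s h w with hu
  set q := dQ (δ s) (trtProb R s h.2.1) w
  have hp0 := trtProb_nonneg (Q := R) s h.2.1
  have hp1 := trtProb_le_one (Q := R) s h.2.1
  have hq0 : 0 ≤ q := dQ_nonneg (hδ s) hp0 hp1 w
  have hq1 : q ≤ 1 := dQ_le_one (hδ s) hp0 hp1 w
  have hP0 := trtProb_nonneg (Q := P) s h.2.1
  have hP1 := trtProb_le_one (Q := P) s h.2.1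
  have hu0 : 0 ≤ u := boundedWeight_nonneg _ _ _ _
  have huK : u ≤ K0 := boundedWeight_le hK0 _ _ _
  set k2 := (propensity R f s h - propensity P f s h) ^ 2 with hk2
  have hk20 : 0 ≤ k2 := sq_nonneg _
  have hbx : 0 ≤ b' * x ^ 2 := by positivity
  -- If `P` never gives `w`, its weight is zero and everything is bounded by the intervention
  -- probability of `R`, hence linearly by `trtError`. Otherwise the error splits into a change of
  -- the intervention probability and a change of the propensity, both entering squared.
  by_cases hw : bern (trtProb P s h.2.1) w = 0
  · have hQ0 : dQ (δ s) (trtProb P s h.2.1) w = 0 := dQ_eq_zero (hδ s) hP0 hP1 hw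
    have hu0' : u = 0 := by
      rw [hu, boundedWeight, weight_eq, hQ0, zero_div, min_eq_left hK0, max_self]
    have hqτ : q ≤ c2 * τ := (dQ_le_bern (hδ s) hp0 hp1 w).trans
      (mul_le_mul_of_nonneg_left (bern_le_trtError hcell hw) hc2')
    have hθ : |weightError P R f δ K0 s h w| = q := by
      change |q - b' * u| = q
      rw [hu0', mul_zero, sub_zero, abs_of_nonneg hq0]
    rw [hθ]
    have e1 : q * x ≤ c2 * C0 * τ := by
      calc q * x ≤ (c2 * τ) * C0 := mul_le_mul hqτ hxC hx (by positivity)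
        _ = c2 * C0 * τ := by ring
    have e2 : q * x ^ 2 ≤ c2 * C0 ^ 2 * τ := by
      calc q * x ^ 2 ≤ (c2 * τ) * C0 ^ 2 :=
            mul_le_mul hqτ (pow_le_pow_left₀ hx hxC 2) (sq_nonneg x) (by positivity)
        _ = c2 * C0 ^ 2 * τ := by ring
    calc q * x + q * x ^ 2 ≤ (c2 * C0 + c2 * C0 ^ 2) * τ := by linarith
      _ ≤ A * τ := by
          refine mul_le_mul_of_nonneg_right ?_ hτ
          linarith
      _ ≤ A * (b' * x ^ 2 + k2 + τ) := by
          refine mul_le_mul_of_nonneg_left ?_ (by positivity)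
          linarith
  · have hηb : η ≤ b := hreg1 hw
    have hkk : |b' - b| ^ 2 = k2 := by
      rw [abs_bern_sub, sq_abs]
    have h1 := sq_bound_of_overlap hx hxC hη hηb (b' := b') rfl
    rw [hkk] at h1
    have hθ : weightError P R f δ K0 s h w
        = (q - dQ (δ s) (trtProb P s h.2.1) w) + (b - b') * u := by
      change q - b' * u = _
      rw [← hreg2]; ring
    have hd := abs_dQ_sub_le (hδ s) hP0 hP1 hp0 hp1 w
    have hd2 : (q - dQ (δ s) (trtProb P s h.2.1) w) ^ 2 ≤ c1 ^ 2 * τ := by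
      rw [← sq_abs]
      refine (pow_le_pow_left₀ (abs_nonneg _) hd 2).trans ?_
      rw [mul_pow, sq_abs]
      exact mul_le_mul_of_nonneg_left (sq_le_trtError hcell) (sq_nonneg _)
    have hbu : ((b - b') * u) ^ 2 ≤ K0 ^ 2 * k2 := by
      rw [mul_pow, ← hkk, sq_abs, mul_comm]
      have : (b - b') ^ 2 = (b' - b) ^ 2 := by ring
      rw [this]
      exact mul_le_mul_of_nonneg_right (pow_le_pow_left₀ hu0 huK 2) (sq_nonneg _)
    have hθ2 : weightError P R f δ K0 s h w ^ 2 ≤ 2 * (c1 ^ 2 * τ) + 2 * (K0 ^ 2 * k2) := by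
      rw [hθ]
      nlinarith [sq_nonneg ((q - dQ (δ s) (trtProb P s h.2.1) w) - (b - b') * u)]
    have h2 : |weightError P R f δ K0 s h w| * x
        ≤ 1 / η * weightError P R f δ K0 s h w ^ 2 + η / 2 * x ^ 2 := by
      have e : 1 / η * weightError P R f δ K0 s h w ^ 2 + η / 2 * x ^ 2
          - |weightError P R f δ K0 s h w| * x
          = (|weightError P R f δ K0 s h w| - η / 2 * x) ^ 2 / η + η / 4 * x ^ 2 := by
        rw [← sq_abs (weightError P R f δ K0 s h w)]
        field_simp
        ring
      have : 0 ≤ (|weightError P R f δ K0 s h w| - η / 2 * x) ^ 2 / η + η / 4 * x ^ 2 := by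
        positivity
      linarith
    have h3 : q * x ^ 2 ≤ 2 / η * (η / 2 * x ^ 2) := by
      have : 2 / η * (η / 2 * x ^ 2) = x ^ 2 := by field_simp
      rw [this]
      exact mul_le_of_le_one_left (sq_nonneg x) hq1
    have h4 : 1 / η * weightError P R f δ K0 s h w ^ 2
        ≤ 2 / η * c1 ^ 2 * τ + 2 / η * K0 ^ 2 * k2 := by
      calc _ ≤ 1 / η * (2 * (c1 ^ 2 * τ) + 2 * (K0 ^ 2 * k2)) :=
            mul_le_mul_of_nonneg_left hθ2 (by positivity)
        _ = _ := by ring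
    have h5 : η / 2 * x ^ 2 + 2 / η * (η / 2 * x ^ 2)
        ≤ a * (b' * x ^ 2) + a * (C0 ^ 2 / (2 * η)) * k2 := by
      calc _ = a * (η / 2 * x ^ 2) := by rw [ha]; ring
        _ ≤ a * (b' * x ^ 2 + C0 ^ 2 / (2 * η) * k2) := mul_le_mul_of_nonneg_left h1 ha'
        _ = _ := by ring
    have i1 : a * (b' * x ^ 2) ≤ A * (b' * x ^ 2) :=
      mul_le_mul_of_nonneg_right (by linarith) hbx
    have i2 : (a * (C0 ^ 2 / (2 * η)) + 2 / η * K0 ^ 2) * k2 ≤ A * k2 :=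
      mul_le_mul_of_nonneg_right (by linarith) hk20
    have i3 : 2 / η * c1 ^ 2 * τ ≤ A * τ := mul_le_mul_of_nonneg_right (by linarith) hτ
    have i4 : (a * (C0 ^ 2 / (2 * η)) + 2 / η * K0 ^ 2) * k2
        = a * (C0 ^ 2 / (2 * η)) * k2 + 2 / η * K0 ^ 2 * k2 := by ring
    calc _ ≤ A * (b' * x ^ 2) + A * k2 + A * τ := by linarith
      _ = _ := by ring

end GPI

/-! ### Comparison of the cumulative weights along a path. -/

namespace GPI

variable {d e : ℕ} {f : ℕ → (Fin d → ℝ) → (Fin e → ℝ)} {δ : ℕ → ℝ}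
  {smax : ℕ} {𝒴 : Set ℝ} {P : ProbabilityMeasure (Obs d)} {Q : ℝ → ProbabilityMeasure (Obs d)}
  {g : Obs d → ℝ} {K0 B : ℝ} {K : ℝ → ℝ}

theorem boundedMeasurable_bern_propensity (R : ProbabilityMeasure (Obs d))
    (f : ℕ → (Fin d → ℝ) → (Fin e → ℝ)) (s : ℕ) (w : Bool) :
    BoundedMeasurable fun h : Hist e s => bern (propensity R f s h) w :=
  ⟨measurable_bern (measurable_propensity s) w, 1, fun h => by
    rw [abs_of_nonneg (bern_nonneg (propensity_nonneg _ _) (propensity_le_one _ _) w)]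
    exact bern_le_one (propensity_nonneg _ _) (propensity_le_one _ _) w⟩

theorem boundedMeasurable_dQ_trtProb (R : ProbabilityMeasure (Obs d)) (δ : ℕ → ℝ) (s : ℕ)
    (w : Bool) : BoundedMeasurable fun h : Hist e s => dQ (δ s) (trtProb R s h.2.1) w :=
  boundedMeasurable_of_treatHist fun v => dQ (δ s) (trtProb R s v) w

theorem boundedMeasurable_weightError (R : ProbabilityMeasure (Obs d)) (hK0 : 0 ≤ K0) (s : ℕ)
    (w : Bool) : BoundedMeasurable fun h : Hist e s => weightError P R f δ K0 s h w :=
  (boundedMeasurable_dQ_trtProb R δ s w).sub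
    ((boundedMeasurable_bern_propensity R f s w).mul (boundedMeasurable_boundedWeight hK0 s w))

theorem abs_weightError_le (hδ : ∀ s, 0 < δ s) (hK0 : 0 ≤ K0) (R : ProbabilityMeasure (Obs d))
    (s : ℕ) (h : Hist e s) (w : Bool) : |weightError P R f δ K0 s h w| ≤ 1 + K0 := by
  refine (abs_sub _ _).trans (add_le_add ?_ ?_)
  · rw [abs_of_nonneg (dQ_nonneg (hδ s) (trtProb_nonneg _ _) (trtProb_le_one _ _) w)]
    exact dQ_le_one (hδ s) (trtProb_nonneg _ _) (trtProb_le_one _ _) w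
  · have h0 := bern_nonneg (propensity_nonneg (Q := R) (f := f) s h) (propensity_le_one _ _) w
    rw [abs_of_nonneg (mul_nonneg h0 (boundedWeight_nonneg _ _ _ _))]
    exact (mul_le_mul (bern_le_one (propensity_nonneg _ _) (propensity_le_one _ _) w)
      (boundedWeight_le hK0 _ _ _) (boundedWeight_nonneg _ _ _ _) zero_le_one).trans_eq
      (one_mul K0)

theorem integral_mono_bounded {μ : Measure (Obs d)} [IsFiniteMeasure μ] {φ ψ : Obs d → ℝ}
    (hφ : BoundedMeasurable φ) (hψ : BoundedMeasurable ψ) (h : ∀ D, φ D ≤ ψ D) :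
    ∫ D, φ D ∂μ ≤ ∫ D, ψ D ∂μ :=
  integral_mono hφ.integrable hψ.integrable h

/-- The hypothesis concerns `x` at the observed treatment, the conclusion the average of its square
over the intervention; the overlap of `P` makes this transfer uniform in `t`. Histories without that
overlap are `P`-null, so have mass `O(t²)`. -/
theorem IsRegularPath.weightError_isBigO (H : IsRegularPath smax 𝒴 f δ P Q g K0 K B) (s : ℕ)
    {x : ℝ → Hist e s → Bool → ℝ} {C0 : ℝ} (hxm : ∀ t w, Measurable fun h => x t h w)
    (hx0 : ∀ t h w, 0 ≤ x t h w) (hxC : ∀ t h w, x t h w ≤ C0)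
    (hx : (fun t => ∫ D, act s (hist f s D) * x t (hist f s D) (treat s D) ^ 2
      ∂(Q t : Measure (Obs d))) =O[𝓝[>] 0] fun t : ℝ => t ^ 2) :
    (fun t => ∫ D, act s (hist f s D) * ∑ w, (|weightError P (Q t) f δ K0 s (hist f s D) w|
        * x t (hist f s D) w
      + dQ (δ s) (trtProb (Q t) s (treatHist s D)) w * x t (hist f s D) w ^ 2)
      ∂(Q t : Measure (Obs d))) =O[𝓝[>] 0] fun t : ℝ => t ^ 2 := by
  obtain ⟨η, hη, hreg⟩ := exists_regularHist H.mem H.bound s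
  have hH := measurable_hist (d := d) H.measurable_f s
  have hC0 : 0 ≤ max C0 0 := le_max_right _ _
  obtain ⟨C, hC, hb⟩ := exists_pointwise_bound (P := P) (f := f) H.delta_pos H.bound.1 hη hC0 s
  have hxC' : ∀ t h w, x t h w ≤ max C0 0 := fun t h w => (hxC t h w).trans (le_max_left _ _)
  set A : Set (Obs d) := {D | s < len D ∧ hist f s D ∉ regularHist P f δ K0 η s} with hA
  have hAm : MeasurableSet A :=
    (measurableSet_lt measurable_const measurable_len).inter
      (hH (measurableSet_regularHist K0 η s)).compl
  have hA0 : (P : Measure (Obs d)) A = 0 := by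
    rw [measure_eq_zero_iff_ae_notMem]
    filter_upwards [hreg] with D hD hDA
    exact hDA.2 (hD hDA.1)
  -- A crude bound of the integrand off the regular histories; the factor two counts the treatments.
  set C1 := 2 * ((1 + K0) * max C0 0 + max C0 0 ^ 2) with hC1
  have hK0 := H.bound.1
  have bx : ∀ t w, BoundedMeasurable fun h => x t h w := fun t w =>
    ⟨hxm t w, C0, fun h => by rw [abs_of_nonneg (hx0 t h w)]; exact hxC t h w⟩
  have bL : ∀ t, BoundedMeasurable fun D : Obs d => act s (hist f s D) *
      ∑ w, (|weightError P (Q t) f δ K0 s (hist f s D) w| * x t (hist f s D) w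
      + dQ (δ s) (trtProb (Q t) s (treatHist s D)) w * x t (hist f s D) w ^ 2) := fun t =>
    ((boundedMeasurable_act s).mul (.sum _ fun w _ =>
      ((boundedMeasurable_weightError (P := P) (f := f) (δ := δ) (Q t) hK0 s w).abs.mul
        (bx t w)).add ((boundedMeasurable_dQ_trtProb (Q t) δ s w).mul (bx t w).pow_two))).comp hH
  have b1 : ∀ t, BoundedMeasurable fun D : Obs d => act s (hist f s D) *
      ∑ w, bern (propensity (Q t) f s (hist f s D)) w * x t (hist f s D) w ^ 2 := fun t =>
    ((boundedMeasurable_act s).mul (.sum _ fun w _ =>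
      (boundedMeasurable_bern_propensity (Q t) f s w).mul (bx t w).pow_two)).comp hH
  have b2 : ∀ t, BoundedMeasurable fun D : Obs d =>
      (propensity (Q t) f s (hist f s D) - propensity P f s (hist f s D)) ^ 2 := fun t =>
    (((boundedMeasurable_propensity (Q t) f s).sub
      (boundedMeasurable_propensity P f s)).pow_two).comp hH
  have b3 : BoundedMeasurable (A.indicator fun _ => (1 : ℝ)) := .indicator hAm
  have hint : ∀ t, ∫ D, act s (hist f s D) *
      ∑ w, bern (propensity (Q t) f s (hist f s D)) w * x t (hist f s D) w ^ 2
        ∂(Q t : Measure (Obs d))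
      = ∫ D, act s (hist f s D) * x t (hist f s D) (treat s D) ^ 2 ∂(Q t : Measure (Obs d)) := by
    intro t
    have bφ : ∀ w, BoundedMeasurable fun h => act s h * x t h w ^ 2 := fun w =>
      (boundedMeasurable_act s).mul (bx t w).pow_two
    obtain ⟨C', hC'⟩ := (BoundedMeasurable.uncurry_bool bφ).bounded
    rw [integral_histTreat H.measurable_f s (φ := fun h w => act s h * x t h w ^ 2)
      (fun w => (bφ w).measurable) (fun h w => hC' (h, w))]
    refine integral_congr_ae (.of_forall fun D => ?_)
    simp only [Fintype.sum_bool]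
    ring
  refine isBigO_of_abs_le (G := fun t =>
    C * (∫ D, act s (hist f s D) * x t (hist f s D) (treat s D) ^ 2 ∂(Q t : Measure (Obs d)))
    + 2 * C * (∫ D, (propensity (Q t) f s (hist f s D) - propensity P f s (hist f s D)) ^ 2
      ∂(Q t : Measure (Obs d))) + 2 * C * trtError P (Q t) s + C1 * (Q t : Measure (Obs d)).real A)
    (fun t => ?_) ((((hx.const_mul_left _).add
      ((propensity_diff_isBigO H.measurable_f H.score s).const_mul_left _)).add
      ((trtError_isBigO H.score s).const_mul_left _)).add
      ((null_isBigO H.score hAm hA0).const_mul_left _))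
  have hterm : ∀ D : Obs d, ∀ w, 0 ≤ |weightError P (Q t) f δ K0 s (hist f s D) w|
      * x t (hist f s D) w
      + dQ (δ s) (trtProb (Q t) s (treatHist s D)) w * x t (hist f s D) w ^ 2 := fun D w =>
    add_nonneg (mul_nonneg (abs_nonneg _) (hx0 _ _ _)) (mul_nonneg
      (dQ_nonneg (H.delta_pos s) (trtProb_nonneg _ _) (trtProb_le_one _ _) w) (sq_nonneg _))
  rw [abs_of_nonneg (integral_nonneg fun D => mul_nonneg (act_nonneg _ _)
    (Finset.sum_nonneg fun w _ => hterm D w))]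
  rw [← hint t, ← integral_const_mul, ← integral_const_mul,
    ← integral_add ((BoundedMeasurable.const C).mul (b1 t)).integrable
      ((BoundedMeasurable.const (2 * C)).mul (b2 t)).integrable]
  have e1 : 2 * C * trtError P (Q t) s
      = ∫ _D, 2 * C * trtError P (Q t) s ∂(Q t : Measure (Obs d)) := by simp
  have e2 : C1 * (Q t : Measure (Obs d)).real A
      = ∫ D, C1 * A.indicator (fun _ => (1 : ℝ)) D ∂(Q t : Measure (Obs d)) := by
    rw [integral_const_mul, integral_indicator_const _ hAm, smul_eq_mul, mul_one]
  have bG := (((BoundedMeasurable.const C).mul (b1 t)).add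
    ((BoundedMeasurable.const (2 * C)).mul (b2 t)))
  have bτ := BoundedMeasurable.const (Ω := Obs d) (2 * C * trtError P (Q t) s)
  have bA := (BoundedMeasurable.const C1).mul b3
  rw [e1, e2, ← integral_add bG.integrable bτ.integrable,
    ← integral_add (bG.add bτ).integrable bA.integrable]
  refine integral_mono_bounded (bL t) ((bG.add bτ).add bA) fun D => ?_
  have hτ := trtError_nonneg P (Q t) s
  have hk := sq_nonneg (propensity (Q t) f s (hist f s D) - propensity P f s (hist f s D))
  have hbx : ∀ w, 0 ≤ bern (propensity (Q t) f s (hist f s D)) w * x t (hist f s D) w ^ 2 :=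
    fun w => mul_nonneg (bern_nonneg (propensity_nonneg _ _) (propensity_le_one _ _) w)
      (sq_nonneg _)
  have hC1' : 0 ≤ C1 := by positivity
  have hind : 0 ≤ A.indicator (fun _ => (1 : ℝ)) D :=
    Set.indicator_nonneg (fun _ _ => zero_le_one) _
  have hRHS : 0 ≤ C * (act s (hist f s D) *
      ∑ w, bern (propensity (Q t) f s (hist f s D)) w * x t (hist f s D) w ^ 2)
      + 2 * C * (propensity (Q t) f s (hist f s D) - propensity P f s (hist f s D)) ^ 2
      + 2 * C * trtError P (Q t) s := by
    have := mul_nonneg (act_nonneg s (hist f s D)) (Finset.sum_nonneg fun w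
      (_ : w ∈ Finset.univ) => hbx w)
    positivity
  by_cases hs : s < len D
  · rw [act_hist, if_pos hs] at hRHS ⊢
    by_cases hD : hist f s D ∈ regularHist P f δ K0 η s
    · have h1 := hb (Q t) _ hD true (x t (hist f s D) true) (hx0 t (hist f s D) true) (hxC' t (hist f s D) true)
      have h2 := hb (Q t) _ hD false (x t (hist f s D) false) (hx0 t (hist f s D) false) (hxC' t (hist f s D) false)
      have h3 : 0 ≤ C1 * A.indicator (fun _ => (1 : ℝ)) D := mul_nonneg hC1' hind
      simp only [Fintype.sum_bool]
      change _ + dQ (δ s) (trtProb (Q t) s (treatHist s D)) true * _ ≤ _ at h1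
      change _ + dQ (δ s) (trtProb (Q t) s (treatHist s D)) false * _ ≤ _ at h2
      linarith
    · have hDA : D ∈ A := ⟨hs, hD⟩
      rw [Set.indicator_of_mem hDA, mul_one, one_mul]
      refine le_trans ?_ (le_add_of_nonneg_left hRHS)
      have h1 : ∀ w, |weightError P (Q t) f δ K0 s (hist f s D) w| * x t (hist f s D) w
          + dQ (δ s) (trtProb (Q t) s (treatHist s D)) w * x t (hist f s D) w ^ 2
          ≤ (1 + K0) * max C0 0 + max C0 0 ^ 2 := fun w => by
        refine add_le_add (mul_le_mul (abs_weightError_le H.delta_pos hK0 _ _ _ _) (hxC' _ _ _)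
          (hx0 _ _ _) (by positivity)) ?_
        refine (mul_le_of_le_one_left (sq_nonneg _)
          (dQ_le_one (H.delta_pos s) (trtProb_nonneg _ _) (trtProb_le_one _ _) w)).trans ?_
        exact pow_le_pow_left₀ (hx0 _ _ _) (hxC' _ _ _) 2
      rw [Fintype.sum_bool, hC1, two_mul]
      exact add_le_add (h1 true) (h1 false)
  · simp only [act_hist, if_neg hs, zero_mul] at hRHS ⊢
    exact add_nonneg hRHS (mul_nonneg hC1' hind)

/-- The difference of the cumulative weights under `Q t` and under `P`. -/
def weightDiff (P : ProbabilityMeasure (Obs d)) (Q : ℝ → ProbabilityMeasure (Obs d))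
    (f : ℕ → (Fin d → ℝ) → (Fin e → ℝ)) (δ : ℕ → ℝ) (K0 : ℝ) (K : ℝ → ℝ) (t : ℝ) (s : ℕ)
    (h : Hist e s) : ℝ :=
  prodWeight (boundedWeight (Q t) f δ (K t)) s h - prodWeight (boundedWeight P f δ K0) s h

/-- Conditional means contract `L²`: test the normal equations with `n` itself. -/
theorem integral_sq_regression_le {β : Type*} [MeasurableSpace β] {μ : Measure (Obs d)}
    [IsProbabilityMeasure μ] {X : Obs d → β} (hX : Measurable X) {Z : Obs d → ℝ} {n : β → ℝ}
    (hZ : BoundedMeasurable Z) (hn : BoundedMeasurable n)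
    (h : ∀ φ : β → ℝ, Measurable φ → ∀ C, (∀ b, |φ b| ≤ C) →
      ∫ x, φ (X x) * Z x ∂μ = ∫ x, φ (X x) * n (X x) ∂μ) :
    ∫ x, n (X x) ^ 2 ∂μ ≤ ∫ x, Z x ^ 2 ∂μ := by
  obtain ⟨C, hC⟩ := hn.bounded
  have h1 := h n hn.measurable C hC
  have bn := hn.comp hX
  have h2 : ∫ x, n (X x) * Z x ∂μ ≤ ∫ x, (1 / 2 * n (X x) ^ 2 + 1 / 2 * Z x ^ 2) ∂μ :=
    integral_mono_bounded (bn.mul hZ) (((BoundedMeasurable.const _).mul bn.pow_two).add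
      ((BoundedMeasurable.const _).mul hZ.pow_two)) fun x => by
        nlinarith [sq_nonneg (n (X x) - Z x)]
  rw [integral_add ((BoundedMeasurable.const (1 / 2)).mul bn.pow_two).integrable
    ((BoundedMeasurable.const (1 / 2)).mul hZ.pow_two).integrable, integral_const_mul,
    integral_const_mul, h1] at h2
  simp only [← sq] at h2
  linarith

/-- Replaces Cauchy–Schwarz, which would need an `L²` rate for the weights of `Q t`. With `Ω` the
cumulative and `u` the single weights, `Ω_t u_t - Ω u = u_t (Ω_t - Ω) + Ω (u_t - u)`. In the first
term balance turns `u_t` into the intervention average, and the induction hypothesis applies to the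
averaged `x`. In the second, propensity times `u_t - u` is `weightError`, and `Ω` is bounded by a
power of `K0`. The induction is therefore over all `x` with mean square of order `t²`. -/
theorem IsRegularPath.weightDiff_isBigO (H : IsRegularPath smax 𝒴 f δ P Q g K0 K B) (s : ℕ)
    {x : ℝ → Obs d → ℝ} {C0 : ℝ} (hxm : ∀ t, Measurable (x t)) (hxC : ∀ t D, |x t D| ≤ C0)
    (hx : (fun t => ∫ D, x t D ^ 2 ∂(Q t : Measure (Obs d))) =O[𝓝[>] 0] fun t : ℝ => t ^ 2) :
    (fun t => ∫ D, (if s ≤ len D then 1 else 0) * (|weightDiff P Q f δ K0 K t s (hist f s D)|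
      * |x t D|) ∂(Q t : Measure (Obs d))) =O[𝓝[>] 0] fun t : ℝ => t ^ 2 := by
  induction s generalizing x C0 with
  | zero => simp [weightDiff, prodWeight, Asymptotics.isBigO_zero]
  | succ s ih =>
    have hf := H.measurable_f
    have hK0 := H.bound.1
    have hH := measurable_hist (d := d) hf s
    have hX := measurable_histTreat (d := d) hf s
    have hC0 : 0 ≤ C0 := by
      obtain ⟨D⟩ : Nonempty (Obs d) := nonempty_of_isProbabilityMeasure (P : Measure (Obs d))
      exact (abs_nonneg _).trans (hxC 0 D)
    have bx : ∀ t, BoundedMeasurable (x t) := fun t => ⟨hxm t, C0, hxC t⟩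
    -- The weights depend on `(H_s, W_s)` only, so `|x|` may be replaced by its conditional mean
    -- under `Q t`.
    have hreg := fun t => exists_regression (μ := (Q t : Measure (Obs d))) hX (hxm t).abs hC0
      (fun D => by rw [abs_abs]; exact hxC t D)
    choose n hnm hnC hn using hreg
    have bn : ∀ t, BoundedMeasurable (n t) := fun t => ⟨hnm t, C0, hnC t⟩
    set y : ℝ → Hist e s → Bool → ℝ := fun t h w => |n t (h, w)| with hy
    have bnw : ∀ t w, BoundedMeasurable fun h => y t h w := fun t w =>
      ((bn t).comp (X := fun h : Hist e s => (h, w)) (measurable_id.prodMk measurable_const)).abs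
    have hn2 : (fun t => ∫ D, act s (hist f s D) * y t (hist f s D) (treat s D) ^ 2
        ∂(Q t : Measure (Obs d))) =O[𝓝[>] 0] fun t : ℝ => t ^ 2 := by
      refine isBigO_of_abs_le (fun t => ?_) hx
      rw [abs_of_nonneg (integral_nonneg fun D => mul_nonneg (act_nonneg _ _) (sq_nonneg _))]
      refine le_trans ?_ ((integral_sq_regression_le hX (bx t).abs (bn t) (hn t)).trans_eq
        (by simp only [sq_abs]))
      refine integral_mono_bounded ((((boundedMeasurable_act s).comp measurable_fst).mul
        (BoundedMeasurable.uncurry_bool (bnw t)).pow_two).comp hX) ((bn t).pow_two.comp hX)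
        fun D => ?_
      simp only [hy, sq_abs]
      exact mul_le_of_le_one_left (sq_nonneg _) (act_le_one _ _)
    have hE := H.weightError_isBigO s (x := y) (C0 := C0) (fun t w => (bnw t w).measurable)
      (fun t h w => abs_nonneg _) (fun t h w => hnC t _) hn2
    -- The function to which the induction hypothesis is applied: the regression of `|x|`, averaged
    -- over the intervention at segment `s`.
    set z : ℝ → Obs d → ℝ := fun t D => act s (hist f s D) *
      ∑ w, dQ (δ s) (trtProb (Q t) s (treatHist s D)) w * y t (hist f s D) w with hz
    have bz : ∀ t, BoundedMeasurable (z t) := fun t =>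
      ((boundedMeasurable_act s).mul (boundedMeasurable_sum_dQ_mul (bnw t))).comp hH
    have hzC : ∀ t D, |z t D| ≤ C0 := fun t D => by
      rw [hz, abs_mul, ← one_mul C0]
      exact mul_le_mul (abs_act_le _ _) (abs_sum_dQ_mul_le (H.delta_pos s) (trtProb_nonneg _ _)
        (trtProb_le_one _ _) fun w => by rw [hy, abs_abs]; exact hnC t _) (abs_nonneg _)
        zero_le_one
    have bE : ∀ t, BoundedMeasurable fun D : Obs d => act s (hist f s D) *
        ∑ w, (|weightError P (Q t) f δ K0 s (hist f s D) w| * y t (hist f s D) w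
        + dQ (δ s) (trtProb (Q t) s (treatHist s D)) w * y t (hist f s D) w ^ 2) := fun t =>
      ((boundedMeasurable_act s).mul (.sum _ fun w _ =>
        ((boundedMeasurable_weightError (P := P) (f := f) (δ := δ) (Q t) hK0 s w).abs.mul
          (bnw t w)).add ((boundedMeasurable_dQ_trtProb (Q t) δ s w).mul
            (bnw t w).pow_two))).comp hH
    have hdQ : ∀ t (D : Obs d) w, 0 ≤ dQ (δ s) (trtProb (Q t) s (treatHist s D)) w := fun t D w =>
      dQ_nonneg (H.delta_pos s) (trtProb_nonneg _ _) (trtProb_le_one _ _) w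
    have hz2 : (fun t => ∫ D, z t D ^ 2 ∂(Q t : Measure (Obs d))) =O[𝓝[>] 0]
        fun t : ℝ => t ^ 2 := by
      refine isBigO_of_abs_le (fun t => ?_) hE
      rw [abs_of_nonneg (integral_nonneg fun D => sq_nonneg _)]
      refine integral_mono_bounded (bz t).pow_two (bE t) fun D => ?_
      have hy0 : ∀ w, 0 ≤ |weightError P (Q t) f δ K0 s (hist f s D) w| * y t (hist f s D) w :=
        fun w => mul_nonneg (abs_nonneg _) (abs_nonneg _)
      -- Jensen's inequality for the two-point law `dQ`.
      have hsq : (∑ w, dQ (δ s) (trtProb (Q t) s (treatHist s D)) w * y t (hist f s D) w) ^ 2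
          ≤ ∑ w, dQ (δ s) (trtProb (Q t) s (treatHist s D)) w * y t (hist f s D) w ^ 2 := by
        have h1 := sum_dQ (H.delta_pos s) (trtProb_nonneg (Q := Q t) s (treatHist s D))
          (trtProb_le_one _ _)
        have ht := hdQ t D true
        have hf' := hdQ t D false
        simp only [Fintype.sum_bool] at h1 ⊢
        generalize dQ (δ s) (trtProb (Q t) s (treatHist s D)) true = a at *
        generalize dQ (δ s) (trtProb (Q t) s (treatHist s D)) false = b at *
        obtain rfl : b = 1 - a := by linarith
        nlinarith [mul_nonneg (mul_nonneg ht hf')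
          (sq_nonneg (y t (hist f s D) true - y t (hist f s D) false))]
      have hle : ∑ w, dQ (δ s) (trtProb (Q t) s (treatHist s D)) w * y t (hist f s D) w ^ 2
          ≤ ∑ w, (|weightError P (Q t) f δ K0 s (hist f s D) w| * y t (hist f s D) w
            + dQ (δ s) (trtProb (Q t) s (treatHist s D)) w * y t (hist f s D) w ^ 2) :=
        Finset.sum_le_sum fun w _ => le_add_of_nonneg_left (hy0 w)
      simp only [hz, mul_pow]
      have ha : act s (hist f s D) ^ 2 = act s (hist f s D) := by
        rw [act_hist]; split_ifs <;> simp
      rw [ha]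
      exact mul_le_mul_of_nonneg_left (hsq.trans hle) (act_nonneg _ _)
    refine isBigO_of_abs_le (G := fun t =>
      (∫ D, (if s ≤ len D then 1 else 0) * (|weightDiff P Q f δ K0 K t s (hist f s D)|
        * |z t D|) ∂(Q t : Measure (Obs d)))
      + K0 ^ s * ∫ D, act s (hist f s D) *
        ∑ w, (|weightError P (Q t) f δ K0 s (hist f s D) w| * y t (hist f s D) w
        + dQ (δ s) (trtProb (Q t) s (treatHist s D)) w * y t (hist f s D) w ^ 2)
          ∂(Q t : Measure (Obs d))) (fun t => ?_)
      ((ih (fun t => (bz t).measurable) hzC hz2).add (hE.const_mul_left _))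
    have hKt := (H.bound_path t).1
    have bΩt := fun s => boundedMeasurable_prodWeight (Q := Q t) (f := f) (δ := δ) hKt s
    have bΩ := fun s => boundedMeasurable_prodWeight (Q := P) (f := f) (δ := δ) hK0 s
    have but := fun w => boundedMeasurable_boundedWeight (Q := Q t) (f := f) (δ := δ) hKt s w
    have bu := fun w => boundedMeasurable_boundedWeight (Q := P) (f := f) (δ := δ) hK0 s w
    have bW : BoundedMeasurable (weightDiff P Q f δ K0 K t s) := (bΩt s).sub (bΩ s)
    set ω : Hist e s → Bool → ℝ := fun h w =>
      prodWeight (boundedWeight (Q t) f δ (K t)) s h * boundedWeight (Q t) f δ (K t) s h w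
      - prodWeight (boundedWeight P f δ K0) s h * boundedWeight P f δ K0 s h w with hω
    have bω : ∀ w, BoundedMeasurable fun h => act s h * |ω h w| := fun w =>
      (boundedMeasurable_act s).mul (((bΩt s).mul (but w)).sub ((bΩ s).mul (bu w))).abs
    have bω' := BoundedMeasurable.uncurry_bool bω
    obtain ⟨C', hC'⟩ := bω'.bounded
    have e1 : ∫ D, (if s + 1 ≤ len D then 1 else 0) *
        (|weightDiff P Q f δ K0 K t (s + 1) (hist f (s + 1) D)| * |x t D|)
          ∂(Q t : Measure (Obs d))
        = ∫ D, (act s (hist f s D) * |ω (hist f s D) (treat s D)|) * n t (histTreat f s D)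
          ∂(Q t : Measure (Obs d)) := by
      refine Eq.trans ?_ (hn t (fun z => act s z.1 * |ω z.1 z.2|) bω'.measurable C' hC')
      refine integral_congr_ae (.of_forall fun D => ?_)
      simp only [weightDiff, prodWeight_succ_hist, act_hist, Nat.succ_le_iff, histTreat, hω, mul_assoc]
    have b1 : ∀ w, BoundedMeasurable fun h =>
        boundedWeight (Q t) f δ (K t) s h w * (|weightDiff P Q f δ K0 K t s h| * y t h w) :=
      fun w => (but w).mul (bW.abs.mul (bnw t w))
    have b1' : ∀ w, BoundedMeasurable fun h => |weightDiff P Q f δ K0 K t s h| * y t h w :=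
      fun w => bW.abs.mul (bnw t w)
    have b2 : ∀ w, BoundedMeasurable fun h => act s h * (|boundedWeight (Q t) f δ (K t) s h w
        - boundedWeight P f δ K0 s h w| * y t h w) := fun w =>
      (boundedMeasurable_act s).mul (((but w).sub (bu w)).abs.mul (bnw t w))
    obtain ⟨C1, hC1⟩ := (BoundedMeasurable.uncurry_bool b1').bounded
    obtain ⟨C2, hC2⟩ := (BoundedMeasurable.uncurry_bool b2).bounded
    have e2 := (H.bound_path t).integral_balance hf s (φ := fun h w =>
      |weightDiff P Q f δ K0 K t s h| * y t h w) (fun w => (b1' w).measurable)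
      (fun h w => hC1 (h, w))
    have e3 := integral_histTreat (Q := Q t) hf s (φ := fun h w =>
      act s h * (|boundedWeight (Q t) f δ (K t) s h w - boundedWeight P f δ K0 s h w| * y t h w))
      (fun w => (b2 w).measurable) (fun h w => hC2 (h, w))
    have bb1 := (((boundedMeasurable_act (e := e) s).comp measurable_fst).mul
      (BoundedMeasurable.uncurry_bool b1)).comp hX
    have bb2 := (BoundedMeasurable.uncurry_bool b2).comp hX
    have hpos : 0 ≤ ∫ D, (if s + 1 ≤ len D then 1 else 0) *
        (|weightDiff P Q f δ K0 K t (s + 1) (hist f (s + 1) D)| * |x t D|)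
          ∂(Q t : Measure (Obs d)) :=
      integral_nonneg fun D => mul_nonneg (by split_ifs <;> simp)
        (mul_nonneg (abs_nonneg _) (abs_nonneg _))
    rw [abs_of_nonneg hpos, e1]
    calc ∫ D, (act s (hist f s D) * |ω (hist f s D) (treat s D)|) * n t (histTreat f s D)
          ∂(Q t : Measure (Obs d))
        ≤ ∫ D, (act s (hist f s D) * (boundedWeight (Q t) f δ (K t) s (hist f s D) (treat s D)
            * (|weightDiff P Q f δ K0 K t s (hist f s D)| * y t (hist f s D) (treat s D)))
          + K0 ^ s * (act s (hist f s D) * (|boundedWeight (Q t) f δ (K t) s (hist f s D) (treat s D)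
            - boundedWeight P f δ K0 s (hist f s D) (treat s D)|
              * y t (hist f s D) (treat s D)))) ∂(Q t : Measure (Obs d)) := by
          refine integral_mono_bounded ((bω'.mul (bn t)).comp hX)
            (bb1.add ((BoundedMeasurable.const (K0 ^ s)).mul bb2)) fun D => ?_
          have hu := boundedWeight_nonneg (Q := Q t) (f := f) (δ := δ) (K t) s (hist f s D)
            (treat s D)
          have hΩ := abs_prodWeight_boundedWeight_le (Q := P) (f := f) (δ := δ) hK0 s (hist f s D)
          have hsplit : ω (hist f s D) (treat s D)
              = boundedWeight (Q t) f δ (K t) s (hist f s D) (treat s D)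
                * weightDiff P Q f δ K0 K t s (hist f s D)
              + prodWeight (boundedWeight P f δ K0) s (hist f s D)
                * (boundedWeight (Q t) f δ (K t) s (hist f s D) (treat s D)
                  - boundedWeight P f δ K0 s (hist f s D) (treat s D)) := by
            simp only [hω, weightDiff]; ring
          have hωle : |ω (hist f s D) (treat s D)|
              ≤ boundedWeight (Q t) f δ (K t) s (hist f s D) (treat s D)
                * |weightDiff P Q f δ K0 K t s (hist f s D)|
              + K0 ^ s * |boundedWeight (Q t) f δ (K t) s (hist f s D) (treat s D)
                  - boundedWeight P f δ K0 s (hist f s D) (treat s D)| := by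
            rw [hsplit]
            refine (abs_add_le _ _).trans ?_
            rw [abs_mul, abs_mul, abs_of_nonneg hu]
            gcongr
          have hyn : n t (histTreat f s D) ≤ y t (hist f s D) (treat s D) := le_abs_self _
          have ha := act_nonneg s (hist f s D)
          have hy0 : 0 ≤ y t (hist f s D) (treat s D) := abs_nonneg _
          calc _ ≤ (act s (hist f s D) * |ω (hist f s D) (treat s D)|)
                * y t (hist f s D) (treat s D) :=
                mul_le_mul_of_nonneg_left hyn (mul_nonneg ha (abs_nonneg _))
            _ ≤ (act s (hist f s D) * (boundedWeight (Q t) f δ (K t) s (hist f s D) (treat s D)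
                * |weightDiff P Q f δ K0 K t s (hist f s D)|
              + K0 ^ s * |boundedWeight (Q t) f δ (K t) s (hist f s D) (treat s D)
                  - boundedWeight P f δ K0 s (hist f s D) (treat s D)|))
                * y t (hist f s D) (treat s D) := by gcongr
            _ = _ := by ring
      _ = ∫ D, act s (hist f s D) * ∑ w, dQ (δ s) (trtProb (Q t) s (treatHist s D)) w
            * (|weightDiff P Q f δ K0 K t s (hist f s D)| * y t (hist f s D) w)
            ∂(Q t : Measure (Obs d))
          + K0 ^ s * ∫ D, ∑ w, bern (propensity (Q t) f s (hist f s D)) w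
            * (act s (hist f s D) * (|boundedWeight (Q t) f δ (K t) s (hist f s D) w
              - boundedWeight P f δ K0 s (hist f s D) w| * y t (hist f s D) w))
            ∂(Q t : Measure (Obs d)) := by
          rw [integral_add (by exact bb1.integrable)
            (by exact ((BoundedMeasurable.const (K0 ^ s)).mul bb2).integrable), e2,
            integral_const_mul, e3]
      _ ≤ _ := by
          refine add_le_add (le_of_eq ?_) (mul_le_mul_of_nonneg_left ?_ (pow_nonneg hK0 s))
          · refine integral_congr_ae (.of_forall fun D => ?_)
            have hz0 : 0 ≤ z t D := mul_nonneg (act_nonneg _ _)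
              (Finset.sum_nonneg fun w _ => mul_nonneg (hdQ t D w) (abs_nonneg _))
            simp only
            rw [abs_of_nonneg hz0, hz]
            by_cases hs : s < len D
            · simp only [act_hist, if_pos hs, if_pos hs.le, Fintype.sum_bool]; ring
            · simp [act_hist, if_neg hs]
          · refine integral_mono_ae (BoundedMeasurable.sum _ fun w _ =>
              ((boundedMeasurable_bern_propensity (Q t) f s w).mul (b2 w)).comp hH).integrable
              (bE t).integrable ?_
            filter_upwards [(H.bound_path t).bern_mul] with D hD
            by_cases hs : s < len D
            · rw [act_hist, if_pos hs, one_mul]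
              refine Finset.sum_le_sum fun w _ => ?_
              have hbn := bern_nonneg (propensity_nonneg (Q := Q t) (f := f) s (hist f s D))
                (propensity_le_one _ _) w
              have hθ : weightError P (Q t) f δ K0 s (hist f s D) w
                  = bern (propensity (Q t) f s (hist f s D)) w
                    * (boundedWeight (Q t) f δ (K t) s (hist f s D) w
                      - boundedWeight P f δ K0 s (hist f s D) w) := by
                rw [mul_sub, hD s hs w]; rfl
              rw [hθ, abs_mul, abs_of_nonneg hbn, one_mul, ← mul_assoc]
              exact le_add_of_nonneg_right (mul_nonneg (hdQ t D w) (sq_nonneg _))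
            · simp [act_hist, if_neg hs]

end GPI

/-! ### The residual terms are of second order. -/

namespace GPI

variable {d e : ℕ} {f : ℕ → (Fin d → ℝ) → (Fin e → ℝ)} {δ : ℕ → ℝ}
  {smax : ℕ} {𝒴 : Set ℝ} {P : ProbabilityMeasure (Obs d)} {Q : ℝ → ProbabilityMeasure (Obs d)}
  {g : Obs d → ℝ} {K0 B : ℝ} {K : ℝ → ℝ}

/-- The difference is the `Q t`-mean of (difference of cumulative weights) times (value minus
`m_s`). Conditioning on `(H_s, W_s)` replaces the value by its `Q t`-regression `n`, and `n - m_s`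
has mean square `O(t²)`, which is what `weightDiff_isBigO` asks for. -/
theorem IsRegularPath.stepTerm_isBigO (H : IsRegularPath smax 𝒴 f δ P Q g K0 K B) (s : ℕ) :
    (fun t => ∫ D, stepTerm P f δ B (boundedWeight (Q t) f δ (K t)) s D ∂(Q t : Measure (Obs d))
      - ∫ D, stepTerm P f δ B (boundedWeight P f δ K0) s D ∂(Q t : Measure (Obs d)))
      =O[𝓝[>] 0] fun t : ℝ => t ^ 2 := by
  have hf := H.measurable_f
  have hK0 := H.bound.1
  have hX := measurable_histTreat (d := d) hf s
  have hH := measurable_hist (d := d) hf s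
  have bv := boundedMeasurable_value (Q := P) hf H.delta_pos H.B_nonneg (s + 1)
  have bZ : BoundedMeasurable fun D : Obs d => act s (hist f s D) * value P f δ B (s + 1) D :=
    ((boundedMeasurable_act s).comp hH).mul bv
  have hZB : ∀ D : Obs d, |act s (hist f s D) * value P f δ B (s + 1) D| ≤ B := fun D => by
    rw [abs_mul]
    exact (mul_le_mul (abs_act_le s _) (abs_value_le H.delta_pos H.B_nonneg _ _) (abs_nonneg _)
      zero_le_one).trans_eq (one_mul B)
  set m : Hist e s × Bool → ℝ := fun z => act s z.1 * truncModel P f δ B s z.1 z.2 with hm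
  have bm : BoundedMeasurable m := .uncurry_bool fun w =>
    (boundedMeasurable_act s).mul (boundedMeasurable_truncModel H.B_nonneg s w)
  have hmB : ∀ z, |m z| ≤ B := fun z => by
    rw [hm, abs_mul]
    exact (mul_le_mul (abs_act_le s _) (abs_truncModel_le H.B_nonneg _ _ _) (abs_nonneg _)
      zero_le_one).trans_eq (one_mul B)
  have hreg := fun t => exists_regression (μ := (Q t : Measure (Obs d))) hX bZ.measurable
    H.B_nonneg hZB
  choose n hnm hnB hn using hreg
  have bn : ∀ t, BoundedMeasurable (n t) := fun t => ⟨hnm t, B, hnB t⟩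
  have hsq := regression_diff_isBigO H.score.hellingerSq_le hX bZ.measurable bm.measurable hnm hZB
    hmB hnB (fun φ hφ => by
      have h1 := integral_act_value hf H.delta_pos H.mem H.B_nonneg H.outcome_le s hφ
      simp only [hm, mul_left_comm (φ _)]
      exact h1) (fun t φ hφ => hn t φ hφ.measurable _ hφ.bounded.choose_spec)
  have bx : ∀ t, BoundedMeasurable fun D : Obs d => n t (histTreat f s D) - m (histTreat f s D) :=
    fun t => ((bn t).sub bm).comp hX
  have hN := H.weightDiff_isBigO (s + 1) (C0 := B + B) (fun t => (bx t).measurable)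
    (fun t D => (abs_sub _ _).trans (add_le_add (hnB t _) (hmB _))) hsq
  refine isBigO_of_abs_le (fun t => ?_) hN
  have hKt := (H.bound_path t).1
  set ω : Hist e s × Bool → ℝ := fun z =>
    prodWeight (boundedWeight (Q t) f δ (K t)) s z.1 * boundedWeight (Q t) f δ (K t) s z.1 z.2
      - prodWeight (boundedWeight P f δ K0) s z.1 * boundedWeight P f δ K0 s z.1 z.2 with hω
  have bω : BoundedMeasurable ω := .uncurry_bool fun w =>
    ((boundedMeasurable_prodWeight hKt s).mul (boundedMeasurable_boundedWeight hKt s w)).sub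
      ((boundedMeasurable_prodWeight hK0 s).mul (boundedMeasurable_boundedWeight hK0 s w))
  have bφ : BoundedMeasurable fun z : Hist e s × Bool => act s z.1 * ω z :=
    ((boundedMeasurable_act s).comp measurable_fst).mul bω
  have h1 := hn t _ bφ.measurable _ bφ.bounded.choose_spec
  have bφX := bφ.comp hX
  have hkey : ∫ D, stepTerm P f δ B (boundedWeight (Q t) f δ (K t)) s D
        ∂(Q t : Measure (Obs d))
      - ∫ D, stepTerm P f δ B (boundedWeight P f δ K0) s D ∂(Q t : Measure (Obs d))
      = ∫ D, act s (hist f s D) * ω (histTreat f s D)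
        * (n t (histTreat f s D) - m (histTreat f s D)) ∂(Q t : Measure (Obs d)) := by
    have h2 := integral_sub (μ := (Q t : Measure (Obs d))) (bφX.mul ((bn t).comp hX)).integrable
      (bφX.mul (bm.comp hX)).integrable
    have h3 := integral_sub (μ := (Q t : Measure (Obs d))) (bφX.mul bZ).integrable
      (bφX.mul (bm.comp hX)).integrable
    have h4 : ∫ D, act s (hist f s D) * ω (histTreat f s D)
        * (n t (histTreat f s D) - m (histTreat f s D)) ∂(Q t : Measure (Obs d))
        = ∫ D, (act s (hist f s D) * ω (histTreat f s D)
          * (act s (hist f s D) * value P f δ B (s + 1) D)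
          - act s (hist f s D) * ω (histTreat f s D) * m (histTreat f s D))
          ∂(Q t : Measure (Obs d)) := by
      simp only [mul_sub]
      exact h2.trans ((congrArg (fun y => y - _) h1.symm).trans h3.symm)
    rw [h4, ← integral_sub (boundedMeasurable_stepTerm hf H.delta_pos H.B_nonneg hKt s).integrable
      (boundedMeasurable_stepTerm hf H.delta_pos H.B_nonneg hK0 s).integrable]
    refine integral_congr_ae (.of_forall fun D => ?_)
    simp only [stepTerm, prodWeight_succ_hist, hm, hω, histTreat]
    by_cases hs : s < len D
    · simp only [act_hist, if_pos hs]; ring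
    · simp only [act_hist, if_neg hs]; ring
  rw [hkey]
  refine abs_integral_le_integral_abs.trans (le_of_eq ?_)
  refine integral_congr_ae (.of_forall fun D => ?_)
  beta_reduce
  rw [abs_mul, abs_mul, abs_of_nonneg (act_nonneg s (hist f s D))]
  simp only [act_hist, Nat.succ_le_iff, weightDiff, prodWeight_succ_hist, hω, histTreat, mul_assoc]

end GPI

/-! ### Linearization in the treatment probabilities. -/

namespace GPI

variable {d e : ℕ} {f : ℕ → (Fin d → ℝ) → (Fin e → ℝ)} {δ : ℕ → ℝ}
  {smax : ℕ} {𝒴 : Set ℝ} {P : ProbabilityMeasure (Obs d)} {Q : ℝ → ProbabilityMeasure (Obs d)}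
  {g : Obs d → ℝ} {K0 B : ℝ} {K : ℝ → ℝ}

theorem boundedMeasurable_weightDiff (hK0 : 0 ≤ K0) {t : ℝ} (hK : 0 ≤ K t) (s : ℕ) :
    BoundedMeasurable (weightDiff P Q f δ K0 K t s) :=
  (boundedMeasurable_prodWeight hK s).sub (boundedMeasurable_prodWeight hK0 s)

theorem boundedMeasurable_ite_le_len (s : ℕ) :
    BoundedMeasurable fun D : Obs d => if s ≤ len D then (1 : ℝ) else 0 :=
  .ite (measurableSet_le measurable_const measurable_len)

/-- The constant function `x = t` has mean square `t²`; divide the resulting bound by `t`. The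
truncation only supplies a bound valid for every `t`. -/
theorem IsRegularPath.integral_abs_weightDiff_isBigO
    (H : IsRegularPath smax 𝒴 f δ P Q g K0 K B) (s : ℕ) :
    (fun t => ∫ D, (if s ≤ len D then 1 else 0) * |weightDiff P Q f δ K0 K t s (hist f s D)|
      ∂(Q t : Measure (Obs d))) =O[𝓝[>] 0] fun t : ℝ => t := by
  have h := H.weightDiff_isBigO s (x := fun t _ => clamp 1 t) (C0 := 1)
    (fun t => measurable_const) (fun t _ => abs_clamp_le zero_le_one t) (by
      refine Asymptotics.IsBigO.of_bound 1 ?_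
      filter_upwards [Ioo_mem_nhdsGT (zero_lt_one' ℝ)] with t ht
      rw [clamp_eq_self (by rw [abs_of_pos ht.1]; exact ht.2.le)]
      simp)
  have h' := ((Asymptotics.isBigO_refl (fun t : ℝ => t⁻¹) (𝓝[>] 0)).mul h)
  refine h'.congr' ?_ ?_
  · filter_upwards [Ioo_mem_nhdsGT (zero_lt_one' ℝ)] with t ht
    simp only [← mul_assoc]
    rw [integral_mul_const, clamp_eq_self (by rw [abs_of_pos ht.1]; exact ht.2.le),
      abs_of_pos ht.1]
    have := ht.1.ne'
    field_simp
  · filter_upwards [self_mem_nhdsWithin] with t ht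
    have : t ≠ 0 := ne_of_gt ht
    field_simp

/-- The mean, on a cell, of the weighted difference of the outcome models of `P` for the two
treatments. -/
def cellContrast (R P : ProbabilityMeasure (Obs d)) (f : ℕ → (Fin d → ℝ) → (Fin e → ℝ))
    (δ : ℕ → ℝ) (B : ℝ) (u : (s : ℕ) → Hist e s → Bool → ℝ) (s : ℕ) (v : Fin s → Bool) : ℝ :=
  ∫ D, cellInd s v D * (prodWeight u s (hist f s D)
    * (truncModel P f δ B s (hist f s D) true - truncModel P f δ B s (hist f s D) false))
    ∂(R : Measure (Obs d))

theorem cellInd_nonneg (s : ℕ) (v : Fin s → Bool) (D : Obs d) : 0 ≤ cellInd s v D := by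
  unfold cellInd; split_ifs <;> simp

theorem cellInd_le_one (s : ℕ) (v : Fin s → Bool) (D : Obs d) : cellInd s v D ≤ 1 := by
  unfold cellInd; split_ifs <;> simp

theorem cellInd_eq_ite_mul (s : ℕ) (v : Fin s → Bool) (D : Obs d) :
    cellInd s v D = (if s ≤ len D then 1 else 0) * cellInd s v D := by
  by_cases h : s < len D ∧ treatHist s D = v
  · rw [if_pos h.1.le, one_mul]
  · rw [cellInd, if_neg h, mul_zero]

theorem boundedMeasurable_contrast (hB : 0 ≤ B) (s : ℕ) :
    BoundedMeasurable fun h : Hist e s => truncModel P f δ B s h true - truncModel P f δ B s h false :=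
  (boundedMeasurable_truncModel hB s true).sub (boundedMeasurable_truncModel hB s false)

theorem abs_contrast_le (hB : 0 ≤ B) (s : ℕ) (h : Hist e s) :
    |truncModel P f δ B s h true - truncModel P f δ B s h false| ≤ B + B :=
  (abs_sub _ _).trans (add_le_add (abs_truncModel_le hB _ _ _) (abs_truncModel_le hB _ _ _))

theorem boundedMeasurable_weighted_contrast (hf : ∀ s, Measurable (f s)) (hB : 0 ≤ B)
    {R : ProbabilityMeasure (Obs d)} {k : ℝ} (hk : 0 ≤ k) (s : ℕ) :
    BoundedMeasurable fun D : Obs d => prodWeight (boundedWeight R f δ k) s (hist f s D)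
      * (truncModel P f δ B s (hist f s D) true - truncModel P f δ B s (hist f s D) false) :=
  ((boundedMeasurable_prodWeight hk s).mul (boundedMeasurable_contrast hB s)).comp
    (measurable_hist hf s)

/-- The cell indicator is kept in the bound: on a null cell it gives a gain, on the others it is
estimated by one. -/
theorem IsRegularPath.abs_cellContrast_sub_le (H : IsRegularPath smax 𝒴 f δ P Q g K0 K B)
    (s : ℕ) (v : Fin s → Bool) (t : ℝ) :
    |cellContrast (Q t) P f δ B (boundedWeight (Q t) f δ (K t)) s v
        - cellContrast (Q t) P f δ B (boundedWeight P f δ K0) s v|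
      ≤ (B + B) * ∫ D, (if s ≤ len D then 1 else 0) * (|weightDiff P Q f δ K0 K t s (hist f s D)|
        * |cellInd s v D|) ∂(Q t : Measure (Obs d)) := by
  have hH := measurable_hist (d := d) H.measurable_f s
  have bc := boundedMeasurable_cellInd (d := d) s v
  have b1 := boundedMeasurable_weighted_contrast (P := P) (δ := δ) H.measurable_f H.B_nonneg
    (R := Q t) (H.bound_path t).1 s
  have b2 := boundedMeasurable_weighted_contrast (P := P) (δ := δ) H.measurable_f H.B_nonneg
    (R := P) H.bound.1 s
  have bw := (boundedMeasurable_weightDiff (P := P) (Q := Q) (f := f) (δ := δ) H.bound.1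
    (H.bound_path t).1 s).comp hH
  rw [cellContrast, cellContrast, ← integral_sub (bc.mul b1).integrable (bc.mul b2).integrable,
    ← integral_const_mul]
  refine abs_integral_le_integral_abs.trans (integral_mono_bounded
    ((bc.mul b1).sub (bc.mul b2)).abs ((BoundedMeasurable.const (B + B)).mul
      ((boundedMeasurable_ite_le_len s).mul (bw.abs.mul bc.abs))) fun D => ?_)
  rw [← mul_sub, ← sub_mul, abs_mul, abs_mul, abs_of_nonneg (cellInd_nonneg s v D),
    mul_left_comm _ |_| (cellInd s v D), mul_left_comm _ |_| (_ * _), ← cellInd_eq_ite_mul]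
  have h1 := abs_contrast_le (P := P) (f := f) (δ := δ) H.B_nonneg s (hist f s D)
  have h2 : 0 ≤ cellInd s v D := cellInd_nonneg s v D
  change _ * (|weightDiff P Q f δ K0 K t s (hist f s D)| * _) ≤ _
  calc _ = (cellInd s v D * |weightDiff P Q f δ K0 K t s (hist f s D)|)
        * |truncModel P f δ B s (hist f s D) true - truncModel P f δ B s (hist f s D) false| := by
          ring
    _ ≤ (cellInd s v D * |weightDiff P Q f δ K0 K t s (hist f s D)|) * (B + B) :=
        mul_le_mul_of_nonneg_left h1 (mul_nonneg h2 (abs_nonneg _))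
    _ = _ := by ring

theorem IsRegularPath.tendsto_cellContrast (H : IsRegularPath smax 𝒴 f δ P Q g K0 K B)
    (s : ℕ) (v : Fin s → Bool) :
    Tendsto (fun t => cellContrast (Q t) P f δ B (boundedWeight (Q t) f δ (K t)) s v) (𝓝[>] 0)
      (𝓝 (cellContrast P P f δ B (boundedWeight P f δ K0) s v)) := by
  have b2 := boundedMeasurable_weighted_contrast (P := P) (δ := δ) H.measurable_f H.B_nonneg
    (R := P) H.bound.1 s
  have h1 := HasScore_tendsto H.score ((boundedMeasurable_cellInd s v).mul b2)
  have h2 : Tendsto (fun t => cellContrast (Q t) P f δ B (boundedWeight (Q t) f δ (K t)) s v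
      - cellContrast (Q t) P f δ B (boundedWeight P f δ K0) s v) (𝓝[>] 0) (𝓝 0) := by
    refine Asymptotics.IsBigO.trans_tendsto (isBigO_of_abs_le (fun t => ?_)
      ((H.integral_abs_weightDiff_isBigO s).const_mul_left (B + B))) tendsto_id_nhdsGT
    refine (H.abs_cellContrast_sub_le s v t).trans (mul_le_mul_of_nonneg_left ?_
      (add_nonneg H.B_nonneg H.B_nonneg))
    have bw := ((boundedMeasurable_weightDiff (P := P) (Q := Q) (f := f) (δ := δ) H.bound.1
      (H.bound_path t).1 s).comp (measurable_hist (d := d) H.measurable_f s)).abs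
    have bi := boundedMeasurable_ite_le_len (d := d) s
    refine integral_mono_bounded (bi.mul (bw.mul (boundedMeasurable_cellInd s v).abs))
      (bi.mul bw) fun D => mul_le_mul_of_nonneg_left ?_ (by split_ifs <;> simp)
    rw [abs_of_nonneg (cellInd_nonneg s v D)]
    exact mul_le_of_le_one_right (abs_nonneg _) (cellInd_le_one _ _ _)
  simpa [cellContrast] using h2.add h1

/-- On a `P`-null cell the treatment probability under `Q t` need not converge to its default value,
so the contrast itself must be small. The mean square of the cell indicator is the cell probability,
which is `O(t²)`, so `weightDiff_isBigO` applies with `x` this indicator. -/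
theorem IsRegularPath.cellContrast_isBigO (H : IsRegularPath smax 𝒴 f δ P Q g K0 K B)
    {s : ℕ} {v : Fin s → Bool} (hv : (P : Measure (Obs d)).real (cell s v) = 0) :
    (fun t => cellContrast (Q t) P f δ B (boundedWeight (Q t) f δ (K t)) s v)
      =O[𝓝[>] 0] fun t : ℝ => t ^ 2 := by
  have bc := boundedMeasurable_cellInd (d := d) s v
  have h0 := null_isBigO H.score (measurableSet_cell s v) ((measureReal_eq_zero_iff).1 hv)
  have hsq : ∀ D : Obs d, cellInd s v D ^ 2 = cellInd s v D := fun D => by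
    unfold cellInd; split_ifs <;> simp
  have h1 := H.weightDiff_isBigO s (x := fun _ => cellInd s v) (C0 := 1) (fun t => bc.measurable)
    (fun t D => by rw [abs_of_nonneg (cellInd_nonneg s v D)]; exact cellInd_le_one _ _ _)
    (by simpa only [hsq, integral_cellInd] using h0)
  refine isBigO_of_abs_le (fun t => ?_) ((h1.const_mul_left (B + B)).add
    (h0.const_mul_left (K0 ^ s * (B + B))))
  have h2 : |cellContrast (Q t) P f δ B (boundedWeight P f δ K0) s v|
      ≤ K0 ^ s * (B + B) * (Q t : Measure (Obs d)).real (cell s v) := by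
    have b2 := boundedMeasurable_weighted_contrast (P := P) (δ := δ) H.measurable_f H.B_nonneg
      (R := P) H.bound.1 s
    rw [← integral_cellInd, ← integral_const_mul]
    refine abs_integral_le_integral_abs.trans (integral_mono_bounded (bc.mul b2).abs
      ((BoundedMeasurable.const _).mul bc) fun D => ?_)
    rw [abs_mul, abs_mul, abs_of_nonneg (cellInd_nonneg s v D), mul_comm]
    exact mul_le_mul_of_nonneg_right (mul_le_mul (abs_prodWeight_boundedWeight_le H.bound.1 _ _)
      (abs_contrast_le H.B_nonneg _ _) (abs_nonneg _) (pow_nonneg H.bound.1 _))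
      (cellInd_nonneg s v D)
  have h3 := abs_sub_abs_le_abs_sub
    (cellContrast (Q t) P f δ B (boundedWeight (Q t) f δ (K t)) s v)
    (cellContrast (Q t) P f δ B (boundedWeight P f δ K0) s v)
  have h4 := H.abs_cellContrast_sub_le s v t
  linarith

/-- The coefficient of the centred treatment in the linearization of the target. -/
def treatCoef (P : ProbabilityMeasure (Obs d)) (f : ℕ → (Fin d → ℝ) → (Fin e → ℝ))
    (δ : ℕ → ℝ) (B K0 : ℝ) (s : ℕ) (v : Fin s → Bool) : ℝ :=
  δ s / (δ s * trtProb P s v + 1 - trtProb P s v) ^ 2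
    * (cellContrast P P f δ B (boundedWeight P f δ K0) s v
      / (P : Measure (Obs d)).real (cell s v))

/-- The changes of the two intervention probabilities are opposite, so only the contrast of the
outcome models remains; it is then grouped by treatment history. -/
theorem integral_sum_dQ_sub (hf : ∀ s, Measurable (f s)) (hδ : ∀ s, 0 < δ s) (hB : 0 ≤ B)
    (R : ProbabilityMeasure (Obs d)) {k : ℝ} (hk : 0 ≤ k) (s : ℕ) :
    ∫ D, act s (hist f s D) * ∑ w, (dQ (δ s) (trtProb R s (treatHist s D)) w
        - dQ (δ s) (trtProb P s (treatHist s D)) w)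
        * (prodWeight (boundedWeight R f δ k) s (hist f s D)
          * truncModel P f δ B s (hist f s D) w) ∂(R : Measure (Obs d))
      = ∑ v, (trtProb R s v - trtProb P s v) * (δ s / ((δ s * trtProb R s v + 1 - trtProb R s v)
        * (δ s * trtProb P s v + 1 - trtProb P s v)))
        * cellContrast R P f δ B (boundedWeight R f δ k) s v := by
  have b1 := boundedMeasurable_weighted_contrast (P := P) (δ := δ) hf hB (R := R) hk s
  simp only [cellContrast, ← integral_const_mul]
  rw [← integral_finsetSum _ fun v _ => ((BoundedMeasurable.const _).mul
    ((boundedMeasurable_cellInd s v).mul b1)).integrable]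
  refine integral_congr_ae (.of_forall fun D => ?_)
  beta_reduce
  have h1 := act_mul_eq_sum_cellInd (f := f) s D fun v =>
    (trtProb R s v - trtProb P s v) * (δ s / ((δ s * trtProb R s v + 1 - trtProb R s v)
        * (δ s * trtProb P s v + 1 - trtProb P s v)))
    * (prodWeight (boundedWeight R f δ k) s (hist f s D)
      * (truncModel P f δ B s (hist f s D) true - truncModel P f δ B s (hist f s D) false))
  refine Eq.trans ?_ (h1.trans (Finset.sum_congr rfl fun v _ => by ring))
  rw [← dQ_true_sub (hδ s) (trtProb_nonneg _ _) (trtProb_le_one _ _) (trtProb_nonneg _ _)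
    (trtProb_le_one _ _)]
  have e1 := sum_dQ (hδ s) (trtProb_nonneg (Q := R) s (treatHist s D)) (trtProb_le_one _ _)
  have e2 := sum_dQ (hδ s) (trtProb_nonneg (Q := P) s (treatHist s D)) (trtProb_le_one _ _)
  rw [Fintype.sum_bool] at e1 e2 ⊢
  have e3 : dQ (δ s) (trtProb R s (treatHist s D)) false
      - dQ (δ s) (trtProb P s (treatHist s D)) false
      = -(dQ (δ s) (trtProb R s (treatHist s D)) true
        - dQ (δ s) (trtProb P s (treatHist s D)) true) := by linarith
  rw [e3]
  ring

theorem integral_act_mul_num_sub (R : ProbabilityMeasure (Obs d)) (s : ℕ)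
    (c p : (Fin s → Bool) → ℝ) :
    ∫ D, act s (hist f s D) * (c (treatHist s D) * (num (treat s D) - p (treatHist s D)))
      ∂(R : Measure (Obs d))
      = ∑ v, c v * ((R : Measure (Obs d)).real (cell s v) * (trtProb R s v - p v)) := by
  simp only [← integral_cellInd_mul_num, ← integral_const_mul]
  rw [← integral_finsetSum _ fun v _ => ((BoundedMeasurable.const _).mul
    ((boundedMeasurable_cellInd s v).mul ((boundedMeasurable_num_treat s).sub
      (.const _)))).integrable]
  refine integral_congr_ae (.of_forall fun D => ?_)
  have h1 := act_mul_eq_sum_cellInd (f := f) s D fun v => c v * (num (treat s D) - p v)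
  exact h1.trans (Finset.sum_congr rfl fun v _ => by ring)

/-- Cell by cell, the difference is `p_t - p`, of order `t`, times a factor that tends to zero by
the choice of `treatCoef`. -/
theorem IsRegularPath.treat_isLittleO (H : IsRegularPath smax 𝒴 f δ P Q g K0 K B) (s : ℕ) :
    (fun t => ∫ D, act s (hist f s D) * ∑ w, (dQ (δ s) (trtProb (Q t) s (treatHist s D)) w
        - dQ (δ s) (trtProb P s (treatHist s D)) w)
        * (prodWeight (boundedWeight (Q t) f δ (K t)) s (hist f s D)
          * truncModel P f δ B s (hist f s D) w) ∂(Q t : Measure (Obs d))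
      - ∫ D, act s (hist f s D) * (treatCoef P f δ B K0 s (treatHist s D)
        * (num (treat s D) - trtProb P s (treatHist s D))) ∂(Q t : Measure (Obs d)))
      =o[𝓝[>] 0] fun t : ℝ => t := by
  have hδ := H.delta_pos s
  simp only [fun t => integral_sum_dQ_sub (P := P) H.measurable_f H.delta_pos H.B_nonneg (Q t)
    (H.bound_path t).1 s, integral_act_mul_num_sub, ← Finset.sum_sub_distrib]
  refine Asymptotics.IsLittleO.fun_sum fun v _ => ?_
  have hm : 0 < min (δ s) 1 := lt_min hδ one_pos
  by_cases hv : (P : Measure (Obs d)).real (cell s v) = 0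
  -- Division by the zero cell probability makes the coefficient vanish, so the contrast term must
  -- be negligible by itself.
  · have hc : treatCoef P f δ B K0 s v = 0 := by rw [treatCoef, hv, div_zero, mul_zero]
    simp only [hc, zero_mul, sub_zero]
    have ht2 : (fun t : ℝ => t ^ 2) =o[𝓝[>] 0] fun t : ℝ => t := by
      simpa using (Asymptotics.isLittleO_pow_pow (𝕜 := ℝ) one_lt_two).mono nhdsWithin_le_nhds
    refine Asymptotics.IsBigO.trans_isLittleO ?_ ht2
    refine isBigO_of_abs_le (fun t => ?_) ((H.cellContrast_isBigO hv).abs_left.const_mul_left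
      (δ s / (min (δ s) 1 * min (δ s) 1)))
    rw [abs_mul, ← dQ_true_sub hδ (trtProb_nonneg _ _) (trtProb_le_one _ _) (trtProb_nonneg _ _)
      (trtProb_le_one _ _)]
    refine mul_le_mul_of_nonneg_right ((abs_dQ_sub_le hδ (trtProb_nonneg _ _) (trtProb_le_one _ _)
      (trtProb_nonneg _ _) (trtProb_le_one _ _) _).trans ?_) (abs_nonneg _)
    refine mul_le_of_le_one_right (by positivity) ?_
    rw [abs_le]
    have h1 := trtProb_nonneg (Q := P) s v
    have h2 := trtProb_le_one (Q := P) s v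
    have h3 := trtProb_nonneg (Q := Q t) s v
    have h4 := trtProb_le_one (Q := Q t) s v
    constructor <;> linarith
  · have hp := isBigO_of_cell_mul H.score hv (cell_mul_trtProb_isBigO H.score s v)
    have hpt : Tendsto (fun t => trtProb (Q t) s v) (𝓝[>] 0) (𝓝 (trtProb P s v)) :=
      tendsto_sub_nhds_zero_iff.1 (hp.trans_tendsto tendsto_id_nhdsGT)
    have hd := (dQ_denom_pos hδ (trtProb_nonneg (Q := P) s v) (trtProb_le_one _ _)).ne'
    have hlim : Tendsto (fun t => δ s / ((δ s * trtProb (Q t) s v + 1 - trtProb (Q t) s v)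
        * (δ s * trtProb P s v + 1 - trtProb P s v))
        * cellContrast (Q t) P f δ B (boundedWeight (Q t) f δ (K t)) s v
        - treatCoef P f δ B K0 s v * (Q t : Measure (Obs d)).real (cell s v)) (𝓝[>] 0) (𝓝 0) := by
      have h1 := ((((tendsto_const_nhds (x := δ s)).div ((((hpt.const_mul (δ s)).add_const 1).sub
        hpt).mul_const (δ s * trtProb P s v + 1 - trtProb P s v)) (mul_ne_zero hd hd)).mul
        (H.tendsto_cellContrast s v)).sub
        ((tendsto_measureReal_cell H.score s v).const_mul (treatCoef P f δ B K0 s v)))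
      have hz : δ s / ((δ s * trtProb P s v + 1 - trtProb P s v)
          * (δ s * trtProb P s v + 1 - trtProb P s v))
          * cellContrast P P f δ B (boundedWeight P f δ K0) s v
          - treatCoef P f δ B K0 s v * (P : Measure (Obs d)).real (cell s v) = 0 := by
        rw [treatCoef, ← sq, mul_assoc, div_mul_cancel₀ _ hv, sub_self]
      rw [hz] at h1
      exact h1
    have := hp.mul_isLittleO ((Asymptotics.isLittleO_one_iff ℝ).2 hlim)
    refine this.congr (fun t => ?_) (fun t => mul_one t)
    ring

end GPI

/-! ### Differentiability of the target, and identification of the influence function. -/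

namespace GPI

variable {d e : ℕ} {f : ℕ → (Fin d → ℝ) → (Fin e → ℝ)} {δ : ℕ → ℝ}
  {smax : ℕ} {𝒴 : Set ℝ} {P : ProbabilityMeasure (Obs d)} {Q : ℝ → ProbabilityMeasure (Obs d)}
  {g : Obs d → ℝ} {K0 B : ℝ} {K : ℝ → ℝ}

/-- The uncentred influence function, written with bounded weights and outcome models. -/
def linearization (smax : ℕ) (P : ProbabilityMeasure (Obs d))
    (f : ℕ → (Fin d → ℝ) → (Fin e → ℝ)) (δ : ℕ → ℝ) (B K0 : ℝ) (D : Obs d) : ℝ :=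
  value P f δ B 0 D + ∑ s ∈ Finset.range smax, (stepTerm P f δ B (boundedWeight P f δ K0) s D
    + act s (hist f s D) * (treatCoef P f δ B K0 s (treatHist s D)
      * (num (treat s D) - trtProb P s (treatHist s D))))

theorem boundedMeasurable_act_mul_num_sub (hf : ∀ s, Measurable (f s)) (s : ℕ)
    (c p : (Fin s → Bool) → ℝ) : BoundedMeasurable fun D : Obs d =>
      act s (hist f s D) * (c (treatHist s D) * (num (treat s D) - p (treatHist s D))) := by
  have hH := measurable_hist (d := d) hf s
  exact ((boundedMeasurable_act s).comp hH).mul (((boundedMeasurable_of_treatHist c).comp hH).mul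
    ((boundedMeasurable_num_treat s).sub ((boundedMeasurable_of_treatHist p).comp hH)))

theorem boundedMeasurable_linearization (hf : ∀ s, Measurable (f s)) (hδ : ∀ s, 0 < δ s)
    (hB : 0 ≤ B) (hK0 : 0 ≤ K0) : BoundedMeasurable (linearization smax P f δ B K0) :=
  (boundedMeasurable_value hf hδ hB 0).add (.sum _ fun s _ =>
    (boundedMeasurable_stepTerm hf hδ hB hK0 s).add
      (boundedMeasurable_act_mul_num_sub hf s _ (trtProb P s)))

theorem integral_linearization (hf : ∀ s, Measurable (f s)) (hδ : ∀ s, 0 < δ s)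
    (hB : 0 ≤ B) (hK0 : 0 ≤ K0) (R : ProbabilityMeasure (Obs d)) :
    ∫ D, linearization smax P f δ B K0 D ∂(R : Measure (Obs d))
      = ∫ D, value P f δ B 0 D ∂(R : Measure (Obs d))
        + ∑ s ∈ Finset.range smax, (∫ D, stepTerm P f δ B (boundedWeight P f δ K0) s D
            ∂(R : Measure (Obs d))
          + ∫ D, act s (hist f s D) * (treatCoef P f δ B K0 s (treatHist s D)
            * (num (treat s D) - trtProb P s (treatHist s D))) ∂(R : Measure (Obs d))) := by
  have b1 := fun s => boundedMeasurable_stepTerm (P := P) (Q := P) hf hδ hB hK0 s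
  have b2 := fun s => boundedMeasurable_act_mul_num_sub (d := d) hf s (treatCoef P f δ B K0 s)
    (trtProb P s)
  simp only [linearization]
  rw [integral_add (boundedMeasurable_value hf hδ hB 0).integrable
    (BoundedMeasurable.sum _ fun s _ => (b1 s).add (b2 s)).integrable,
    integral_finsetSum _ fun s _ => ((b1 s).add (b2 s)).integrable]
  congr 1
  exact Finset.sum_congr rfl fun s _ => integral_add (b1 s).integrable (b2 s).integrable

/-- The expansion with `Q = P`: the intervention terms cancel, and the centred treatment has mean
zero on every cell. -/
theorem target_eq_integral_linearization (hf : ∀ s, Measurable (f s)) (hδ : ∀ s, 0 < δ s)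
    (hP : P ∈ model smax 𝒴 f) (hK0 : IsWeightBound P f δ K0) (hB0 : 0 ≤ B)
    (hB : ∀ y ∈ 𝒴, |y| ≤ B) :
    target smax f δ P = ∫ D, linearization smax P f δ B K0 D ∂(P : Measure (Obs d)) := by
  rw [hK0.target_expansion hf hδ hP hB0 hB P, integral_linearization hf hδ hB0 hK0.1]
  congr 1
  refine Finset.sum_congr rfl fun s _ => ?_
  rw [integral_act_mul_num_sub]
  simp

theorem IsRegularPath.target_sub_isLittleO (H : IsRegularPath smax 𝒴 f δ P Q g K0 K B) :
    (fun t => target smax f δ (Q t)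
      - ∫ D, linearization smax P f δ B K0 D ∂(Q t : Measure (Obs d))) =o[𝓝[>] 0]
      fun t : ℝ => t := by
  simp only [fun t => (H.bound_path t).target_expansion H.measurable_f H.delta_pos (H.mem_path t)
    H.B_nonneg H.outcome_le P, fun t => integral_linearization (smax := smax) (P := P)
    H.measurable_f H.delta_pos H.B_nonneg H.bound.1 (Q t), add_sub_add_left_eq_sub,
    ← Finset.sum_sub_distrib, add_sub_add_comm]
  have ht2 : (fun t : ℝ => t ^ 2) =o[𝓝[>] 0] fun t : ℝ => t := by
    simpa using (Asymptotics.isLittleO_pow_pow (𝕜 := ℝ) one_lt_two).mono nhdsWithin_le_nhds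
  exact Asymptotics.IsLittleO.fun_sum fun s _ =>
    ((H.stepTerm_isBigO s).trans_isLittleO ht2).add (H.treat_isLittleO s)

theorem IsRegularPath.tendsto_target (H : IsRegularPath smax 𝒴 f δ P Q g K0 K B) :
    Tendsto (fun t => (target smax f δ (Q t) - target smax f δ P) / t) (𝓝[>] 0)
      (𝓝 (∫ D, linearization smax P f δ B K0 D * g D ∂(P : Measure (Obs d)))) := by
  have bΛ := boundedMeasurable_linearization (smax := smax) (P := P) H.measurable_f H.delta_pos
    H.B_nonneg H.bound.1
  obtain ⟨C, hC⟩ := bΛ.bounded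
  have h1 := H.score.tendsto_integral bΛ.measurable hC
  have h2 := H.target_sub_isLittleO.tendsto_div_nhds_zero.add h1
  rw [zero_add] at h2
  refine h2.congr fun t => ?_
  rw [target_eq_integral_linearization H.measurable_f H.delta_pos H.mem H.bound H.B_nonneg
    H.outcome_le]
  ring

/-! ### The influence function in terms of the linearization -/

/-- For each of the countably many histories and treatments, the event that a treatment of
conditional probability zero occurs is null. -/
theorem ae_bern_treat_ne_zero (P : ProbabilityMeasure (Obs d)) :
    ∀ᵐ D ∂(P : Measure (Obs d)), ∀ s < len D,
      bern (trtProb P s (treatHist s D)) (treat s D) ≠ 0 := by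
  have h : ∀ s, ∀ v : Fin s → Bool, ∀ w, bern (trtProb P s v) w = 0 →
      ∀ᵐ D ∂(P : Measure (Obs d)), D ∉ cell s v ∩ {D | treat s D = w} := fun s v w hw => by
    rw [← measure_eq_zero_iff_ae_notMem, ← measureReal_eq_zero_iff, ← measureReal_cell_mul_bern, hw,
      mul_zero]
  have h' : ∀ᵐ D ∂(P : Measure (Obs d)), ∀ s, ∀ v : Fin s → Bool, ∀ w,
      bern (trtProb P s v) w = 0 → D ∉ cell s v ∩ {D | treat s D = w} :=
    ae_all_iff.2 fun s => ae_all_iff.2 fun v => ae_all_iff.2 fun w => by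
      by_cases hw : bern (trtProb P s v) w = 0
      · exact (h s v w hw).mono fun D hD _ => hD
      · exact .of_forall fun D hw' => absurd hw' hw
  filter_upwards [h'] with D hD s hs h0
  exact hD s _ _ h0 ⟨⟨hs, rfl⟩, rfl⟩

theorem integral_cond_cell (s : ℕ) (v : Fin s → Bool) (φ : Obs d → ℝ) :
    ∫ D, φ D ∂(cond (P : Measure (Obs d)) (cell s v))
      = ((P : Measure (Obs d)).real (cell s v))⁻¹
        * ∫ D, cellInd s v D * φ D ∂(P : Measure (Obs d)) := by
  rw [ProbabilityTheory.cond, integral_smul_measure, ENNReal.toReal_inv, smul_eq_mul,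
    ← integral_indicator (measurableSet_cell s v)]
  congr 1
  refine integral_congr_ae (.of_forall fun D => ?_)
  by_cases h : s < len D ∧ treatHist s D = v
  · have h' : D ∈ cell s v := h
    simp [cellInd, h, h']
  · have h' : D ∉ cell s v := h
    simp [cellInd, h, h']

theorem cumWeight_eq_prodWeight (hK0 : IsWeightBound P f δ K0) :
    ∀ᵐ D ∂(P : Measure (Obs d)), ∀ s ≤ len D,
      cumWeight P f δ s D = prodWeight (boundedWeight P f δ K0) s (hist f s D) := by
  filter_upwards [hK0.boundedWeight_eq] with D hD s hs
  rw [prodWeight_hist]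
  exact Finset.prod_congr rfl fun j hj =>
    (hD j ((Finset.mem_range.1 hj).trans_le hs) _).symm

/-- At a treatment of probability zero the untruncated outcome model could be anything, hence the
hypothesis on `w`. -/
theorem outcomeModelTilde_eq (hf : ∀ s, Measurable (f s)) (hδ : ∀ s, 0 < δ s)
    (hP : P ∈ model smax 𝒴 f) (hK0 : IsWeightBound P f δ K0) (hB0 : 0 ≤ B)
    (hB : ∀ y ∈ 𝒴, |y| ≤ B) {s : ℕ} {v : Fin s → Bool} {w : Bool}
    (hw : bern (trtProb P s v) w ≠ 0) :
    outcomeModelTilde P f δ s v w = ((P : Measure (Obs d)).real (cell s v))⁻¹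
      * ∫ D, cellInd s v D * (prodWeight (boundedWeight P f δ K0) s (hist f s D)
        * truncModel P f δ B s (hist f s D) w) ∂(P : Measure (Obs d)) := by
  rw [outcomeModelTilde, integral_cond_cell]
  congr 1
  refine integral_congr_ae ?_
  filter_upwards [cumWeight_eq_prodWeight hK0, outcomeModel_eq_truncModel hf hδ hP hB0 hB]
    with D h1 h2
  by_cases h : s < len D ∧ treatHist s D = v
  · rw [h1 s h.1.le, h2 s h.1 w (by rw [h.2]; exact hw)]
  · rw [cellInd, if_neg h, zero_mul, zero_mul]

theorem outcomeModelTilde_sub_eq (hf : ∀ s, Measurable (f s)) (hδ : ∀ s, 0 < δ s)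
    (hP : P ∈ model smax 𝒴 f) (hK0 : IsWeightBound P f δ K0) (hB0 : 0 ≤ B)
    (hB : ∀ y ∈ 𝒴, |y| ≤ B) {s : ℕ} {v : Fin s → Bool} (hw : ∀ w, bern (trtProb P s v) w ≠ 0) :
    outcomeModelTilde P f δ s v true - outcomeModelTilde P f δ s v false
      = cellContrast P P f δ B (boundedWeight P f δ K0) s v
        / (P : Measure (Obs d)).real (cell s v) := by
  have b : ∀ w, BoundedMeasurable fun D : Obs d => cellInd s v D *
      (prodWeight (boundedWeight P f δ K0) s (hist f s D) * truncModel P f δ B s (hist f s D) w) :=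
    fun w => (boundedMeasurable_cellInd s v).mul (((boundedMeasurable_prodWeight hK0.1 s).mul
      (boundedMeasurable_truncModel hB0 s w)).comp (measurable_hist hf s))
  rw [outcomeModelTilde_eq hf hδ hP hK0 hB0 hB (hw true),
    outcomeModelTilde_eq hf hδ hP hK0 hB0 hB (hw false), ← mul_sub,
    ← integral_sub (b true).integrable (b false).integrable, div_eq_inv_mul, cellContrast]
  congr 1
  refine integral_congr_ae (.of_forall fun D => ?_)
  beta_reduce
  ring

/-- A summation by parts: the linearization groups, at each segment, the next value with the current
outcome model, while the influence function groups the current value with the current outcome model.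
-/
theorem influence_eq_linearization (hf : ∀ s, Measurable (f s)) (hδ : ∀ s, 0 < δ s)
    (hP : P ∈ model smax 𝒴 f) (hK0 : IsWeightBound P f δ K0) (hB0 : 0 ≤ B)
    (hB : ∀ y ∈ 𝒴, |y| ≤ B) :
    ∀ᵐ D ∂(P : Measure (Obs d)), influence smax f δ P D
      = linearization smax P f δ B K0 D - target smax f δ P := by
  filter_upwards [hP.1, ae_outcome_bounded hB hP, hK0.boundedWeight_eq, cumWeight_eq_prodWeight hK0,
    outcomeModel_eq_truncModel hf hδ hP hB0 hB, ae_bern_treat_ne_zero P] with D hl hY hu hΩ hm hW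
  have hact : ∀ F : ℕ → ℝ, ∑ s ∈ Finset.range smax, act s (hist f s D) * F s
      = ∑ s ∈ Finset.range (len D), F s := fun F => by
    rw [← Finset.sum_subset (Finset.range_subset_range.2 hl.2)
      (f := fun s => act s (hist f s D) * F s)]
    · refine Finset.sum_congr rfl fun s hs => ?_
      rw [act_hist, if_pos (Finset.mem_range.1 hs), one_mul]
    · intro s _ hs
      rw [act_hist, if_neg (by simpa using hs), zero_mul]
  -- The weighted values run from the value at the first segment to the weighted outcome.
  have htel : ∑ s ∈ Finset.range (len D),
      (prodWeight (boundedWeight P f δ K0) (s + 1) (hist f (s + 1) D) * value P f δ B (s + 1) D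
        - prodWeight (boundedWeight P f δ K0) s (hist f s D) * value P f δ B s D)
      = prodWeight (boundedWeight P f δ K0) (len D) (hist f (len D) D) * outcome D
        - value P f δ B 0 D := by
    rw [Finset.sum_range_sub fun s =>
      prodWeight (boundedWeight P f δ K0) s (hist f s D) * value P f δ B s D]
    have h1 : value P f δ B (len D) D = outcome D := by
      rw [value, if_neg (lt_irrefl _), clamp_eq_self hY]
    rw [h1, prodWeight_hist (s := 0)]
    simp
  have hΛ : linearization smax P f δ B K0 D = value P f δ B 0 D
      + ∑ s ∈ Finset.range (len D), (prodWeight (boundedWeight P f δ K0) (s + 1) (hist f (s + 1) D)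
        * (value P f δ B (s + 1) D - truncModel P f δ B s (hist f s D) (treat s D)))
      + ∑ s ∈ Finset.range (len D), treatCoef P f δ B K0 s (treatHist s D)
        * (num (treat s D) - trtProb P s (treatHist s D)) := by
    rw [linearization, Finset.sum_add_distrib, ← hact fun s => treatCoef P f δ B K0 s (treatHist s D)
      * (num (treat s D) - trtProb P s (treatHist s D)), add_assoc]
    simp only [stepTerm]
    rw [hact fun s => prodWeight (boundedWeight P f δ K0) (s + 1) (hist f (s + 1) D)
        * (value P f δ B (s + 1) D - truncModel P f δ B s (hist f s D) (treat s D))]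
  have hfirst : ∀ s ∈ Finset.range (len D), cumWeight P f δ s D *
      ((δ s * trtProb P s (treatHist s D) * outcomeModel P f δ s (hist f s D) true
            * (1 - num (treat s D) / propensity P f s (hist f s D))
          + (1 - trtProb P s (treatHist s D)) * outcomeModel P f δ s (hist f s D) false
            * (1 - (1 - num (treat s D)) / (1 - propensity P f s (hist f s D))))
        / (δ s * trtProb P s (treatHist s D) + 1 - trtProb P s (treatHist s D)))
      = prodWeight (boundedWeight P f δ K0) s (hist f s D) * value P f δ B s D
        - prodWeight (boundedWeight P f δ K0) (s + 1) (hist f (s + 1) D)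
          * truncModel P f δ B s (hist f s D) (treat s D) := by
    intro s hs
    have hs' := Finset.mem_range.1 hs
    have hq : ∀ w, dQ (δ s) (trtProb P s (treatHist s D)) w * outcomeModel P f δ s (hist f s D) w
        = dQ (δ s) (trtProb P s (treatHist s D)) w * truncModel P f δ B s (hist f s D) w := by
      intro w
      by_cases hw : bern (trtProb P s (treatHist s D)) w = 0
      · rw [dQ_eq_zero (hδ s) (trtProb_nonneg _ _) (trtProb_le_one _ _) hw, zero_mul, zero_mul]
      · rw [hm s hs' w hw]
    have hw : weight P f δ s (hist f s D) (treat s D)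
        = dQ (δ s) (trtProb P s (treatHist s D)) (treat s D)
          / bern (propensity P f s (hist f s D)) (treat s D) := weight_eq _ _ _ _
    rw [hΩ s hs'.le, prodWeight_succ_hist, hu s hs', hw, value, if_pos hs', Fintype.sum_bool,
      ← hq, ← hq, mul_assoc (prodWeight _ _ _), ← mul_sub, div_mul_eq_mul_div, ← hq]
    congr 1
    rw [dQ_true, dQ_false]
    cases treat s D
    · rw [dQ_false]
      simp only [num, bern, Bool.false_eq_true, if_false]
      ring
    · rw [dQ_true]
      simp only [num, bern, if_true]
      ring
  have hsecond : ∀ s ∈ Finset.range (len D),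
      δ s * (num (treat s D) - trtProb P s (treatHist s D))
        * (outcomeModelTilde P f δ s (treatHist s D) true
          - outcomeModelTilde P f δ s (treatHist s D) false)
        / (δ s * trtProb P s (treatHist s D) + 1 - trtProb P s (treatHist s D)) ^ 2
      = treatCoef P f δ B K0 s (treatHist s D)
        * (num (treat s D) - trtProb P s (treatHist s D)) := by
    intro s hs
    have hs' := Finset.mem_range.1 hs
    by_cases hw : ∀ w, bern (trtProb P s (treatHist s D)) w ≠ 0
    · rw [outcomeModelTilde_sub_eq hf hδ hP hK0 hB0 hB hw, treatCoef]
      ring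
    -- If one treatment has probability zero, the observed one equals its conditional mean, so the
    -- centred treatment vanishes and the uncontrolled contrast does not matter.
    · push Not at hw
      obtain ⟨w, hw⟩ := hw
      have hne : treat s D ≠ w := fun h => hW s hs' (by rw [h]; exact hw)
      have h0 : num (treat s D) - trtProb P s (treatHist s D) = 0 := by
        cases w
        · have : treat s D = true := by simpa using hne
          rw [this]
          simpa [bern, num] using hw
        · have : treat s D = false := by simpa using hne
          rw [this]
          simpa [bern, num] using hw
      rw [h0]
      ring
  rw [influence, Finset.sum_congr rfl hfirst, Finset.sum_congr rfl hsecond, hΛ, hΩ _ le_rfl]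
  simp only [mul_sub, Finset.sum_sub_distrib] at htel ⊢
  linarith

end GPI

theorem IsInfluenceFunction.congr_ae {Ω : Type*} [MeasurableSpace Ω] {M : Set (ProbabilityMeasure Ω)}
    {Ψ : ProbabilityMeasure Ω → ℝ} {P : ProbabilityMeasure Ω} {ψ ψ' : Ω → ℝ}
    (h : IsInfluenceFunction M Ψ P ψ) (hψ : ψ =ᵐ[(P : Measure Ω)] ψ') :
    IsInfluenceFunction M Ψ P ψ' := by
  refine ⟨h.1.ae_eq hψ, (integral_congr_ae hψ).symm.trans h.2.1, fun Q g hQ hg => ?_⟩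
  rw [integral_congr_ae (g := fun x => ψ x * g x) (hψ.mono fun x hx => by beta_reduce; rw [hx])]
  exact h.2.2 Q g hQ hg

namespace GPI

variable {d e : ℕ} {f : ℕ → (Fin d → ℝ) → (Fin e → ℝ)} {δ δ' : ℕ → ℝ}
  {smax : ℕ} {𝒴 : Set ℝ} {P : ProbabilityMeasure (Obs d)}

/-- Positivity of all `δ s` makes the bounds on values hold at every observation; irrelevant entries
of `δ` are changed afterwards to reach the general case. -/
theorem isInfluenceFunction_influence_of_forall_pos (h𝒴 : Bornology.IsBounded 𝒴)
    (hf : ∀ s, Measurable (f s)) (hδ : ∀ s, 0 < δ s) (hP : P ∈ model smax 𝒴 f) :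
    IsInfluenceFunction (model smax 𝒴 f) (target smax f δ) P (influence smax f δ P) := by
  obtain ⟨B', hB'⟩ := h𝒴.exists_norm_le
  set B := max B' 0
  have hB : ∀ y ∈ 𝒴, |y| ≤ B := fun y hy => (hB' y hy).trans (le_max_left _ _)
  have hB0 : 0 ≤ B := le_max_right _ _
  obtain ⟨K0, hK0⟩ := exists_isWeightBound (fun s _ => hδ s) hP
  have bΛ := boundedMeasurable_linearization (smax := smax) (P := P) hf hδ hB0 hK0.1
  refine IsInfluenceFunction.congr_ae (ψ := fun D => linearization smax P f δ B K0 D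
    - target smax f δ P) ?_ ((influence_eq_linearization hf hδ hP hK0 hB0 hB).mono
      fun D hD => hD.symm)
  have bψ := bΛ.sub (.const (target smax f δ P))
  refine ⟨?_, ?_, fun Q g hQ hg => ?_⟩
  · obtain ⟨C, hC⟩ := bψ.bounded
    exact MemLp.of_bound bψ.measurable.aestronglyMeasurable C (.of_forall hC)
  · rw [integral_sub bΛ.integrable (integrable_const _),
      ← target_eq_integral_linearization hf hδ hP hK0 hB0 hB]
    simp
  · classical
    -- The path lies in the model only for small `t`; elsewhere it is replaced by `P`, so that
    -- weight bounds exist for every `t`.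
    set Q' : ℝ → ProbabilityMeasure (Obs d) := fun t => if Q t ∈ model smax 𝒴 f then Q t else P
      with hQ'
    have hmem : ∀ t, Q' t ∈ model smax 𝒴 f := fun t => by
      simp only [hQ']; split_ifs with h
      · exact h
      · exact hP
    have hev : Q =ᶠ[𝓝[>] 0] Q' := hQ.mono fun t ht => (if_pos ht).symm
    choose K hK using fun t => exists_isWeightBound (fun s _ => hδ s) (hmem t)
    have H : IsRegularPath smax 𝒴 f δ P Q' g K0 K B :=
      ⟨hf, hδ, hP, hmem, hg.congr_path hev, hK0, hK, hB0, hB⟩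
    have hgi : Integrable g (P : Measure (Obs d)) := hg.1.integrable one_le_two
    obtain ⟨C, hC⟩ := bΛ.bounded
    -- The score has mean zero, so centring does not change the derivative.
    have h1 : ∫ D, (linearization smax P f δ B K0 D - target smax f δ P) * g D
        ∂(P : Measure (Obs d))
        = ∫ D, linearization smax P f δ B K0 D * g D ∂(P : Measure (Obs d)) := by
      simp only [sub_mul]
      rw [integral_sub (hgi.bdd_mul bΛ.measurable.aestronglyMeasurable (.of_forall hC))
        (hgi.const_mul _), integral_const_mul, hg.integral_score, mul_zero, sub_zero]
    rw [h1]
    exact H.tendsto_target.congr' (hev.mono fun t ht => by rw [← ht])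

/-! ### Dependence on the intervention parameters -/

theorem interventionLaw_congr (n s : ℕ) (h : ∀ j < s, δ j = δ' j) :
    interventionLaw P f δ n s = interventionLaw P f δ' n s := by
  induction s with
  | zero => rfl
  | succ s ih =>
    rw [interventionLaw, interventionLaw, ih fun j hj => h j (by omega), h s (by omega)]

theorem target_congr (h : ∀ j < smax, δ j = δ' j) : target smax f δ = target smax f δ' := by
  funext R
  refine Finset.sum_congr rfl fun n hn => ?_
  have hn' := Finset.mem_range.1 hn
  rw [interventionLaw_congr (δ' := δ') _ _ fun j hj => h j (hj.trans hn'), h n hn']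

theorem cumWeight_congr {s : ℕ} (h : ∀ j < s, δ j = δ' j) :
    cumWeight P f δ s = cumWeight P f δ' s := by
  funext D
  refine Finset.prod_congr rfl fun j hj => ?_
  rw [weight, weight, h j (Finset.mem_range.1 hj)]

theorem outcomeModelAux_congr (k s : ℕ) (h : ∀ j ≤ s + k, δ j = δ' j) :
    (outcomeModelAux P f δ k s : Hist e s → Bool → ℝ) = outcomeModelAux P f δ' k s := by
  induction k generalizing s with
  | zero => rfl
  | succ k ih =>
    funext x w
    rw [outcomeModelAux, outcomeModelAux, ih (s + 1) fun j hj => h j (by omega),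
      h (s + 1) (by omega)]

theorem outcomeModel_hist_congr {s : ℕ} {D : Obs d} (hs : s < len D)
    (h : ∀ j < len D, δ j = δ' j) (w : Bool) :
    outcomeModel P f δ s (hist f s D) w = outcomeModel P f δ' s (hist f s D) w := by
  rw [outcomeModel, outcomeModel, outcomeModelAux_congr (δ' := δ')]
  intro j hj
  change j ≤ s + (len D - (s + 1)) at hj
  exact h j (by omega)

theorem outcomeModelTilde_congr (hP : P ∈ model smax 𝒴 f) (h : ∀ j < smax, δ j = δ' j) (s : ℕ)
    (v : Fin s → Bool) (w : Bool) :
    outcomeModelTilde P f δ s v w = outcomeModelTilde P f δ' s v w := by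
  rw [outcomeModelTilde, outcomeModelTilde, integral_cond_cell, integral_cond_cell]
  congr 1
  refine integral_congr_ae ?_
  filter_upwards [hP.1] with D hD
  by_cases hs : s < len D ∧ treatHist s D = v
  · rw [outcomeModel_hist_congr hs.1 fun j hj => h j (hj.trans_le hD.2),
      cumWeight_congr (δ' := δ') fun j hj => h j (by omega)]
  · rw [cellInd, if_neg hs, zero_mul, zero_mul]

/-- Equality is only almost sure because records longer than `smax` are excluded only almost surely.
-/
theorem influence_congr (hP : P ∈ model smax 𝒴 f) (h : ∀ j < smax, δ j = δ' j) :
    influence smax f δ P =ᵐ[(P : Measure (Obs d))] influence smax f δ' P := by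
  filter_upwards [hP.1] with D hD
  have h' : ∀ j < len D, δ j = δ' j := fun j hj => h j (hj.trans_le hD.2)
  rw [influence, influence, target_congr h, cumWeight_congr h']
  congr 3
  · refine Finset.sum_congr rfl fun s hs => ?_
    have hs' := Finset.mem_range.1 hs
    rw [outcomeModel_hist_congr hs' h', outcomeModel_hist_congr hs' h', h' s hs',
      cumWeight_congr (δ' := δ') fun j hj => h' j (by omega)]
  · refine Finset.sum_congr rfl fun s hs => ?_
    rw [outcomeModelTilde_congr hP h, outcomeModelTilde_congr hP h, h' s (Finset.mem_range.1 hs)]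

theorem isInfluenceFunction_influence (h𝒴 : Bornology.IsBounded 𝒴)
    (hf : ∀ s, Measurable (f s)) (hδ : ∀ s < smax, 0 < δ s) (hP : P ∈ model smax 𝒴 f) :
    IsInfluenceFunction (model smax 𝒴 f) (target smax f δ) P (influence smax f δ P) := by
  set δ' : ℕ → ℝ := fun s => if s < smax then δ s else 1 with hδ'
  have h : ∀ j < smax, δ j = δ' j := fun j hj => (if_pos hj).symm
  have hpos : ∀ s, 0 < δ' s := fun s => by
    simp only [hδ']; split_ifs with hs
    · exact hδ s hs
    · exact one_pos
  rw [target_congr h]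
  exact (isInfluenceFunction_influence_of_forall_pos h𝒴 hf hpos hP).congr_ae
    (influence_congr hP h).symm

end GPI

/-! ### Bounded scores and uniqueness. -/

section Perturbation

variable {Ω : Type*} [MeasurableSpace Ω]

/-- The law with density `1 + t g` with respect to `P`, with `t` truncated to `[-1/2, 1/2]`. -/
def perturbedMeasure (P : Measure Ω) (g : Ω → ℝ) (t : ℝ) : Measure Ω :=
  P.withDensity fun x => ENNReal.ofReal (1 + clamp (1 / 2) t * g x)

theorem half_le_density {t y : ℝ} (hy : |y| ≤ 1) : 1 / 2 ≤ 1 + clamp (1 / 2) t * y := by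
  have h := abs_le.1 ((abs_mul (clamp (1 / 2) t) y).le.trans
    (mul_le_mul (abs_clamp_le (by norm_num) t) hy (abs_nonneg _) (by norm_num)))
  linarith [h.1]

theorem density_le {t y : ℝ} (hy : |y| ≤ 1) : 1 + clamp (1 / 2) t * y ≤ 3 / 2 := by
  have h := abs_le.1 ((abs_mul (clamp (1 / 2) t) y).le.trans
    (mul_le_mul (abs_clamp_le (by norm_num) t) hy (abs_nonneg _) (by norm_num)))
  linarith [h.2]

variable {P : Measure Ω} {g : Ω → ℝ}

theorem integral_perturbedMeasure (hg : Measurable g) (hg1 : ∀ x, |g x| ≤ 1) (t : ℝ) (φ : Ω → ℝ) :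
    ∫ x, φ x ∂(perturbedMeasure P g t) = ∫ x, (1 + clamp (1 / 2) t * g x) * φ x ∂P := by
  rw [perturbedMeasure, integral_withDensity_eq_integral_toReal_smul (by fun_prop)
    (.of_forall fun _ => ENNReal.ofReal_lt_top)]
  refine integral_congr_ae (.of_forall fun x => ?_)
  beta_reduce
  rw [ENNReal.toReal_ofReal (by linarith [half_le_density (t := t) (hg1 x)]), smul_eq_mul]

theorem isProbabilityMeasure_perturbedMeasure [IsProbabilityMeasure P] (hg : Measurable g)
    (hg1 : ∀ x, |g x| ≤ 1) (h0 : ∫ x, g x ∂P = 0) (t : ℝ) :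
    IsProbabilityMeasure (perturbedMeasure P g t) := by
  have bg : BoundedMeasurable g := ⟨hg, 1, hg1⟩
  have bd := (BoundedMeasurable.const (1 : ℝ)).add ((BoundedMeasurable.const
    (clamp (1 / 2) t)).mul bg)
  refine ⟨?_⟩
  rw [perturbedMeasure, withDensity_apply _ MeasurableSet.univ, Measure.restrict_univ,
    ← ofReal_integral_eq_lintegral_ofReal bd.integrable
      (.of_forall fun x => (show (0 : ℝ) ≤ 1 / 2 by norm_num).trans
        (half_le_density (t := t) (hg1 x))),
    integral_add (integrable_const _) ((BoundedMeasurable.const _).mul bg).integrable,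
    integral_const_mul, h0]
  simp

theorem perturbedMeasure_absolutelyContinuous (t : ℝ) : perturbedMeasure P g t ≪ P :=
  withDensity_absolutelyContinuous _ _

theorem integral_perturbedMeasure_le [IsProbabilityMeasure P] (hg : Measurable g)
    (hg1 : ∀ x, |g x| ≤ 1) (t : ℝ) {φ : Ω → ℝ} (hφ : BoundedMeasurable φ) (h0 : ∀ x, 0 ≤ φ x) :
    ∫ x, φ x ∂(perturbedMeasure P g t) ≤ 3 / 2 * ∫ x, φ x ∂P := by
  have bg : BoundedMeasurable g := ⟨hg, 1, hg1⟩
  rw [integral_perturbedMeasure hg hg1, ← integral_const_mul]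
  exact integral_mono (((BoundedMeasurable.const (1 : ℝ)).add ((BoundedMeasurable.const
    (clamp (1 / 2) t)).mul bg)).mul hφ).integrable ((BoundedMeasurable.const _).mul hφ).integrable
    fun x => mul_le_mul_of_nonneg_right (density_le (hg1 x)) (h0 x)

theorem le_integral_perturbedMeasure [IsProbabilityMeasure P] (hg : Measurable g)
    (hg1 : ∀ x, |g x| ≤ 1) (t : ℝ) {φ : Ω → ℝ} (hφ : BoundedMeasurable φ) (h0 : ∀ x, 0 ≤ φ x) :
    1 / 2 * ∫ x, φ x ∂P ≤ ∫ x, φ x ∂(perturbedMeasure P g t) := by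
  have bg : BoundedMeasurable g := ⟨hg, 1, hg1⟩
  rw [integral_perturbedMeasure hg hg1, ← integral_const_mul]
  exact integral_mono ((BoundedMeasurable.const _).mul hφ).integrable
    (((BoundedMeasurable.const (1 : ℝ)).add ((BoundedMeasurable.const
    (clamp (1 / 2) t)).mul bg)).mul hφ).integrable
    fun x => mul_le_mul_of_nonneg_right (half_le_density (hg1 x)) (h0 x)

/-- With `r = √(1 + x)` the error is `(r - 1)² / 2`, while `x² = (r - 1)² (r + 1)²` and `r + 1 ≥ 1`.
-/
theorem abs_sqrt_one_add_sub_le {x : ℝ} (hx : -1 ≤ x) : |√(1 + x) - 1 - x / 2| ≤ x ^ 2 / 2 := by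
  have h1 : √(1 + x) ^ 2 = 1 + x := Real.sq_sqrt (by linarith)
  have h0 := Real.sqrt_nonneg (1 + x)
  generalize √(1 + x) = r at *
  obtain rfl : x = r ^ 2 - 1 := by linarith
  have h2 : r - 1 - (r ^ 2 - 1) / 2 = -((r - 1) ^ 2 / 2) := by ring
  rw [h2, abs_neg, abs_of_nonneg (by positivity)]
  have h3 : (r ^ 2 - 1) ^ 2 = (r - 1) ^ 2 * (r + 1) ^ 2 := by ring
  rw [h3]
  have h4 : 1 ≤ (r + 1) ^ 2 := by nlinarith
  nlinarith [mul_le_mul_of_nonneg_left h4 (sq_nonneg (r - 1))]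

/-- The path of laws with densities `1 + t g`. -/
def perturbedLaw (P : ProbabilityMeasure Ω) {g : Ω → ℝ} (hg : Measurable g)
    (hg1 : ∀ x, |g x| ≤ 1) (h0 : ∫ x, g x ∂(P : Measure Ω) = 0) (t : ℝ) : ProbabilityMeasure Ω :=
  ⟨perturbedMeasure P g t, isProbabilityMeasure_perturbedMeasure hg hg1 h0 t⟩

/-- The remainder is `√p` times `(√(1 + t g) - 1 - t g / 2) / t`, which is at most `t / 2`
uniformly. -/
theorem hasScore_perturbedLaw (P : ProbabilityMeasure Ω) {g : Ω → ℝ} (hg : Measurable g)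
    (hg1 : ∀ x, |g x| ≤ 1) (h0 : ∫ x, g x ∂(P : Measure Ω) = 0) :
    HasScore P (perturbedLaw P hg hg1 h0) g := by
  refine ⟨MemLp.of_bound hg.aestronglyMeasurable 1 (.of_forall hg1), ?_⟩
  have hlim : Tendsto (fun t : ℝ => ENNReal.ofReal ((t / 2) ^ 2)) (𝓝[>] 0) (𝓝 0) := by
    have h : Tendsto (fun t : ℝ => (t / 2) ^ 2) (𝓝[>] 0) (𝓝 0) := by
      have : Continuous fun t : ℝ => (t / 2) ^ 2 := by fun_prop
      simpa using (this.tendsto 0).mono_left nhdsWithin_le_nhds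
    simpa using ENNReal.tendsto_ofReal h
  refine tendsto_of_tendsto_of_tendsto_of_le_of_le' tendsto_const_nhds hlim
    (.of_forall fun _ => zero_le) ?_
  filter_upwards [Ioo_mem_nhdsGT (show (0 : ℝ) < 1 / 2 by norm_num)] with t ht
  set μ : Measure Ω := (P : Measure Ω) + (perturbedLaw P hg hg1 h0 t : Measure Ω)
  have hPμ : (P : Measure Ω) ≪ μ := absolutelyContinuous_add_left
  have hclamp : clamp (1 / 2) t = t :=
    clamp_eq_self (by rw [abs_of_pos ht.1]; exact ht.2.le)
  have hQ : (perturbedLaw P hg hg1 h0 t : Measure Ω).rnDeriv μ =ᵐ[μ]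
      fun x => ENNReal.ofReal (1 + clamp (1 / 2) t * g x) * (P : Measure Ω).rnDeriv μ x :=
    Measure.rnDeriv_withDensity_left_of_absolutelyContinuous hPμ (by fun_prop)
  calc _ ≤ ∫⁻ x, ENNReal.ofReal ((t / 2) ^ 2) * (P : Measure Ω).rnDeriv μ x ∂μ := by
        refine lintegral_mono_ae ?_
        filter_upwards [hQ, Measure.rnDeriv_lt_top (P : Measure Ω) μ] with x hx hx'
        have hd := half_le_density (t := t) (hg1 x)
        rw [hx, ENNReal.toReal_mul, ENNReal.toReal_ofReal (by linarith), hclamp,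
          Real.sqrt_mul (by rw [hclamp] at hd; linarith)]
        obtain ⟨p, hp⟩ : ∃ p, p = ((P : Measure Ω).rnDeriv μ x).toReal := ⟨_, rfl⟩
        have hp0 : 0 ≤ p := hp ▸ ENNReal.toReal_nonneg
        rw [← ENNReal.ofReal_toReal hx'.ne, ENNReal.toReal_ofReal ENNReal.toReal_nonneg, ← hp,
          ← ENNReal.ofReal_mul (by positivity)]
        refine ENNReal.ofReal_le_ofReal ?_
        have hfac : (√(1 + t * g x) * √p - √p) / t - 1 / 2 * g x * √p
            = (√(1 + t * g x) - 1 - t * g x / 2) / t * √p := by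
          have := ht.1.ne'
          field_simp
        rw [hfac, mul_pow, Real.sq_sqrt hp0]
        refine mul_le_mul_of_nonneg_right ?_ hp0
        have h1 := abs_sqrt_one_add_sub_le (x := t * g x) (by rw [hclamp] at hd; linarith)
        have h2 : |(√(1 + t * g x) - 1 - t * g x / 2) / t| ≤ t / 2 := by
          rw [abs_div, abs_of_pos ht.1, div_le_iff₀ ht.1]
          refine h1.trans ?_
          have : g x ^ 2 ≤ 1 := (sq_le_one_iff_abs_le_one _).2 (hg1 x)
          nlinarith [sq_nonneg t]
        rw [← sq_abs]
        exact pow_le_pow_left₀ (abs_nonneg _) h2 2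
    _ ≤ ENNReal.ofReal ((t / 2) ^ 2) := by
        rw [lintegral_const_mul _ (Measure.measurable_rnDeriv _ _), Measure.lintegral_rnDeriv hPμ]
        simp

/-- Centred indicators suffice as scores: for a mean-zero function, integrating against one gives
its integral over the set, and these integrals determine it almost everywhere. -/
theorem IsInfluenceFunction.ae_eq_of_perturbedLaw_mem {M : Set (ProbabilityMeasure Ω)}
    {Ψ : ProbabilityMeasure Ω → ℝ} {P : ProbabilityMeasure Ω} {φ ψ : Ω → ℝ}
    (hφ : IsInfluenceFunction M Ψ P φ) (hψ : IsInfluenceFunction M Ψ P ψ)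
    (hM : ∀ (g : Ω → ℝ) (hg : Measurable g) (hg1 : ∀ x, |g x| ≤ 1)
      (h0 : ∫ x, g x ∂(P : Measure Ω) = 0) (t : ℝ), perturbedLaw P hg hg1 h0 t ∈ M) :
    φ =ᵐ[(P : Measure Ω)] ψ := by
  have iφ := hφ.1.integrable one_le_two
  have iψ := hψ.1.integrable one_le_two
  refine ae_eq_of_forall_setIntegral_eq_of_sigmaFinite (fun _ _ _ => iφ.integrableOn)
    (fun _ _ _ => iψ.integrableOn) fun A hA _ => ?_
  set g : Ω → ℝ := fun x => A.indicator (fun _ => 1) x - (P : Measure Ω).real A with hgd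
  have hg : Measurable g := (measurable_const.indicator hA).sub measurable_const
  have hg1 : ∀ x, |g x| ≤ 1 := fun x => by
    have h1 : 0 ≤ (P : Measure Ω).real A := measureReal_nonneg
    have h2 : (P : Measure Ω).real A ≤ 1 := measureReal_le_one
    rw [abs_le]
    by_cases hx : x ∈ A <;> simp only [hgd, hx, Set.indicator_of_mem, Set.indicator_of_notMem,
      not_false_eq_true] <;> constructor <;> linarith
  have h0 : ∫ x, g x ∂(P : Measure Ω) = 0 := by
    rw [integral_sub ((BoundedMeasurable.indicator hA).integrable) (integrable_const _),
      integral_indicator_const _ hA]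
    simp
  have hmul : ∀ χ : Ω → ℝ, Integrable χ (P : Measure Ω) → ∫ x, χ x ∂(P : Measure Ω) = 0 →
      ∫ x, χ x * g x ∂(P : Measure Ω) = ∫ x in A, χ x ∂(P : Measure Ω) := fun χ hχ hχ0 => by
    have h1 : ∀ x, χ x * g x = A.indicator χ x - (P : Measure Ω).real A * χ x := fun x => by
      by_cases hx : x ∈ A <;> simp [hgd, hx] <;> ring
    simp only [h1]
    rw [integral_sub (hχ.indicator hA) (hχ.const_mul _), integral_const_mul, hχ0,
      integral_indicator hA, mul_zero, sub_zero]
  rw [← hmul φ iφ hφ.2.1, ← hmul ψ iψ hψ.2.1]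
  exact tendsto_nhds_unique
    (hφ.2.2 _ g (.of_forall (hM g hg hg1 h0)) (hasScore_perturbedLaw P hg hg1 h0))
    (hψ.2.2 _ g (.of_forall (hM g hg hg1 h0)) (hasScore_perturbedLaw P hg hg1 h0))

end Perturbation

/-! ### Stability of the model under bounded perturbations. -/

namespace GPI

variable {d e : ℕ} {f : ℕ → (Fin d → ℝ) → (Fin e → ℝ)} {δ : ℕ → ℝ}
  {smax : ℕ} {𝒴 : Set ℝ} {P Q : ProbabilityMeasure (Obs d)}

/-- `Q` has a density with respect to `P` with values in `[1/2, 3/2]`. -/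
structure IsComparable (P Q : ProbabilityMeasure (Obs d)) : Prop where
  absolutelyContinuous : (Q : Measure (Obs d)) ≪ (P : Measure (Obs d))
  le : ∀ φ : Obs d → ℝ, BoundedMeasurable φ → (∀ D, 0 ≤ φ D) →
    ∫ D, φ D ∂(Q : Measure (Obs d)) ≤ 3 / 2 * ∫ D, φ D ∂(P : Measure (Obs d))
  ge : ∀ φ : Obs d → ℝ, BoundedMeasurable φ → (∀ D, 0 ≤ φ D) →
    1 / 2 * ∫ D, φ D ∂(P : Measure (Obs d)) ≤ ∫ D, φ D ∂(Q : Measure (Obs d))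

theorem integral_indicator_eq_measureReal (R : ProbabilityMeasure (Obs d)) {A : Set (Obs d)}
    (hA : MeasurableSet A) : ∫ D, A.indicator (fun _ => (1 : ℝ)) D ∂(R : Measure (Obs d))
      = (R : Measure (Obs d)).real A := by
  rw [integral_indicator_const _ hA, smul_eq_mul, mul_one]

theorem IsComparable.measureReal_le (h : IsComparable P Q) {A : Set (Obs d)}
    (hA : MeasurableSet A) :
    (Q : Measure (Obs d)).real A ≤ 3 / 2 * (P : Measure (Obs d)).real A := by
  rw [← integral_indicator_eq_measureReal Q hA, ← integral_indicator_eq_measureReal P hA]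
  exact h.le _ (.indicator hA) fun D => Set.indicator_nonneg (fun _ _ => zero_le_one) D

theorem IsComparable.le_measureReal (h : IsComparable P Q) {A : Set (Obs d)}
    (hA : MeasurableSet A) :
    1 / 2 * (P : Measure (Obs d)).real A ≤ (Q : Measure (Obs d)).real A := by
  rw [← integral_indicator_eq_measureReal Q hA, ← integral_indicator_eq_measureReal P hA]
  exact h.ge _ (.indicator hA) fun D => Set.indicator_nonneg (fun _ _ => zero_le_one) D

/-- A ratio of two probabilities: the numerator grows at most by `3/2` and the denominator shrinks
at most by `1/2`, whence the factor `3`. -/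
theorem IsComparable.bern_trtProb_le (h : IsComparable P Q) {s : ℕ} {v : Fin s → Bool}
    (hv : (P : Measure (Obs d)).real (cell s v) ≠ 0) (w : Bool) :
    bern (trtProb Q s v) w ≤ 3 * bern (trtProb P s v) w := by
  have h1 := measureReal_cell_mul_bern P s v w
  have h2 := measureReal_cell_mul_bern Q s v w
  have h3 := h.measureReal_le ((measurableSet_cell s v).inter
    (measurable_treat s (measurableSet_singleton w)))
  have h4 := h.le_measureReal (measurableSet_cell s v)
  have hp : 0 < (P : Measure (Obs d)).real (cell s v) := measureReal_nonneg.lt_of_ne' hv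
  have hb := bern_trtProb_nonneg P s v w
  refine le_of_mul_le_mul_left ?_ (lt_of_lt_of_le (by positivity) h4)
  calc _ = _ := h2
    _ ≤ 3 / 2 * (P : Measure (Obs d)).real (cell s v ∩ {D | treat s D = w}) := h3
    _ = (1 / 2 * (P : Measure (Obs d)).real (cell s v)) * (3 * bern (trtProb P s v) w) := by
        rw [← h1]; ring
    _ ≤ _ := mul_le_mul_of_nonneg_right h4 (by positivity)

theorem integral_mul_ite_treat (hf : ∀ s, Measurable (f s)) (R : ProbabilityMeasure (Obs d))
    (s : ℕ) {φ : Hist e s → ℝ} (hφ : BoundedMeasurable φ) (w : Bool) :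
    ∫ D, φ (hist f s D) * (if treat s D = w then 1 else 0) ∂(R : Measure (Obs d))
      = ∫ D, φ (hist f s D) * bern (propensity R f s (hist f s D)) w ∂(R : Measure (Obs d)) := by
  have hb : ∀ w', BoundedMeasurable fun h => φ h * (if w' = w then (1 : ℝ) else 0) :=
    fun w' => hφ.mul (.const _)
  obtain ⟨C, hC⟩ := (BoundedMeasurable.uncurry_bool hb).bounded
  rw [integral_histTreat hf s (φ := fun h w' => φ h * if w' = w then 1 else 0)
    (fun w' => (hb w').measurable) (fun h w' => hC (h, w'))]
  refine integral_congr_ae (.of_forall fun D => ?_)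
  beta_reduce
  rw [Finset.sum_eq_single w (fun w' _ hw' => by rw [if_neg hw', mul_zero, mul_zero])
    (fun h => absurd (Finset.mem_univ _) h), if_pos rfl]
  ring

/-- The conditioning history is continuous, so the ratio argument is integrated over the set of
histories violating the bound. Passing from `Q` to `P` and back costs `3/2` and `1/2`, which gives
`1/3` and shows that this set is null. -/
theorem IsComparable.le_bern_propensity (h : IsComparable P Q) (hf : ∀ s, Measurable (f s))
    (s : ℕ) (w : Bool) : ∀ᵐ D ∂(Q : Measure (Obs d)),
      1 / 3 * bern (propensity P f s (hist f s D)) w ≤ bern (propensity Q f s (hist f s D)) w := by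
  classical
  have bP := boundedMeasurable_bern_propensity P f s w
  have bQ := boundedMeasurable_bern_propensity Q f s w
  have b3 := (BoundedMeasurable.const (1 / 3 : ℝ)).mul bP
  have hH := measurable_hist (d := d) hf s
  set φ : Hist e s → ℝ := fun x =>
    if bern (propensity Q f s x) w < 1 / 3 * bern (propensity P f s x) w then 1 else 0 with hφd
  have bφ : BoundedMeasurable φ := .ite (measurableSet_lt bQ.measurable b3.measurable)
  have hφ0 : ∀ x, 0 ≤ φ x := fun x => by simp only [hφd]; split_ifs <;> simp
  have hPn : ∀ x : Hist e s, 0 ≤ bern (propensity P f s x) w := fun x =>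
    bern_nonneg (propensity_nonneg _ _) (propensity_le_one _ _) w
  have hle := h.le _ ((bφ.mul bP).comp hH) fun D => mul_nonneg (hφ0 _) (hPn _)
  have bT : BoundedMeasurable fun D : Obs d => φ (hist f s D) * (if treat s D = w then 1 else 0) :=
    (bφ.comp hH).mul (.ite (measurable_treat s (measurableSet_singleton w)))
  have hge := h.ge _ bT fun D => mul_nonneg (hφ0 _) (by split_ifs <;> simp)
  rw [integral_mul_ite_treat hf P s bφ w, integral_mul_ite_treat hf Q s bφ w] at hge
  set ψ : Hist e s → ℝ := fun x =>
    φ x * (1 / 3 * bern (propensity P f s x) w - bern (propensity Q f s x) w) with hψd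
  have bψ : BoundedMeasurable ψ := bφ.mul (b3.sub bQ)
  have hψ0 : ∀ x, 0 ≤ ψ x := fun x => by
    simp only [hψd, hφd]
    split_ifs with hx
    · linarith
    · simp
  have hint : ∫ D, ψ (hist f s D) ∂(Q : Measure (Obs d)) ≤ 0 := by
    have e1 : ∫ D, ψ (hist f s D) ∂(Q : Measure (Obs d))
        = ∫ D, (1 / 3 * (φ (hist f s D) * bern (propensity P f s (hist f s D)) w)
          - φ (hist f s D) * bern (propensity Q f s (hist f s D)) w) ∂(Q : Measure (Obs d)) := by
      refine integral_congr_ae (.of_forall fun D => ?_)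
      simp only [hψd]
      ring
    rw [e1, integral_sub (by exact ((BoundedMeasurable.const _).mul ((bφ.mul bP).comp hH)).integrable)
      (by exact ((bφ.mul bQ).comp hH).integrable), integral_const_mul]
    linarith
  have hzero := (integral_eq_zero_iff_of_nonneg (fun D => hψ0 (hist f s D))
    (bψ.comp hH).integrable).1 (le_antisymm hint (integral_nonneg fun D => hψ0 _))
  filter_upwards [hzero] with D hD
  by_contra hlt
  have hlt' := not_le.1 hlt
  have : ψ (hist f s D) = 0 := hD
  simp only [hψd, hφd, if_pos hlt', one_mul] at this
  linarith

theorem IsComparable.mem_model (h : IsComparable P Q) (hf : ∀ s, Measurable (f s))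
    (hP : P ∈ model smax 𝒴 f) : Q ∈ model smax 𝒴 f := by
  have hac := h.absolutelyContinuous.ae_le
  obtain ⟨hl, hY, c, hc, hov⟩ := hP
  -- One factor `3` is lost in the propensities and one in the treatment probabilities.
  refine ⟨hac hl, hac hY, c / 9, by positivity, ?_⟩
  have hprop : ∀ᵐ D ∂(Q : Measure (Obs d)), ∀ s w,
      1 / 3 * bern (propensity P f s (hist f s D)) w ≤ bern (propensity Q f s (hist f s D)) w :=
    ae_all_iff.2 fun s => ae_all_iff.2 fun w => h.le_bern_propensity hf s w
  filter_upwards [hac hov, hac (ae_cell_ne_zero P), hprop] with D hD hcell hpr s hs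
  have key : ∀ w, c / 9 * bern (trtProb Q s (treatHist s D)) w
      ≤ bern (propensity Q f s (hist f s D)) w := fun w => by
    have h1 := bern_overlap (hD s hs).1 (hD s hs).2 w
    have h2 := h.bern_trtProb_le (hcell s hs) w
    have h3 := hpr s w
    have h4 := mul_le_mul_of_nonneg_left h2 hc.le
    linarith
  exact ⟨by simpa [bern] using key true, by simpa [bern] using key false⟩

theorem perturbedLaw_mem_model (hf : ∀ s, Measurable (f s)) (hP : P ∈ model smax 𝒴 f)
    {g : Obs d → ℝ} (hg : Measurable g) (hg1 : ∀ x, |g x| ≤ 1)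
    (h0 : ∫ x, g x ∂(P : Measure (Obs d)) = 0) (t : ℝ) :
    perturbedLaw P hg hg1 h0 t ∈ model smax 𝒴 f :=
  IsComparable.mem_model ⟨perturbedMeasure_absolutelyContinuous t,
    fun _ => integral_perturbedMeasure_le hg hg1 t,
    fun _ => le_integral_perturbedMeasure hg hg1 t⟩ hf hP

end GPI

end

theorem theorem2 {d e : ℕ} (smax : ℕ) (𝒴 : Set ℝ) (h𝒴 : Bornology.IsBounded 𝒴)
    (f : ℕ → (Fin d → ℝ) → (Fin e → ℝ)) (hf : ∀ s, Measurable (f s))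
    (δ : ℕ → ℝ) (hδ : ∀ s < smax, 0 < δ s)
    (P : ProbabilityMeasure (GPI.Obs d)) (hP : P ∈ GPI.model smax 𝒴 f) :
    IsInfluenceFunction (GPI.model smax 𝒴 f) (GPI.target smax f δ) P
        (GPI.influence smax f δ P) ∧
      ∀ φ : GPI.Obs d → ℝ,
        IsInfluenceFunction (GPI.model smax 𝒴 f) (GPI.target smax f δ) P φ →
          φ =ᵐ[(P : Measure (GPI.Obs d))] GPI.influence smax f δ P := by
  have h := GPI.isInfluenceFunction_influence h𝒴 hf hδ hP
  exact ⟨h, fun φ hφ => hφ.ae_eq_of_perturbedLaw_mem h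
    fun g hg hg1 h0 t => GPI.perturbedLaw_mem_model hf hP hg hg1 h0 t⟩
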